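/- Let $n\ge 2$ and $\zeta=\exp(\pi\sqrt{-1}/n)$. Let $(x_0,x_1,\dots,x_{n-1})$ and $(y_0,y_1,\dots,y_{n-1})$ be the coordinates on the $B$-model moduli space related, where $x_1,\dots,x_{n-1}\neq 0$, by $y_0=x_0$ and $y_i=x_{i-1}x_i^{-2}x_{i+1}$ for $1\le i<n$, where in the last formula the end factors $x_0$ (for $i=1$) and $x_n$ (for $i=n-1$) are read as $1$; the $x_i$ are coordinates on the uniformizing chart at the large-radius limit point $x=0$ of $[\mathbb C^2/\mathbb Z_n]$, and $y=0$ is the large-radius limit point of the crepant resolution $Y$. *Flat coordinates of $[\mathbb C^2/\mathbb Z_n]$.* For $k=(k_1,\dots,k_{n-1})\in\mathbb Z_{\ge0}^{n-1}$ put $D_0(k)=-\frac1n\sum_{i}(n-i)k_i$ and $D_n(k)=-\frac1n\sum_i i k_i$. For $1\le r<n$, $$f^r(x)=\sum_{k:\ \langle -D_n(k)\rangle=r/n}\frac{x_1^{k_1}\cdots x_{n-1}^{k_{n-1}}}{k_1!\cdots k_{n-1}!}\,\frac{\Gamma(\langle D_0(k)\rangle)}{\Gamma(1+D_0(k))}\,\frac{\Gamma(\langle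 D_n(k)\rangle)}{\Gamma(1+D_n(k))},$$ where $\langle\cdot\rangle$ is the fractional part; these series converge absolutely near $x=0$. *Flat coordinates of $Y$.* Let $\omega_j=\gamma_{j-1}-2\gamma_j+\gamma_{j+1}+\delta_{j,0}\lambda_1+\delta_{j,n}\lambda_2$ for $0\le j\le n$ (with $\gamma_i$ omitted unless $1\le i<n$) and $H_T^\bullet(Y;\mathbb C)=\mathbb C[\lambda_1,\lambda_2,\gamma_1,\dots,\gamma_{n-1}]/\langle\omega_i\omega_j: i-j>1\rangle$. With $D'_j(d)=d_{j-1}-2d_j+d_{j+1}$ (where $d_i$ is read as $0$ unless $1\le i<n$), the $I$-function of $Y$, expanded at $z=\infty$, is $$I_Y(y,z)=z\,e^{y_0/z}\prod_{i=1}^{n-1}e^{\gamma_i\log y_i/z}\sum_{d_1,\dots,d_{n-1}\ge0}\ \prod_{j=0}^n\frac{\prod_{m\le 0}(\omega_j+mz)}{\prod_{m\le D'_j(d)}(\omega_j+mz)}\;y_1^{d_1}\cdots y_{n-1}^{d_{n-1}} .$$ For $y_1,\dots,y_{n-1}$ nonzero and sufficiently small, $I_Y(y,z)=z+g^0(y)\cdot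 1+\sum_{i=1}^{n-1}g^i(y)\gamma_i+O(z^{-1})$, which defines the (multi-valued) flat coordinates $g^i(y)$ of $Y$; their principal branches are those with $\log y_i$ principal. *Claim.* There is a path from the large-radius limit point of $Y$ to the large-radius limit point of $[\mathbb C^2/\mathbb Z_n]$, which after its starting point avoids the discriminant locus of $W(\kappa)=\kappa^n+x_{n-1}\kappa^{n-1}+\cdots+x_1\kappa+1$ and near its starting point lies in the domain where the $y_i$ are coordinates and the principal branches of $\log y_i$ are analytic, such that for every $1\le i<n$ the principal branch of $g^i$ continues analytically along the path, and near $x=0$ the continuation is $$g^i=-\frac{2\pi\sqrt{-1}}{n}+\frac1n\sum_{k=1}^{n-1}\zeta^{2ki}\bigl(\zeta^{-k}-\zeta^{k}\bigr)f^k(x).$$ -/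

import Mathlib

open Filter Topology

noncomputable section

namespace TypeACrepant

/-- The component `v_j`, `1 ≤ j < n`, of a tuple `v = (v_1, …, v_{n-1})`; it takes the value `e` at
all other indices `j`. -/
def entry {R : Type} (n : ℕ) (e : R) (v : Fin (n - 1) → R) (j : ℕ) : R :=
  if h : 1 ≤ j ∧ j < n then v ⟨j - 1, by omega⟩ else e

/-- Coordinate space for the `B`-model moduli space: a point is `(x_0, (x_1, …, x_{n-1}))`
(coordinates of the uniformizing chart `ℂ × ℂ^{n-1} → ℂ × ℂ^{n-1} / μ_n` at the large-radius limit
point of `[ℂ²/ℤ_n]`), or `(y_0, (y_1, …, y_{n-1}))` (coordinates of the chart at the large-radius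
limit point of `Y`). In both charts the large-radius limit point is the origin. -/
abbrev Chart (n : ℕ) : Type := ℂ × (Fin (n - 1) → ℂ)

/-- The change of coordinates: `y_0 = x_0` and `y_i = x_{i-1} x_i⁻² x_{i+1}` for `1 ≤ i < n`, where
in the latter formula the (absent) end factors, with index `0` and `n`, are `1`. -/
def xToY (n : ℕ) (x : Chart n) : Chart n :=
  (x.1, fun j => entry n 1 x.2 (j : ℕ) * (entry n 1 x.2 (j + 1) ^ 2)⁻¹ * entry n 1 x.2 (j + 2))

/-- `W_𝒳(κ) = κ^n + x_{n-1} κ^{n-1} + ⋯ + x_1 κ + 1`. Its discriminant locus is the singular locus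
of the Picard–Fuchs system. -/
def WX (n : ℕ) (x : Chart n) : Polynomial ℂ :=
  Polynomial.X ^ n
    + ∑ k ∈ Finset.Icc 1 (n - 1), Polynomial.C (entry n 0 x.2 k) * Polynomial.X ^ k + 1

/-! ### Flat coordinates for `[ℂ²/ℤ_n]` -/

/-- `D_0(k) = -(1/n) ∑ (n-i) k_i`. -/
def DX0 (n : ℕ) (k : Fin (n - 1) → ℕ) : ℝ :=
  -(1 / (n : ℝ)) * ∑ i ∈ Finset.Icc 1 (n - 1), ((n : ℝ) - (i : ℝ)) * ((entry n 0 k i : ℕ) : ℝ)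

/-- `D_n(k) = -(1/n) ∑ i k_i`. -/
def DXn (n : ℕ) (k : Fin (n - 1) → ℕ) : ℝ :=
  -(1 / (n : ℝ)) * ∑ i ∈ Finset.Icc 1 (n - 1), (i : ℝ) * ((entry n 0 k i : ℕ) : ℝ)

/-- The term with exponent `k` of the series `f^r(x)`, `1 ≤ r < n`. -/
def flatXTerm (n : ℕ) (x : Chart n) (k : Fin (n - 1) → ℕ) : ℂ :=
  (∏ j, x.2 j ^ k j / ((k j).factorial : ℂ))
    * ((Real.Gamma (Int.fract (DX0 n k)) / Real.Gamma (1 + DX0 n k) : ℝ) : ℂ)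
    * ((Real.Gamma (Int.fract (DXn n k)) / Real.Gamma (1 + DXn n k) : ℝ) : ℂ)

/-- The exponents of the series `f^r(x)`: those `k` for which the fractional part of
`b(k) = (1/n) ∑ i k_i` is `r/n`. -/
abbrev FlatXIndex (n r : ℕ) : Type :=
  {k : Fin (n - 1) → ℕ // Int.fract (-DXn n k) = (r : ℝ) / (n : ℝ)}

/-- The flat coordinates `f^0(x) = x_0` and `f^r(x)`, `1 ≤ r < n`, for `[ℂ²/ℤ_n]`. -/
def flatX (n r : ℕ) (x : Chart n) : ℂ :=
  if r = 0 then x.1 else ∑' k : FlatXIndex n r, flatXTerm n x k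

/-! ### The `I`-function and the flat coordinates for `Y` -/

/-- The polynomial ring `ℂ[λ_1, λ_2, γ_1, …, γ_{n-1}]`. -/
abbrev PolyY (n : ℕ) : Type := MvPolynomial (Fin 2 ⊕ Fin (n - 1)) ℂ

/-- `ω_j = γ_{j-1} - 2 γ_j + γ_{j+1}`, plus `λ_1` if `j = 0` and plus `λ_2` if `j = n`; here
`γ_i` is omitted unless `1 ≤ i < n`. -/
def omegaPoly (n j : ℕ) : PolyY n :=
  (if j = 0 then MvPolynomial.X (Sum.inl 0) else 0)
    + (if j = n then MvPolynomial.X (Sum.inl 1) else 0)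
    + ((if j = 0 then 0 else entry n 0 (fun i => MvPolynomial.X (Sum.inr i)) (j - 1))
      - 2 * entry n 0 (fun i => MvPolynomial.X (Sum.inr i)) j
      + entry n 0 (fun i => MvPolynomial.X (Sum.inr i)) (j + 1))

/-- The ideal `⟨ω_i ω_j : i - j > 1⟩`, `0 ≤ i, j ≤ n`. -/
def relY (n : ℕ) : Ideal (PolyY n) :=
  Ideal.span {p | ∃ i j : ℕ, i ≤ n ∧ j + 1 < i ∧ p = omegaPoly n i * omegaPoly n j}

/-- The `T`-equivariant cohomology ring
`H_T(Y; ℂ) = ℂ[λ_1, λ_2, γ_1, …, γ_{n-1}] / ⟨ω_i ω_j : i - j > 1⟩`. -/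
def HTY (n : ℕ) : Type := PolyY n ⧸ relY n

instance (n : ℕ) : CommRing (HTY n) := inferInstanceAs (CommRing (PolyY n ⧸ relY n))

instance (n : ℕ) : Algebra ℂ (HTY n) := inferInstanceAs (Algebra ℂ (PolyY n ⧸ relY n))

instance (n : ℕ) : Algebra ℚ (HTY n) := inferInstanceAs (Algebra ℚ (PolyY n ⧸ relY n))

/-- The quotient map `ℂ[λ_1, λ_2, γ_1, …, γ_{n-1}] → H_T(Y; ℂ)`. -/
def toHTY (n : ℕ) : PolyY n →ₐ[ℂ] HTY n := Ideal.Quotient.mkₐ ℂ (relY n)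

/-- The class `γ_i`, where `γ_0 = 1`. -/
def gammaClass (n : ℕ) (i : ℕ) : HTY n :=
  toHTY n (entry n 1 (fun k => MvPolynomial.X (Sum.inr k)) i)

/-- The class `ω_j`. -/
def omegaClass (n : ℕ) (j : ℕ) : HTY n := toHTY n (omegaPoly n j)

/-- Laurent expansions at `z = ∞`: the variable of the Laurent series is `z⁻¹`. -/
abbrev LaurentY (n : ℕ) : Type := LaurentSeries (HTY n)

/-- A class as a constant Laurent series. -/
def constY (n : ℕ) (a : HTY n) : LaurentY n := HahnSeries.C a

/-- The variable `z`. -/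
def zVar (n : ℕ) : LaurentY n := HahnSeries.single (-1) 1

/-- `a + m z` is a unit for every class `a` and every integer `m ≠ 0`. -/
theorem isUnit_const_add (n : ℕ) (a : HTY n) (m : ℤ) (hm : m ≠ 0) :
    IsUnit (constY n a + (m : LaurentY n) * zVar n) := by
  have h1 : zVar n * HahnSeries.single (1 : ℤ) (1 : HTY n) = 1 := by simp [zVar]
  have e : constY n a + (m : LaurentY n) * zVar n
      = zVar n * HahnSeries.ofPowerSeries ℤ (HTY n)
          (PowerSeries.C (m : HTY n) + PowerSeries.C a * PowerSeries.X) := by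
    have hm' : (m : LaurentY n) = HahnSeries.C (m : HTY n) := by simp
    simp only [map_add, map_mul, HahnSeries.ofPowerSeries_C, HahnSeries.ofPowerSeries_X, constY]
    rw [hm']
    linear_combination -(HahnSeries.C a) * h1
  rw [e]
  refine (IsUnit.of_mul_eq_one _ h1).mul (IsUnit.map _ ?_)
  rw [PowerSeries.isUnit_iff_constantCoeff]
  have h2 : (m : HTY n) = algebraMap ℂ (HTY n) m := by simp
  simp only [map_add, map_mul, PowerSeries.constantCoeff_C, PowerSeries.constantCoeff_X, mul_zero,
    add_zero, h2]
  exact (IsUnit.mk0 (m : ℂ) (by exact_mod_cast hm)).map _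

/-- `exp (a / z)`. -/
def expOverZ (n : ℕ) (a : HTY n) : LaurentY n :=
  HahnSeries.ofPowerSeries ℤ (HTY n) (PowerSeries.rescale a (PowerSeries.exp (HTY n)))

/-- `D'_j(d) = d_{j-1} - 2 d_j + d_{j+1}`, where `d_i` is read as `0` unless `1 ≤ i < n`. -/
def DY (n : ℕ) (d : Fin (n - 1) → ℕ) (j : ℕ) : ℤ :=
  (if j = 0 then 0 else ((entry n 0 d (j - 1) : ℕ) : ℤ)) - 2 * ((entry n 0 d j : ℕ) : ℤ) + ((entry n 0 d (j + 1) : ℕ) : ℤ)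

/-- `∏_{m ≤ 0} (ω_j + m z) / ∏_{m ≤ D} (ω_j + m z)` after cancellation: it is
`∏_{D < m ≤ 0} (ω_j + m z) / ∏_{0 < m ≤ D} (ω_j + m z)`. The denominator is a unit by
`isUnit_const_add`. -/
def hyperFactor (n : ℕ) (j : ℕ) (D : ℤ) : LaurentY n :=
  (∏ m ∈ Finset.Ioc D 0, (constY n (omegaClass n j) + (m : LaurentY n) * zVar n))
    * Ring.inverse
      (∏ m ∈ Finset.Ioc 0 D, (constY n (omegaClass n j) + (m : LaurentY n) * zVar n))

/-- The `d`-th term of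
`I_Y(y, z) = z e^{y_0/z} ∏_i y_i^{γ_i/z} ∑_d ∏_j (⋯) y_1^{d_1} ⋯ y_{n-1}^{d_{n-1}}`, with
`y_i^{γ_i/z} = exp (γ_i log y_i / z)` and the principal branch of the logarithms. -/
def IYTerm (n : ℕ) (y : Chart n) (d : Fin (n - 1) → ℕ) : LaurentY n :=
  zVar n * expOverZ n (algebraMap ℂ (HTY n) y.1)
    * (∏ i : Fin (n - 1), expOverZ n (Complex.log (y.2 i) • gammaClass n (i + 1)))
    * (∏ j ∈ Finset.range (n + 1), hyperFactor n j (DY n d j))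
    * constY n (algebraMap ℂ (HTY n) (∏ i : Fin (n - 1), y.2 i ^ d i))

/-- The coefficient of `z^N` in `I_Y(y, z)` converges to the class `s`. Convergence in `H_T(Y; ℂ)`
is convergence of all components, that is, of the values of all `ℂ`-linear functionals. -/
def HasCoeffIY (n : ℕ) (y : Chart n) (N : ℤ) (s : HTY n) : Prop :=
  ∀ φ : HTY n →ₗ[ℂ] ℂ,
    HasSum (fun d : Fin (n - 1) → ℕ => φ ((IYTerm n y d).coeff (-N))) (φ s)

/-- The functions `g^0, …, g^{n-1}` are (the principal branches of) the flat coordinates for `Y`: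
`I_Y(y, z) = z + g^0(y) γ_0 + ⋯ + g^{n-1}(y) γ_{n-1} + O(z⁻¹)` for all sufficiently small
`y_1, …, y_{n-1} ≠ 0`. -/
def IsFlatY (n : ℕ) (g : ℕ → Chart n → ℂ) : Prop :=
  ∃ δ : ℝ, 0 < δ ∧ ∀ y : Chart n, (∀ j, y.2 j ≠ 0 ∧ ‖y.2 j‖ < δ) →
    (∀ N : ℤ, 1 < N → HasCoeffIY n y N 0) ∧
    HasCoeffIY n y 1 1 ∧
    HasCoeffIY n y 0 (∑ i ∈ Finset.range n, g i y • gammaClass n i)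

/-! ### Paths and analytic continuation -/

/-- `p : (0, 1] → Chart n`, in the `x`-coordinates, is a path in the moduli space from the
large-radius limit point of `Y` (`y = 0`, reached as `t → 0+`) to that of `[ℂ²/ℤ_n]` (`x = 0`, at
`t = 1`) which avoids the discriminant locus for `0 < t ≤ 1`. Near its start it lies where the
`y_i` are coordinates and the principal branches of `log y_i` are analytic. -/
structure IsPathYX (n : ℕ) (p : ℝ → Chart n) : Prop where
  continuousOn : ContinuousOn p (Set.Ioc 0 1)
  regular : ∀ t ∈ Set.Ioc (0 : ℝ) 1, (WX n (p t)).Separable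
  torus : ∀ᶠ t in 𝓝[>] (0 : ℝ), ∀ j, (p t).2 j ≠ 0 ∧ (xToY n (p t)).2 j ∈ Complex.slitPlane
  start : Tendsto (fun t => xToY n (p t)) (𝓝[>] (0 : ℝ)) (𝓝 0)
  finish : p 1 = 0

/-- `F t`, `0 < t ≤ 1`, is an analytic continuation along `p`: `F t` is analytic at `p t`, and for
`s` close to `t` the germ of `F s` at `p s` is that of `F t`. -/
def IsContinuationAlong (n : ℕ) (p : ℝ → Chart n) (F : ℝ → Chart n → ℂ) : Prop :=
  ∀ t ∈ Set.Ioc (0 : ℝ) 1, AnalyticAt ℂ (F t) (p t) ∧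
    ∀ᶠ s in 𝓝[Set.Ioc (0 : ℝ) 1] t, F s =ᶠ[𝓝 (p s)] F t

end TypeACrepant

end

/-!
Write `W = ∏_{j < n} (κ + A_j)` with `A_j = exp U_j`. Both sets of flat coordinates are read off
from the logarithms `U_j` of the negatives of the roots, and these logarithms are analytic and
continue along every path avoiding the discriminant locus (`exists_logRoot`).

For `Y`: at `z = ∞` the `d`-th term of `I_Y` is of order `z^{1 - N}`, where `N` is the number of
negative `D'_j(d)`. As the `D'_j(d)` sum to `0`, only `d = 0` has `N = 0`, and `z⁰` receives the
terms with exactly one negative `D'_J(d)`. The resulting coefficient of `ω_J` is a series in `y`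
whose terms are those of the multivariable expansion of
`log (1 + ∑_{k ≠ J} (x_k / x_J) κ^{k - J})` that do not involve `κ`. If `κ` runs through a circle that separates the roots with indices
`j < J` from the other ones, and if these two groups of roots are far apart, the constant term of
this logarithm is computed from the factorization of `W` and equals `-log (x_J / ∏_{j ≥ J} A_j)`
(`flatYSeries_eq_neg_log`). Taking second differences in `J` leaves `g^i = U_{i-1} - U_i` near
`y = 0` (`exists_flatY_eq_sub`).

For `[ℂ²/ℤ_n]`: near `x = 0` the logarithm of the root with value `κ_0` at `x = 0`, `κ_0^n = -1`,
is a contour integral of `κ⁻¹ log (W(κ) / (κ^n + 1))` about `κ_0`. Expanding the logarithm in `x`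
and integrating term by term produces a power series (`hasSum_logRootTerm`) whose coefficients are
falling products, which are the quotients of values of `Γ` in `f^r` up to sign
(`Gamma_quotients_eq`). Sorting the terms by `∑ i k_i` modulo `n` gives
`log (κ / κ_0) = (1 / n) ∑_r κ_0^r f^r` (`eq_sum_flatX_of_hasSum`).

Along the path the `A_j` are in geometric progression with ratio `exp (-log t + 2 π i t / n)`. As
`t → 0` their absolute values separate and `y_i` is asymptotic to `t`; at `t = 1` they become the
negatives of the `n`-th roots of `-1`. The continuation of `g^i` is therefore `U_{i-1} - U_i`
throughout, and its value at `x = 0` is `-2 π i / n`.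
-/

noncomputable section

namespace TypeACrepant

/-! ### Series and circle integrals -/

theorem summable_prod_pow {ι : Type*} [Fintype ι] (r : ι → ℝ) (h0 : ∀ j, 0 ≤ r j)
    (h1 : ∀ j, r j < 1) : Summable (fun k : ι → ℕ => ∏ j, r j ^ k j) := by
  classical
  refine summable_of_sum_le (c := ∏ j, (1 - r j)⁻¹)
    (fun k => Finset.prod_nonneg fun j _ => pow_nonneg (h0 j) _) fun u => ?_
  obtain ⟨M, hM⟩ : ∃ M, ∀ k ∈ u, ∀ j, k j < M := by
    refine ⟨(u.sup fun k => ∑ j, k j) + 1, fun k hk j => Nat.lt_succ_of_le ?_⟩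
    exact (Finset.single_le_sum (fun _ _ => Nat.zero_le _) (Finset.mem_univ j)).trans
      (Finset.le_sup (f := fun k : ι → ℕ => ∑ j, k j) hk)
  calc ∑ k ∈ u, ∏ j, r j ^ k j
      ≤ ∑ k ∈ Fintype.piFinset (fun _ : ι => Finset.range M), ∏ j, r j ^ k j := by
        refine Finset.sum_le_sum_of_subset_of_nonneg (fun k hk => ?_)
          fun k _ _ => Finset.prod_nonneg fun j _ => pow_nonneg (h0 j) _
        simpa [Fintype.mem_piFinset] using hM k hk
    _ = ∏ j, ∑ m ∈ Finset.range M, r j ^ m := by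
        rw [Finset.prod_univ_sum]
    _ ≤ ∏ j, (1 - r j)⁻¹ := by
        refine Finset.prod_le_prod (fun j _ => Finset.sum_nonneg fun m _ => pow_nonneg (h0 j) _)
          fun j _ => ?_
        rw [← tsum_geometric_of_lt_one (h0 j) (h1 j)]
        exact (summable_geometric_of_lt_one (h0 j) (h1 j)).sum_le_tsum _
          fun m _ => pow_nonneg (h0 j) _

/-- A single term of the multinomial theorem for `(1 + ⋯ + 1)^m`. -/
theorem multinomial_le_card_pow {ι : Type*} [Fintype ι] [DecidableEq ι] (k : ι → ℕ) :
    Nat.multinomial Finset.univ k ≤ Fintype.card ι ^ ∑ j, k j := by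
  have h := Finset.sum_pow_eq_sum_piAntidiag (Finset.univ : Finset ι) (fun _ => (1 : ℕ)) (∑ j, k j)
  simp only [Finset.sum_const, Finset.card_univ, smul_eq_mul, mul_one, one_pow,
    Finset.prod_const_one, Nat.cast_id] at h
  rw [h]
  exact Finset.single_le_sum (f := fun k => Nat.multinomial Finset.univ k)
    (fun _ _ => Nat.zero_le _) (by simp)

/-- The coefficient of `z^k` in the expansion of `log (1 + ∑ z_j)`. -/
def logCoeff {ι : Type*} [Fintype ι] (k : ι → ℕ) : ℂ :=
  if ∑ j, k j = 0 then 0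
  else (-1) ^ (∑ j, k j + 1) * ((∑ j, k j - 1).factorial : ℂ) / ∏ j, ((k j).factorial : ℂ)

theorem logCoeff_eq {ι : Type*} [Fintype ι] [DecidableEq ι] (k : ι → ℕ) :
    logCoeff k = (-1) ^ (∑ j, k j + 1) * (Nat.multinomial Finset.univ k : ℂ) / (∑ j, k j : ℕ) := by
  unfold logCoeff
  split_ifs with h
  · simp [h]
  · have h1 := Nat.multinomial_spec Finset.univ k
    have h2 : (∑ j, k j).factorial = (∑ j, k j) * (∑ j, k j - 1).factorial :=
      (Nat.mul_factorial_pred h).symm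
    rw [h2] at h1
    have h3 : (∏ j, ((k j).factorial : ℂ)) * (Nat.multinomial Finset.univ k : ℂ)
        = ((∑ j, k j : ℕ) : ℂ) * ((∑ j, k j - 1).factorial : ℂ) := by exact_mod_cast h1
    have h4 : ((∑ j, k j : ℕ) : ℂ) ≠ 0 := by exact_mod_cast h
    have h5 : (∏ j, ((k j).factorial : ℂ)) ≠ 0 :=
      Finset.prod_ne_zero_iff.2 fun j _ => by exact_mod_cast Nat.factorial_ne_zero _
    rw [div_eq_div_iff h5 h4]
    linear_combination -(-1) ^ (∑ j, k j + 1) * h3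

theorem norm_logCoeff_le {ι : Type*} [Fintype ι] (k : ι → ℕ) :
    ‖logCoeff k‖ ≤ (Fintype.card ι : ℝ) ^ ∑ j, k j := by
  classical
  rw [logCoeff_eq]
  have h2 : (Nat.multinomial Finset.univ k : ℝ) ≤ (Fintype.card ι : ℝ) ^ ∑ j, k j := by
    exact_mod_cast multinomial_le_card_pow k
  rw [norm_div, norm_mul, norm_pow, norm_neg, norm_one, one_pow, one_mul, Complex.norm_natCast,
    Complex.norm_natCast]
  rcases Nat.eq_zero_or_pos (∑ j, k j) with h | h
  · simp [h]
  · exact (div_le_self (Nat.cast_nonneg _) (by exact_mod_cast h)).trans h2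

theorem norm_logCoeff_mul_prod_le {ι : Type*} [Fintype ι] {c : ℝ} (z : ι → ℂ)
    (hz : ∀ j, Fintype.card ι * ‖z j‖ ≤ c) (k : ι → ℕ) :
    ‖logCoeff k * ∏ j, z j ^ k j‖ ≤ ∏ j, c ^ k j := by
  calc ‖logCoeff k * ∏ j, z j ^ k j‖
      ≤ (Fintype.card ι : ℝ) ^ (∑ j, k j) * ∏ j, ‖z j‖ ^ k j := by
        rw [norm_mul, norm_prod]
        simp only [norm_pow]
        exact mul_le_mul_of_nonneg_right (norm_logCoeff_le k)
          (Finset.prod_nonneg fun j _ => by positivity)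
    _ = ∏ j, (Fintype.card ι * ‖z j‖) ^ k j := by
        rw [← Finset.prod_pow_eq_pow_sum, ← Finset.prod_mul_distrib]
        simp only [mul_pow]
    _ ≤ _ := Finset.prod_le_prod (fun j _ => by positivity)
        fun j _ => pow_le_pow_left₀ (by positivity) (hz j) _

/-- The multivariable Taylor expansion of `log (1 + ∑ z_j)`: in that of `log (1 + w)`, the powers of
`w = ∑ z_j` are expanded by the multinomial theorem. -/
theorem hasSum_log_one_add_sum {ι : Type*} [Fintype ι] {c : ℝ} (hc0 : 0 ≤ c) (hc : c < 1)
    (z : ι → ℂ) (hz : ∀ j, Fintype.card ι * ‖z j‖ ≤ c) :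
    HasSum (fun k : ι → ℕ => logCoeff k * ∏ j, z j ^ k j) (Complex.log (1 + ∑ j, z j)) := by
  classical
  have hsum : Summable (fun k : ι → ℕ => logCoeff k * ∏ j, z j ^ k j) :=
    Summable.of_norm_bounded (summable_prod_pow (fun _ => c) (fun _ => hc0) fun _ => hc)
      (norm_logCoeff_mul_prod_le z hz)
  have hlt : ‖∑ j, z j‖ < 1 := by
    rcases isEmpty_or_nonempty ι with h | h
    · simp
    · have hcard : (0 : ℝ) < Fintype.card ι := by exact_mod_cast Fintype.card_pos
      calc ‖∑ j, z j‖ ≤ ∑ j, ‖z j‖ := norm_sum_le _ _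
        _ ≤ ∑ _j : ι, c / Fintype.card ι :=
          Finset.sum_le_sum fun j _ => by rw [le_div_iff₀ hcard, mul_comm]; exact hz j
        _ = c := by simp; field_simp
        _ < 1 := hc
  have h1 := Complex.hasSum_taylorSeries_log hlt
  let e := Equiv.sigmaFiberEquiv (fun k : ι → ℕ => ∑ j, k j)
  have h2 : HasSum (fun p : Σ m, {k : ι → ℕ // ∑ j, k j = m} =>
      logCoeff (e p) * ∏ j, z j ^ (e p) j) (∑' k : ι → ℕ, logCoeff k * ∏ j, z j ^ k j) :=
    (e.hasSum_iff (f := fun k : ι → ℕ => logCoeff k * ∏ j, z j ^ k j)).2 hsum.hasSum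
  have h3 : HasSum (fun m : ℕ => (-1) ^ (m + 1) * (∑ j, z j) ^ m / m)
      (∑' k : ι → ℕ, logCoeff k * ∏ j, z j ^ k j) := by
    refine h2.sigma fun m => ?_
    have h4 : (-1 : ℂ) ^ (m + 1) * (∑ j, z j) ^ m / m
        = ∑ k ∈ Finset.piAntidiag Finset.univ m, logCoeff k * ∏ j, z j ^ k j := by
      rw [Finset.sum_pow_eq_sum_piAntidiag, Finset.mul_sum, Finset.sum_div]
      refine Finset.sum_congr rfl fun k hk => ?_
      have hk' : ∑ j, k j = m := by simpa using hk
      rw [logCoeff_eq, hk']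
      ring
    rw [h4]
    have hset : ∀ k : ι → ℕ, k ∈ Finset.piAntidiag Finset.univ m ↔ ∑ j, k j = m := by simp
    have h5 := (Finset.piAntidiag (Finset.univ : Finset ι) m).hasSum
      (fun k => logCoeff k * ∏ j, z j ^ k j)
    let e2 : {k : ι → ℕ // ∑ j, k j = m} ≃
        {k // k ∈ Finset.piAntidiag (Finset.univ : Finset ι) m} :=
      Equiv.subtypeEquivRight fun k => (hset k).symm
    exact (e2.hasSum_iff).2 h5
  rw [h1.unique h3]
  exact hsum.hasSum

theorem hasSum_circleIntegral {ι : Type*} [Countable ι] {f : ι → ℂ → ℂ} {g : ℂ → ℂ} {c : ℂ} {R : ℝ}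
    (hR : 0 ≤ R) {b : ι → ℝ} (hb : Summable b)
    (hf : ∀ i, ContinuousOn (f i) (Metric.sphere c R))
    (hfb : ∀ i, ∀ z ∈ Metric.sphere c R, ‖f i z‖ ≤ b i)
    (hfg : ∀ z ∈ Metric.sphere c R, HasSum (fun i => f i z) (g z)) :
    HasSum (fun i => ∮ z in C(c, R), f i z) (∮ z in C(c, R), g z) := by
  have hmem : ∀ θ, circleMap c R θ ∈ Metric.sphere c R := circleMap_mem_sphere c hR
  refine intervalIntegral.hasSum_integral_of_dominated_convergence
    (fun i _ => R * b i) (fun i => ?_) (fun i => ?_) ?_ ?_ ?_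
  · have : Continuous fun θ : ℝ => deriv (circleMap c R) θ • f i (circleMap c R θ) := by
      have h1 : Continuous fun θ : ℝ => f i (circleMap c R θ) :=
        (hf i).comp_continuous (continuous_circleMap c R) hmem
      simp only [deriv_circleMap]
      have h2 := continuous_circleMap 0 R
      exact (h2.mul continuous_const).smul h1
    exact this.aestronglyMeasurable
  · refine Eventually.of_forall fun θ _ => ?_
    rw [norm_smul]
    simp only [deriv_circleMap, norm_mul, norm_circleMap_zero, Complex.norm_I, mul_one,
      abs_of_nonneg hR]
    exact mul_le_mul_of_nonneg_left (hfb i _ (hmem θ)) hR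
  · exact Eventually.of_forall fun θ _ => hb.mul_left _
  · exact continuous_const.intervalIntegrable _ _
  · exact Eventually.of_forall fun θ _ => (hfg _ (hmem θ)).const_smul _

/-- The logarithm is additive here without a multiple of `2 π i`, since the imaginary part of the
sum of the logarithms is at most `3 / 2 < π`. -/
theorem log_prod_one_add {ι : Type*} (s : Finset ι) (z : ι → ℂ) (hz : ∀ j ∈ s, ‖z j‖ ≤ 1 / 2)
    (hs : ∑ j ∈ s, ‖z j‖ ≤ 1) :
    Complex.log (∏ j ∈ s, (1 + z j)) = ∑ j ∈ s, Complex.log (1 + z j) := by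
  have h1 : ∏ j ∈ s, (1 + z j) = Complex.exp (∑ j ∈ s, Complex.log (1 + z j)) := by
    rw [Complex.exp_sum]
    refine Finset.prod_congr rfl fun j hj => (Complex.exp_log fun h => ?_).symm
    have : z j = -1 := by linear_combination h
    have h2 := hz j hj
    rw [this] at h2
    norm_num at h2
  have h2 : ‖∑ j ∈ s, Complex.log (1 + z j)‖ ≤ 3 / 2 := by
    calc ‖∑ j ∈ s, Complex.log (1 + z j)‖ ≤ ∑ j ∈ s, ‖Complex.log (1 + z j)‖ := norm_sum_le _ _
      _ ≤ ∑ j ∈ s, (3 / 2) * ‖z j‖ :=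
        Finset.sum_le_sum fun j hj => Complex.norm_log_one_add_half_le_self (hz j hj)
      _ = (3 / 2) * ∑ j ∈ s, ‖z j‖ := by rw [Finset.mul_sum]
      _ ≤ 3 / 2 := by linarith
  have h3 := (Complex.abs_im_le_norm _).trans h2
  have h4 := abs_le.1 h3
  have := Real.pi_gt_three
  rw [h1, Complex.log_exp] <;> linarith

/-! ### The polynomial `W` and its roots -/

open Polynomial in
theorem coeff_WX {n : ℕ} (hn : 2 ≤ n) (x : Chart n) {k : ℕ} (hk : k ≤ n) :
    (WX n x).coeff k = entry n 1 x.2 k := by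
  simp only [WX, coeff_add, coeff_X_pow, finsetSum_coeff, coeff_C_mul, coeff_one, mul_ite, mul_one,
    mul_zero]
  rw [Finset.sum_ite_eq]
  unfold entry
  rcases Nat.eq_zero_or_pos k with rfl | h0
  · simp [show ¬ 0 = n by omega]
  rcases hk.eq_or_lt with rfl | h1
  · simp [h0.ne']
  · have : 1 ≤ k ∧ k < n := ⟨h0, h1⟩
    have h2 : k ≤ n - 1 := by omega
    simp [this, h1.ne, h0.ne', h2]

open Polynomial in
theorem natDegree_WX_le {n : ℕ} (hn : 2 ≤ n) (x : Chart n) : (WX n x).natDegree ≤ n := by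
  unfold WX
  refine natDegree_add_le_of_degree_le (natDegree_add_le_of_degree_le (by simp) ?_) (by simp)
  refine natDegree_sum_le_of_forall_le _ _ fun k hk => ?_
  have := Finset.mem_Icc.1 hk
  exact (natDegree_C_mul_X_pow_le _ _).trans (by omega)

open Polynomial in
theorem monic_WX {n : ℕ} (hn : 2 ≤ n) (x : Chart n) : (WX n x).Monic :=
  monic_of_natDegree_le_of_coeff_eq_one n (natDegree_WX_le hn x) (by
    rw [coeff_WX hn x le_rfl]; simp [entry])

open Polynomial in
/-- The polynomial `∏_{j < n} (X + A_j)`. -/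
def rootProd (n : ℕ) (A : ℕ → ℂ) : Polynomial ℂ := ∏ j ∈ Finset.range n, (X + C (A j))

open Polynomial in
theorem monic_rootProd (n : ℕ) (A : ℕ → ℂ) : (rootProd n A).Monic :=
  monic_prod_of_monic _ _ fun _ _ => monic_X_add_C _

open Polynomial in
theorem natDegree_rootProd (n : ℕ) (A : ℕ → ℂ) : (rootProd n A).natDegree = n := by
  unfold rootProd
  rw [natDegree_prod_of_monic _ _ fun _ _ => monic_X_add_C _]
  simp

theorem coeff_zero_rootProd (n : ℕ) (A : ℕ → ℂ) :
    (rootProd n A).coeff 0 = ∏ j ∈ Finset.range n, A j := by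
  simp [rootProd, Polynomial.coeff_zero_eq_eval_zero, Polynomial.eval_prod]

/-- The point of the moduli space with `x_0 = 0` at which `W` is `∏_{j < n} (X + A_j)`. -/
def chartOfRoots (n : ℕ) (A : ℕ → ℂ) : Chart n := (0, fun k => (rootProd n A).coeff (k + 1))

theorem WX_chartOfRoots {n : ℕ} (hn : 2 ≤ n) {A : ℕ → ℂ} (hA : ∏ j ∈ Finset.range n, A j = 1) :
    WX n (chartOfRoots n A) = rootProd n A := by
  ext k
  rcases lt_or_ge n k with h | h
  · rw [Polynomial.coeff_eq_zero_of_natDegree_lt ((natDegree_WX_le hn _).trans_lt h),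
      Polynomial.coeff_eq_zero_of_natDegree_lt ((natDegree_rootProd n A).trans_lt h)]
  rw [coeff_WX hn _ h]
  unfold entry
  split_ifs with h1
  · simp only [chartOfRoots]
    congr 1; omega
  · rcases (show k = 0 ∨ k = n by omega) with rfl | rfl
    · rw [coeff_zero_rootProd, hA]
    · have := monic_rootProd k A
      rw [Polynomial.Monic, Polynomial.leadingCoeff, natDegree_rootProd] at this
      exact this.symm

open Polynomial in
/-- A monic polynomial of degree `n` is determined by `n` distinct roots. -/
theorem WX_eq_rootProd {n : ℕ} (hn : 2 ≤ n) (x : Chart n) {A : ℕ → ℂ}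
    (hinj : Set.InjOn A (Finset.range n)) (hroot : ∀ j < n, (WX n x).eval (-A j) = 0) :
    WX n x = rootProd n A := by
  refine eq_of_monic_of_dvd_of_natDegree_le (monic_rootProd n A) (monic_WX hn x) ?_
    ((natDegree_WX_le hn x).trans (natDegree_rootProd n A).ge)
  refine Finset.prod_dvd_of_coprime (fun i hi j hj hij => ?_) fun j hj => ?_
  · have h := isCoprime_X_sub_C_of_isUnit_sub (R := ℂ) (a := -A i) (b := -A j)
      (IsUnit.mk0 _ fun h => hij (hinj hi hj (by linear_combination -h)))
    simpa [Function.onFun] using h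
  · have h := dvd_iff_isRoot.2 (hroot j (Finset.mem_range.1 hj))
    simpa using h

open Polynomial in
theorem separable_rootProd {n : ℕ} {A : ℕ → ℂ} (hinj : Set.InjOn A (Finset.range n)) :
    (rootProd n A).Separable := by
  have h : rootProd n A = ∏ j ∈ Finset.range n, (X - C (-A j)) := by simp [rootProd]
  rw [h, separable_prod_X_sub_C_iff']
  intro i hi j hj hij
  exact hinj hi hj (neg_injective hij)

theorem eval_rootProd (n : ℕ) (A : ℕ → ℂ) (z : ℂ) :
    (rootProd n A).eval z = ∏ j ∈ Finset.range n, (z + A j) := by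
  simp [rootProd, Polynomial.eval_prod]

theorem eval_WX (n : ℕ) (x : Chart n) (z : ℂ) :
    (WX n x).eval z
      = z ^ n + ∑ k ∈ Finset.Icc 1 (n - 1), entry n 0 x.2 k * z ^ k + 1 := by
  simp [WX, Polynomial.eval_finsetSum]

theorem contDiff_entry (n k : ℕ) (e : ℂ) :
    ContDiff ℂ ⊤ (fun x : Chart n => entry n e x.2 k) := by
  unfold entry
  split_ifs <;> fun_prop

/-- At a simple root `-exp u₀` of `W`, the logarithm of the negative of the root is an analytic
function of `x`, by the implicit function theorem. The last clause is its local uniqueness. -/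
theorem exists_logRoot {n : ℕ} {x₀ : Chart n} {u₀ : ℂ}
    (h0 : (WX n x₀).eval (-Complex.exp u₀) = 0) (hsep : (WX n x₀).Separable) :
    ∃ U : Chart n → ℂ, AnalyticAt ℂ U x₀ ∧ U x₀ = u₀ ∧
      ∀ᶠ v : Chart n × ℂ in 𝓝 (x₀, u₀), (WX n v.1).eval (-Complex.exp v.2) = 0 ↔ U v.1 = v.2 := by
  let f : Chart n × ℂ → ℂ := fun v => (WX n v.1).eval (-Complex.exp v.2)
  have hf : ContDiff ℂ ⊤ f := by
    simp only [f, eval_WX]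
    have h1 : ContDiff ℂ ⊤ (fun v : Chart n × ℂ => Complex.exp v.2) :=
      Complex.contDiff_exp.comp contDiff_snd
    have h2 := fun k => (contDiff_entry n k 0).comp (contDiff_fst (𝕜 := ℂ) (E := Chart n) (F := ℂ))
    refine ((h1.neg.pow n).add (ContDiff.sum fun k _ => ?_)).add contDiff_const
    exact (h2 k).mul (h1.neg.pow k)
  have hfa : ContDiffAt ℂ ⊤ f (x₀, u₀) := hf.contDiffAt
  have hd : HasDerivAt (fun u => f (x₀, u))
      ((WX n x₀).derivative.eval (-Complex.exp u₀) * (-Complex.exp u₀)) u₀ :=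
    ((WX n x₀).hasDerivAt _).comp u₀ (Complex.hasDerivAt_exp u₀).neg
  have hne : (WX n x₀).derivative.eval (-Complex.exp u₀) * (-Complex.exp u₀) ≠ 0 := by
    refine mul_ne_zero (fun h => ?_) (neg_ne_zero.2 (Complex.exp_ne_zero _))
    obtain ⟨a, b, hab⟩ := hsep
    have := congrArg (Polynomial.eval (-Complex.exp u₀)) hab
    simp [h0, h] at this
  have hfd : HasFDerivAt f (fderiv ℂ f (x₀, u₀)) (x₀, u₀) :=
    (hfa.differentiableAt (by simp)).hasFDerivAt
  have hval : (fderiv ℂ f (x₀, u₀) ∘L .inr ℂ (Chart n) ℂ) 1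
      = (WX n x₀).derivative.eval (-Complex.exp u₀) * (-Complex.exp u₀) := by
    have h2 : HasDerivAt (fun u : ℂ => ((x₀, u) : Chart n × ℂ)) (0, 1) u₀ :=
      (hasDerivAt_const u₀ x₀).prodMk (hasDerivAt_id u₀)
    have h3 := hfd.comp_hasDerivAt u₀ h2
    simpa using h3.unique hd
  have hinv : (fderiv ℂ f (x₀, u₀) ∘L .inr ℂ (Chart n) ℂ).IsInvertible := by
    refine ⟨ContinuousLinearEquiv.unitsEquivAut ℂ (Units.mk0 _ hne), ?_⟩
    ext
    rw [hval]
    simp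
  refine ⟨hfa.implicitFunction (by simp) hinv,
    (hfa.contDiffAt_implicitFunction (by simp) hinv).analyticAt,
    hfa.implicitFunction_apply_self (by simp) hinv, ?_⟩
  have h4 := hfa.eventually_apply_eq_iff_implicitFunction (by simp) hinv
  have h5 : f (x₀, u₀) = 0 := h0
  rw [h5] at h4
  exact h4

theorem continuous_coeff_prod {α ι : Type*} [TopologicalSpace α] (s : Finset ι)
    (f : ι → α → Polynomial ℂ) (hf : ∀ j k, Continuous fun a => (f j a).coeff k) (k : ℕ) :
    Continuous fun a => (∏ j ∈ s, f j a).coeff k := by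
  classical
  induction s using Finset.induction_on generalizing k with
  | empty => simpa using continuous_const
  | insert j s hj ih =>
    simp only [Finset.prod_insert hj, Polynomial.coeff_mul]
    exact continuous_finsetSum _ fun p _ => (hf j p.1).mul (ih p.2)

theorem continuous_coeff_X_add_C (j k : ℕ) :
    Continuous fun a : ℕ → ℂ => (Polynomial.X + Polynomial.C (a j)).coeff k := by
  simp only [Polynomial.coeff_add, Polynomial.coeff_C]
  split_ifs <;> fun_prop

theorem continuous_chartOfRoots (n : ℕ) : Continuous (chartOfRoots n) := by
  refine continuous_const.prodMk (continuous_pi fun k => ?_)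
  exact continuous_coeff_prod _ (fun j (A : ℕ → ℂ) => Polynomial.X + Polynomial.C (A j))
    continuous_coeff_X_add_C _

/-! ### The factorization of `W` on an annulus separating its roots -/

open Polynomial in
/-- The polynomial `∏_{j < i} (X + a_j) ∏_{i ≤ j < n} (1 + a_j X)`. -/
def annProd (n i : ℕ) (a : ℕ → ℂ) : Polynomial ℂ :=
  (∏ j ∈ Finset.range i, (X + C (a j))) * ∏ j ∈ Finset.Ico i n, (1 + C (a j) * X)

/-- The parameters of `annProd` obtained from `∏_{j < n} (X + A_j)` by rescaling `X` by `r`. -/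
def annParam (i : ℕ) (r : ℂ) (A : ℕ → ℂ) (j : ℕ) : ℂ := if j < i then A j / r else r / A j

open Polynomial in
/-- Rescaling `X` by `r` and extracting the leading terms of the factors, `X` for `j < i` and
`A_j` for `j ≥ i`, turns `∏ (X + A_j)` into `annProd`. Its parameters are small if `r` separates
the `A_j`. -/
theorem coeff_rootProd_mul_pow {n i : ℕ} (hi : i ≤ n) {r : ℂ} (hr : r ≠ 0) {A : ℕ → ℂ}
    (hA : ∀ j, A j ≠ 0) (k : ℕ) :
    (rootProd n A).coeff k * r ^ k
      = r ^ i * (∏ j ∈ Finset.Ico i n, A j) * (annProd n i (annParam i r A)).coeff k := by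
  have h : (rootProd n A).comp (C r * X)
      = C (r ^ i * ∏ j ∈ Finset.Ico i n, A j) * annProd n i (annParam i r A) := by
    rw [rootProd, prod_comp, ← Finset.prod_range_mul_prod_Ico _ hi, annProd, C_mul, map_prod]
    have h1 : ∏ j ∈ Finset.range i, (X + C (A j)).comp (C r * X)
        = C (r ^ i) * ∏ j ∈ Finset.range i, (X + C (annParam i r A j)) := by
      have : (C (r ^ i) : Polynomial ℂ) = ∏ _j ∈ Finset.range i, C r := by simp
      rw [this, ← Finset.prod_mul_distrib]
      refine Finset.prod_congr rfl fun j hj => ?_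
      rw [annParam, if_pos (Finset.mem_range.1 hj)]
      simp only [add_comp, X_comp, C_comp, mul_add, ← C_mul]
      rw [mul_div_cancel₀ _ hr]
    have h2 : ∏ j ∈ Finset.Ico i n, (X + C (A j)).comp (C r * X)
        = (∏ j ∈ Finset.Ico i n, C (A j)) * ∏ j ∈ Finset.Ico i n, (1 + C (annParam i r A j) * X) := by
      rw [← Finset.prod_mul_distrib]
      refine Finset.prod_congr rfl fun j hj => ?_
      rw [annParam, if_neg (by simpa using (Finset.mem_Ico.1 hj).1)]
      simp only [add_comp, X_comp, C_comp, mul_add, ← C_mul, ← mul_assoc, mul_one]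
      rw [mul_div_cancel₀ _ (hA j), add_comm]
    rw [h1, h2]
    ring
  have h3 := congrArg (fun p => p.coeff k) h
  simpa only [comp_C_mul_X_coeff, coeff_C_mul] using h3

/-- A neighbourhood of `0` in the product topology contains all sequences with uniformly small
terms. -/
theorem exists_forall_of_eventually_pi {P : (ℕ → ℂ) → Prop} (h : ∀ᶠ a in 𝓝 (0 : ℕ → ℂ), P a) :
    ∃ ε : ℝ, 0 < ε ∧ ∀ a : ℕ → ℂ, (∀ j, ‖a j‖ ≤ ε) → P a := by
  by_contra! hc
  choose a ha hna using fun m : ℕ => hc (1 / ((m : ℝ) + 1)) (by positivity)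
  have h1 : Tendsto a atTop (𝓝 0) := tendsto_pi_nhds.2 fun j =>
    squeeze_zero_norm (fun m => ha m j) tendsto_one_div_add_atTop_nhds_zero_nat
  obtain ⟨m, hm⟩ := (h1.eventually h).exists
  exact hna m hm

open Polynomial in
/-- For small parameters the coefficients of `annProd n i a` are close to those of `X^i`. -/
theorem exists_norm_coeff_annProd_sub_lt (n : ℕ) {η : ℝ} (hη : 0 < η) :
    ∃ ε : ℝ, 0 < ε ∧ ∀ a : ℕ → ℂ, (∀ j < n, ‖a j‖ ≤ ε) → ∀ i ≤ n, ∀ k ≤ n,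
      ‖(annProd n i a).coeff k - (if k = i then 1 else 0)‖ < η := by
  have hcont : ∀ i k, Continuous fun a : ℕ → ℂ => (annProd n i a).coeff k := by
    intro i k
    simp only [annProd, coeff_mul]
    refine continuous_finsetSum _ fun p _ =>
      (continuous_coeff_prod _ _ continuous_coeff_X_add_C _).mul
        (continuous_coeff_prod _ _ (fun j k => ?_) _)
    simp only [coeff_add, coeff_C_mul]
    fun_prop
  have hzero : ∀ i k, (annProd n i 0).coeff k = if k = i then 1 else 0 := by
    intro i k
    simp [annProd, coeff_X_pow]
  have hev : ∀ᶠ a in 𝓝 (0 : ℕ → ℂ), ∀ i ∈ Finset.range (n + 1), ∀ k ∈ Finset.range (n + 1),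
      ‖(annProd n i a).coeff k - (if k = i then 1 else 0)‖ < η := by
    refine (Filter.eventually_all_finset _).2 fun i _ =>
      (Filter.eventually_all_finset _).2 fun k _ => ?_
    have h1 : Continuous fun a : ℕ → ℂ =>
        ‖(annProd n i a).coeff k - (if k = i then 1 else 0)‖ :=
      ((hcont i k).sub continuous_const).norm
    have h2 := h1.tendsto 0
    rw [hzero, sub_self, norm_zero] at h2
    exact h2.eventually_lt_const hη
  obtain ⟨ε, hε, h⟩ := exists_forall_of_eventually_pi hev
  refine ⟨ε, hε, fun a ha i hi k hk => ?_⟩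
  have h3 := h (fun j => if j < n then a j else 0)
    (fun j => by split_ifs with hj; exacts [ha j hj, by simpa using hε.le]) i
    (Finset.mem_range.2 (by omega)) k (Finset.mem_range.2 (by omega))
  have h4 : annProd n i (fun j => if j < n then a j else 0) = annProd n i a := by
    unfold annProd
    congr 1
    · refine Finset.prod_congr rfl fun j hj => ?_
      simp only [if_pos ((Finset.mem_range.1 hj).trans_le hi)]
    · refine Finset.prod_congr rfl fun j hj => ?_
      simp only [if_pos (Finset.mem_Ico.1 hj).2]
  rwa [h4] at h3

/-! ### The path -/

/-- The logarithm of the ratio of consecutive roots of `W` along the path. It runs from `+∞`, where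
the absolute values of the roots separate, to `2 π i / n`. -/
def pathArg (n : ℕ) (t : ℝ) : ℂ := -(Real.log t : ℂ) + 2 * Real.pi * Complex.I * t / n

/-- The logarithms of the negatives of the roots of `W` along the path. The shift by `(n - 1) / 2`
makes their sum `0`, so that the constant coefficient of `W` is `1`. -/
def pathLog (n : ℕ) (t : ℝ) (j : ℕ) : ℂ := ((j : ℂ) - ((n : ℂ) - 1) / 2) * pathArg n t

/-- The negatives of the roots of `W` along the path. -/
def pathRoot (n : ℕ) (t : ℝ) (j : ℕ) : ℂ := Complex.exp (pathLog n t j)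

/-- The path from the large-radius limit point of `Y` to that of `[ℂ²/ℤ_n]`: the roots of `W` are
in geometric progression, with ratio `exp (pathArg n t)`. -/
def path (n : ℕ) (t : ℝ) : Chart n := chartOfRoots n (pathRoot n t)

theorem pathRoot_ne_zero (n : ℕ) (t : ℝ) (j : ℕ) : pathRoot n t j ≠ 0 := Complex.exp_ne_zero _

theorem pathArg_re (n : ℕ) (t : ℝ) : (pathArg n t).re = -Real.log t := by
  have : pathArg n t = ((-Real.log t : ℝ) : ℂ) + ((2 * Real.pi * t / n : ℝ) : ℂ) * Complex.I := by
    simp only [pathArg]; push_cast; ring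
  rw [this]
  simp only [Complex.add_re, Complex.ofReal_re, Complex.re_ofReal_mul, Complex.I_re]
  simp

theorem pathArg_im (n : ℕ) (t : ℝ) : (pathArg n t).im = 2 * Real.pi * t / n := by
  have : pathArg n t = ((-Real.log t : ℝ) : ℂ) + ((2 * Real.pi * t / n : ℝ) : ℂ) * Complex.I := by
    simp only [pathArg]; push_cast; ring
  rw [this]
  simp only [Complex.add_im, Complex.ofReal_im, Complex.im_ofReal_mul, Complex.I_im]
  simp

theorem prod_pathRoot (n : ℕ) (t : ℝ) : ∏ j ∈ Finset.range n, pathRoot n t j = 1 := by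
  simp only [pathRoot, pathLog]
  rw [← Complex.exp_sum, ← Finset.sum_mul, Finset.sum_sub_distrib]
  have h : ∑ j ∈ Finset.range n, (j : ℂ) = (n : ℂ) * ((n : ℂ) - 1) / 2 := by
    induction n with
    | zero => simp
    | succ n ih => rw [Finset.sum_range_succ, ih]; push_cast; ring
  rw [h]
  simp only [Finset.sum_const, Finset.card_range, nsmul_eq_mul]
  rw [show (n : ℂ) * ((n : ℂ) - 1) / 2 - n * (((n : ℂ) - 1) / 2) = 0 by ring, zero_mul,
    Complex.exp_zero]

theorem injOn_pathRoot {n : ℕ} (hn : 2 ≤ n) {t : ℝ} (ht : t ∈ Set.Ioc (0 : ℝ) 1) :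
    Set.InjOn (pathRoot n t) (Finset.range n) := by
  intro i hi j hj hij
  obtain ⟨m, hm⟩ := Complex.exp_eq_exp_iff_exists_int.1 hij
  have h1 : (((i : ℝ) - j : ℝ) : ℂ) * pathArg n t = ((m * (2 * Real.pi) : ℝ) : ℂ) * Complex.I := by
    simp only [pathLog] at hm
    push_cast
    linear_combination hm
  have hre := congrArg Complex.re h1
  have him := congrArg Complex.im h1
  rw [Complex.re_ofReal_mul, Complex.re_ofReal_mul, pathArg_re, Complex.I_re] at hre
  rw [Complex.im_ofReal_mul, Complex.im_ofReal_mul, pathArg_im, Complex.I_im] at him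
  have hn0 : (n : ℝ) ≠ 0 := by positivity
  have hpi := Real.pi_ne_zero
  by_contra hne
  have hsub : (i : ℝ) - j ≠ 0 := sub_ne_zero.2 (by exact_mod_cast hne)
  have hlog : Real.log t = 0 := by
    have := hre
    simp only [mul_zero, mul_eq_zero, hsub, false_or, neg_eq_zero] at this
    exact this
  have ht1 : t = 1 := by
    rcases Real.log_eq_zero.1 hlog with h | h | h
    · exact absurd h ht.1.ne'
    · exact h
    · linarith [ht.1]
  subst ht1
  have h2 : (i : ℝ) - j = m * n := by
    field_simp at him
    linarith
  have h3 : (i : ℤ) - j = m * n := by exact_mod_cast h2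
  have hi' : (i : ℤ) < n := by exact_mod_cast Finset.mem_range.1 (by simpa using hi)
  have hj' : (j : ℤ) < n := by exact_mod_cast Finset.mem_range.1 (by simpa using hj)
  have h4 : (i : ℤ) - j = 0 := Int.eq_zero_of_abs_lt_dvd (m := n) ⟨m, by rw [h3]; ring⟩ (by
    rw [abs_lt]; omega)
  omega

theorem WX_path {n : ℕ} (hn : 2 ≤ n) (t : ℝ) : WX n (path n t) = rootProd n (pathRoot n t) :=
  WX_chartOfRoots hn (prod_pathRoot n t)

theorem separable_WX_path {n : ℕ} (hn : 2 ≤ n) {t : ℝ} (ht : t ∈ Set.Ioc (0 : ℝ) 1) :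
    (WX n (path n t)).Separable := by
  rw [WX_path hn]
  exact separable_rootProd (injOn_pathRoot hn ht)

theorem eval_WX_path {n : ℕ} (hn : 2 ≤ n) (t : ℝ) {j : ℕ} (hj : j < n) :
    (WX n (path n t)).eval (-Complex.exp (pathLog n t j)) = 0 := by
  rw [WX_path hn, eval_rootProd]
  exact Finset.prod_eq_zero (Finset.mem_range.2 hj) (by simp [pathRoot])

theorem WX_zero (n : ℕ) : WX n 0 = Polynomial.X ^ n + 1 := by
  unfold WX
  rw [Finset.sum_eq_zero, add_zero]
  intro k _
  simp [entry]

theorem neg_pathRoot_one_pow {n : ℕ} (hn : 2 ≤ n) (j : ℕ) : (-pathRoot n 1 j) ^ n = -1 := by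
  have hn0 : (n : ℂ) ≠ 0 := by
    have : n ≠ 0 := by omega
    exact_mod_cast this
  have h1 : (n : ℂ) * pathLog n 1 j
      = (j : ℂ) * (2 * Real.pi * Complex.I) + (1 - n : ℂ) * (Real.pi * Complex.I) := by
    simp only [pathLog, pathArg, Real.log_one]
    field_simp
    push_cast
    ring
  have h2 : (Complex.exp (Real.pi * Complex.I)) ^ n = (-1) ^ n := by rw [Complex.exp_pi_mul_I]
  rw [neg_pow, pathRoot, ← Complex.exp_nat_mul, h1, Complex.exp_add, sub_mul, one_mul,
    Complex.exp_sub, Complex.exp_nat_mul_two_pi_mul_I, Complex.exp_pi_mul_I, Complex.exp_nat_mul, h2]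
  field_simp

theorem path_one {n : ℕ} (hn : 2 ≤ n) : path n 1 = 0 := by
  have h : WX n 0 = rootProd n (pathRoot n 1) := by
    refine WX_eq_rootProd hn 0 (injOn_pathRoot hn ⟨zero_lt_one, le_rfl⟩) fun j _ => ?_
    simp [WX_zero, neg_pathRoot_one_pow hn]
  refine Prod.ext rfl (funext fun k => ?_)
  have hk := k.2
  simp only [path, chartOfRoots]
  rw [← h, coeff_WX hn 0 (by omega)]
  simp only [entry]
  rw [dif_pos (by omega)]
  rfl

theorem continuousOn_pathLog (n j : ℕ) : ContinuousOn (fun t => pathLog n t j) (Set.Ioc 0 1) := by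
  simp only [pathLog, pathArg]
  refine continuousOn_const.mul (ContinuousOn.add ?_ (by fun_prop))
  exact (Complex.continuous_ofReal.comp_continuousOn
    (Real.continuousOn_log.mono fun t ht => ht.1.ne')).neg

theorem continuousOn_pathRoot (n j : ℕ) :
    ContinuousOn (fun t => pathRoot n t j) (Set.Ioc (0 : ℝ) 1) :=
  Complex.continuous_exp.comp_continuousOn (continuousOn_pathLog n j)

theorem continuousOn_path (n : ℕ) : ContinuousOn (path n) (Set.Ioc (0 : ℝ) 1) :=
  (continuous_chartOfRoots n).comp_continuousOn
    (continuousOn_pi.2 fun j => continuousOn_pathRoot n j)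

/-- A radius separating the roots of `W` with indices `j < i` from the other ones: for `1 ≤ i < n`
it is the geometric mean of the absolute values of the roots with indices `i - 1` and `i`. -/
def pathRadius (n i : ℕ) (t : ℝ) : ℝ := Real.exp (((i : ℝ) - n / 2) * (-Real.log t))

theorem pathRadius_pos (n i : ℕ) (t : ℝ) : 0 < pathRadius n i t := Real.exp_pos _

theorem norm_pathRoot (n : ℕ) (t : ℝ) (j : ℕ) :
    ‖pathRoot n t j‖ = Real.exp (((j : ℝ) - ((n : ℝ) - 1) / 2) * (-Real.log t)) := by
  rw [pathRoot, Complex.norm_exp, pathLog]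
  congr 1
  have : ((j : ℂ) - ((n : ℂ) - 1) / 2) = (((j : ℝ) - ((n : ℝ) - 1) / 2 : ℝ) : ℂ) := by
    push_cast; rfl
  rw [this, Complex.re_ofReal_mul, pathArg_re]

/-- If the `A_j` are within a factor `2` of the roots along the path, the rescaled parameters are
`O(√t)`. -/
theorem norm_annParam_le {n i : ℕ} {t : ℝ} (ht0 : 0 < t) (ht1 : t < 1) {A : ℕ → ℂ}
    (hA : ∀ j < n, ‖A j‖ ≤ 2 * ‖pathRoot n t j‖ ∧ ‖pathRoot n t j‖ ≤ 2 * ‖A j‖) {j : ℕ}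
    (hj : j < n) :
    ‖annParam i (pathRadius n i t) A j‖ ≤ 2 * Real.sqrt t := by
  have hs : 0 < -Real.log t := by linarith [Real.log_neg ht0 ht1]
  have hsq : Real.sqrt t = Real.exp (-(1 / 2) * (-Real.log t)) := by
    rw [Real.sqrt_eq_rpow, Real.rpow_def_of_pos ht0]
    ring_nf
  have hr : ‖(pathRadius n i t : ℂ)‖ = pathRadius n i t := by
    rw [Complex.norm_real, Real.norm_of_nonneg (pathRadius_pos n i t).le]
  obtain ⟨h1, h2⟩ := hA j hj
  have hpos : 0 < ‖A j‖ := by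
    have : 0 < ‖pathRoot n t j‖ := norm_pos_iff.2 (pathRoot_ne_zero n t j)
    linarith
  unfold annParam
  split_ifs with hji
  · rw [norm_div, hr, div_le_iff₀ (pathRadius_pos n i t)]
    refine h1.trans ?_
    rw [mul_assoc, norm_pathRoot, hsq, pathRadius, ← Real.exp_add, ← add_mul]
    have : (j : ℝ) + 1 ≤ i := by exact_mod_cast hji
    gcongr
    linarith
  · rw [norm_div, hr, div_le_iff₀ hpos]
    have h3 : pathRadius n i t ≤ Real.sqrt t * ‖pathRoot n t j‖ := by
      rw [norm_pathRoot, hsq, pathRadius, ← Real.exp_add, ← add_mul]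
      have : (i : ℝ) ≤ j := by exact_mod_cast not_lt.1 hji
      gcongr
      linarith
    have h4 := mul_le_mul_of_nonneg_left h2 (Real.sqrt_nonneg t)
    linarith

/-- The ratio of the coefficient of `X^i` in `∏_{j < n} (X + A_j)` to its expected leading term. -/
def leadRatio (n : ℕ) (A : ℕ → ℂ) (i : ℕ) : ℂ := (rootProd n A).coeff i / ∏ j ∈ Finset.Ico i n, A j

theorem leadRatio_eq {n i : ℕ} (hi : i ≤ n) {r : ℂ} (hr : r ≠ 0) {A : ℕ → ℂ}
    (hA : ∀ j, A j ≠ 0) : leadRatio n A i = (annProd n i (annParam i r A)).coeff i := by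
  have h := coeff_rootProd_mul_pow hi hr hA i
  have h1 : ∏ j ∈ Finset.Ico i n, A j ≠ 0 := Finset.prod_ne_zero_iff.2 fun j _ => hA j
  have h2 : r ^ i ≠ 0 := pow_ne_zero _ hr
  rw [leadRatio, div_eq_iff h1]
  apply mul_right_cancel₀ h2
  rw [h]
  ring

/-- The coordinate `y_{m+1}` is the ratio of consecutive roots, up to a factor that is close to
`1` if the absolute values of the roots are far apart. -/
theorem xToY_eq_of_WX_eq {n : ℕ} (hn : 2 ≤ n) {x : Chart n} {A : ℕ → ℂ} (hA : ∀ j, A j ≠ 0)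
    (hx : WX n x = rootProd n A) (m : Fin (n - 1)) :
    (xToY n x).2 m = A m / A (m + 1)
      * (leadRatio n A m * leadRatio n A (m + 2) / leadRatio n A (m + 1) ^ 2) := by
  have hm := m.2
  have hc : ∀ k ≤ n, entry n 1 x.2 k = leadRatio n A k * ∏ j ∈ Finset.Ico k n, A j := by
    intro k hk
    rw [← coeff_WX hn x hk, hx, leadRatio, div_mul_cancel₀]
    exact Finset.prod_ne_zero_iff.2 fun j _ => hA j
  have h1 : ∏ j ∈ Finset.Ico (m : ℕ) n, A j
      = A m * (A (m + 1) * ∏ j ∈ Finset.Ico ((m : ℕ) + 2) n, A j) := by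
    rw [Finset.prod_eq_prod_Ico_succ_bot (by omega), Finset.prod_eq_prod_Ico_succ_bot (by omega)]
  have h2 : ∏ j ∈ Finset.Ico ((m : ℕ) + 1) n, A j
      = A (m + 1) * ∏ j ∈ Finset.Ico ((m : ℕ) + 2) n, A j := by
    rw [Finset.prod_eq_prod_Ico_succ_bot (by omega)]
  have h3 : ∏ j ∈ Finset.Ico ((m : ℕ) + 2) n, A j ≠ 0 :=
    Finset.prod_ne_zero_iff.2 fun j _ => hA j
  simp only [xToY]
  rw [hc _ (by omega), hc _ (by omega), hc _ (by omega), h1, h2]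
  have h4 := hA m
  have h5 := hA (m + 1)
  rw [div_eq_mul_inv (_ * _) (_ ^ 2), mul_pow, mul_pow, mul_inv, mul_inv]
  field_simp

theorem tendsto_leadRatio_path (n i : ℕ) (hi : i ≤ n) :
    Tendsto (fun t => leadRatio n (pathRoot n t) i) (𝓝[>] (0 : ℝ)) (𝓝 1) := by
  rw [Metric.tendsto_nhds]
  intro η hη
  obtain ⟨ε, hε, h⟩ := exists_norm_coeff_annProd_sub_lt n hη
  have h1 : Tendsto (fun t : ℝ => 2 * Real.sqrt t) (𝓝[>] 0) (𝓝 0) := by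
    have : Tendsto (fun t : ℝ => 2 * Real.sqrt t) (𝓝 0) (𝓝 (2 * Real.sqrt 0)) :=
      (continuous_const.mul Real.continuous_sqrt).tendsto 0
    simpa using this.mono_left nhdsWithin_le_nhds
  filter_upwards [h1.eventually_lt_const hε, Ioo_mem_nhdsGT zero_lt_one] with t ht ht'
  have hA : ∀ j < n, ‖pathRoot n t j‖ ≤ 2 * ‖pathRoot n t j‖ ∧
      ‖pathRoot n t j‖ ≤ 2 * ‖pathRoot n t j‖ := by
    intro j _
    constructor <;> linarith [norm_nonneg (pathRoot n t j)]
  have h2 := h (annParam i (pathRadius n i t) (pathRoot n t))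
    (fun j hj => (norm_annParam_le ht'.1 ht'.2 hA hj).trans ht.le) i hi i hi
  rw [if_pos rfl, ← leadRatio_eq hi (by exact_mod_cast (pathRadius_pos n i t).ne')
    (pathRoot_ne_zero n t)] at h2
  rwa [dist_eq_norm]

theorem pathRoot_div_succ (n : ℕ) {t : ℝ} (ht : 0 < t) (m : ℕ) :
    pathRoot n t m / pathRoot n t (m + 1)
      = t * Complex.exp (-(2 * Real.pi * Complex.I * t / n)) := by
  have h1 : (t : ℂ) = Complex.exp (Real.log t) := by
    rw [← Complex.ofReal_exp, Real.exp_log ht]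
  rw [pathRoot, pathRoot, ← Complex.exp_sub]
  conv_rhs => rw [h1]
  rw [← Complex.exp_add, ← h1]
  congr 1
  simp only [pathLog, pathArg]
  push_cast
  ring

/-- Along the path `y_{m+1}` is asymptotic to `t`. In particular it tends to `0` within the domain
of the principal branch of the logarithm. -/
theorem exists_tendsto_xToY_path {n : ℕ} (hn : 2 ≤ n) (m : Fin (n - 1)) :
    ∃ q : ℝ → ℂ, Tendsto q (𝓝[>] (0 : ℝ)) (𝓝 1) ∧
      ∀ t : ℝ, 0 < t → (xToY n (path n t)).2 m = t * q t := by
  have hm := m.2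
  refine ⟨fun t => Complex.exp (-(2 * Real.pi * Complex.I * t / n))
    * (leadRatio n (pathRoot n t) m * leadRatio n (pathRoot n t) (m + 2)
      / leadRatio n (pathRoot n t) (m + 1) ^ 2), ?_, fun t ht => ?_⟩
  · have h1 : Tendsto (fun t : ℝ => Complex.exp (-(2 * Real.pi * Complex.I * t / n)))
        (𝓝[>] 0) (𝓝 1) := by
      have h : Continuous (fun t : ℝ => Complex.exp (-(2 * Real.pi * Complex.I * t / n))) := by
        fun_prop
      have h2 := h.tendsto 0
      simp only [Complex.ofReal_zero, mul_zero, zero_div, neg_zero, Complex.exp_zero] at h2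
      exact h2.mono_left nhdsWithin_le_nhds
    have h2 := h1.mul (((tendsto_leadRatio_path n m (by omega)).mul
      (tendsto_leadRatio_path n (m + 2) (by omega))).div
      ((tendsto_leadRatio_path n (m + 1) (by omega)).pow 2) (by simp))
    simpa using h2
  · rw [xToY_eq_of_WX_eq hn (pathRoot_ne_zero n t) (WX_path hn t), pathRoot_div_succ n ht]
    ring

theorem isPathYX_path {n : ℕ} (hn : 2 ≤ n) : IsPathYX n (path n) where
  continuousOn := continuousOn_path n
  regular := fun t ht => separable_WX_path hn ht
  torus := by
    refine Filter.eventually_all.2 fun j => ?_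
    obtain ⟨q, hq, hy⟩ := exists_tendsto_xToY_path hn j
    have h1 : ∀ᶠ t in 𝓝[>] (0 : ℝ), 0 < (q t).re :=
      ((Complex.continuous_re.tendsto 1).comp hq).eventually_const_lt (by simp)
    have h2 : ∀ᶠ t in 𝓝[>] (0 : ℝ), leadRatio n (pathRoot n t) (j + 1) ≠ 0 :=
      (tendsto_leadRatio_path n (j + 1) (by omega)).eventually_ne one_ne_zero
    filter_upwards [h1, h2, self_mem_nhdsWithin] with t h1 h2 ht
    refine ⟨fun h => h2 ?_, ?_⟩
    · have : (rootProd n (pathRoot n t)).coeff (j + 1) = 0 := h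
      rw [leadRatio, this, zero_div]
    · rw [hy t ht]
      refine Or.inl ?_
      rw [Complex.re_ofReal_mul]
      exact mul_pos ht h1
  start := by
    refine Tendsto.prodMk_nhds tendsto_const_nhds (tendsto_pi_nhds.2 fun j => ?_)
    obtain ⟨q, hq, hy⟩ := exists_tendsto_xToY_path hn j
    have h1 : Tendsto (fun t : ℝ => (t : ℂ)) (𝓝[>] 0) (𝓝 ((0 : ℝ) : ℂ)) :=
      (Complex.continuous_ofReal.tendsto 0).mono_left nhdsWithin_le_nhds
    have h2 := h1.mul hq
    simp only [Complex.ofReal_zero, zero_mul] at h2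
    refine h2.congr' ?_
    filter_upwards [self_mem_nhdsWithin] with t ht
    exact (hy t ht).symm
  finish := path_one hn

/-! ### The `I`-function of `Y` at `z = ∞` -/

/-- `a = z⁻ᵏ (c + O(z⁻¹))`, where `c` may be `0`. -/
def HasLead {n : ℕ} (a : LaurentY n) (k : ℤ) (c : HTY n) : Prop :=
  ∃ p : PowerSeries (HTY n), PowerSeries.constantCoeff p = c ∧
    a = HahnSeries.single k 1 * HahnSeries.ofPowerSeries ℤ (HTY n) p

theorem HasLead.mul {n : ℕ} {a b : LaurentY n} {k l : ℤ} {c d : HTY n} (ha : HasLead a k c)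
    (hb : HasLead b l d) : HasLead (a * b) (k + l) (c * d) := by
  obtain ⟨p, rfl, rfl⟩ := ha
  obtain ⟨q, rfl, rfl⟩ := hb
  refine ⟨p * q, by simp, ?_⟩
  have : (HahnSeries.single (k + l) (1 : HTY n)) = HahnSeries.single k 1 * HahnSeries.single l 1 := by
    simp
  rw [this, map_mul]
  ring

theorem hasLead_one (n : ℕ) : HasLead (1 : LaurentY n) 0 1 :=
  ⟨1, by simp, by simp⟩

theorem HasLead.prod {n : ℕ} {ι : Type*} (s : Finset ι) {a : ι → LaurentY n} {k : ι → ℤ}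
    {c : ι → HTY n} (h : ∀ j ∈ s, HasLead (a j) (k j) (c j)) :
    HasLead (∏ j ∈ s, a j) (∑ j ∈ s, k j) (∏ j ∈ s, c j) := by
  classical
  induction s using Finset.induction_on with
  | empty => simpa using hasLead_one n
  | insert j s hj ih =>
    rw [Finset.prod_insert hj, Finset.sum_insert hj, Finset.prod_insert hj]
    exact (h j (Finset.mem_insert_self _ _)).mul
      (ih fun i hi => h i (Finset.mem_insert_of_mem hi))

/-- The hypothesis says that the leading coefficient is a unit. -/
theorem HasLead.inverse {n : ℕ} {a : LaurentY n} {k : ℤ} {c d : HTY n} (ha : HasLead a k c)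
    (hcd : c * d = 1) : HasLead (Ring.inverse a) (-k) d := by
  obtain ⟨p, rfl, rfl⟩ := ha
  obtain ⟨q, hq⟩ :=
    (PowerSeries.isUnit_iff_constantCoeff.2 (IsUnit.of_mul_eq_one _ hcd)).exists_right_inv
  have hq0 : PowerSeries.constantCoeff p * PowerSeries.constantCoeff q = 1 := by
    rw [← map_mul, hq, map_one]
  refine ⟨q, ?_, ?_⟩
  · calc PowerSeries.constantCoeff q
        = d * (PowerSeries.constantCoeff p * PowerSeries.constantCoeff q)
          + (1 - PowerSeries.constantCoeff p * d) * PowerSeries.constantCoeff q := by ring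
      _ = d := by rw [hq0, hcd]; ring
  · have h1 : HahnSeries.ofPowerSeries ℤ (HTY n) p * HahnSeries.ofPowerSeries ℤ (HTY n) q = 1 := by
      rw [← map_mul, hq, map_one]
    have h2 : (HahnSeries.single k (1 : HTY n)) * HahnSeries.single (-k) 1 = 1 := by simp
    have h3 : (HahnSeries.single k (1 : HTY n) * HahnSeries.ofPowerSeries ℤ (HTY n) p)
        * (HahnSeries.single (-k) 1 * HahnSeries.ofPowerSeries ℤ (HTY n) q) = 1 := by
      linear_combination (HahnSeries.single k (1 : HTY n)) * HahnSeries.single (-k) 1 * h1 + h2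
    have h4 := Ring.inverse_mul_cancel _ (IsUnit.of_mul_eq_one _ h3)
    exact left_inv_eq_right_inv h4 h3

theorem HasLead.coeff_of_lt {n : ℕ} {a : LaurentY n} {k : ℤ} {c : HTY n} (ha : HasLead a k c) {j : ℤ}
    (hj : j < k) : a.coeff j = 0 := by
  obtain ⟨p, rfl, rfl⟩ := ha
  rw [show j = (j - k) + k by ring, HahnSeries.coeff_single_mul_add, one_mul,
    HahnSeries.ofPowerSeries_apply]
  exact HahnSeries.embDomain_of_notMem_range (by simpa using hj)

theorem HasLead.coeff_self {n : ℕ} {a : LaurentY n} {k : ℤ} {c : HTY n} (ha : HasLead a k c) :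
    a.coeff k = c := by
  obtain ⟨p, rfl, rfl⟩ := ha
  have := HahnSeries.coeff_single_mul_add (r := (1 : HTY n))
    (x := HahnSeries.ofPowerSeries ℤ (HTY n) p) (a := 0) (b := k)
  rw [zero_add] at this
  rw [this, one_mul]
  have h := HahnSeries.ofPowerSeries_apply_coeff (Γ := ℤ) p 0
  simpa using h

theorem hasLead_zVar (n : ℕ) : HasLead (zVar n) (-1) 1 := ⟨1, by simp, by simp [zVar]⟩

theorem hasLead_constY (n : ℕ) (a : HTY n) : HasLead (constY n a) 0 a :=
  ⟨PowerSeries.C a, by simp, by simp [constY, HahnSeries.ofPowerSeries_C]⟩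

theorem hasLead_expOverZ (n : ℕ) (a : HTY n) : HasLead (expOverZ n a) 0 1 := by
  refine ⟨PowerSeries.rescale a (PowerSeries.exp (HTY n)), ?_, by simp [expOverZ]⟩
  rw [← PowerSeries.coeff_zero_eq_constantCoeff_apply, PowerSeries.coeff_rescale]
  simp

theorem hasLead_const_add (n : ℕ) (a : HTY n) (m : ℤ) :
    HasLead (constY n a + (m : LaurentY n) * zVar n) (-1) (m : HTY n) := by
  refine ⟨PowerSeries.C (m : HTY n) + PowerSeries.C a * PowerSeries.X, by simp, ?_⟩
  have h1 : zVar n * HahnSeries.single (1 : ℤ) (1 : HTY n) = 1 := by simp [zVar]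
  have hm' : (m : LaurentY n) = HahnSeries.C (m : HTY n) := by simp
  simp only [map_add, map_mul, HahnSeries.ofPowerSeries_C, HahnSeries.ofPowerSeries_X, constY]
  rw [hm', ← zVar]
  linear_combination -(HahnSeries.C a) * h1

theorem hasLead_prod_Ioc_zero (n : ℕ) (a : HTY n) (p : ℕ) :
    HasLead (∏ m ∈ Finset.Ioc 0 (p : ℤ), (constY n a + (m : LaurentY n) * zVar n)) (-p)
      (p.factorial : HTY n) := by
  induction p with
  | zero => simpa using hasLead_one n
  | succ p ih =>
    have h1 : Finset.Ioc 0 ((p + 1 : ℕ) : ℤ) = insert ((p + 1 : ℕ) : ℤ) (Finset.Ioc 0 (p : ℤ)) := by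
      ext m; simp only [Finset.mem_insert, Finset.mem_Ioc]; push_cast; omega
    have h2 : ((p + 1 : ℕ) : ℤ) ∉ Finset.Ioc 0 (p : ℤ) := by simp
    rw [h1, Finset.prod_insert h2]
    convert (hasLead_const_add n a ((p + 1 : ℕ) : ℤ)).mul ih using 1
    · push_cast; ring
    · rw [Nat.factorial_succ]; push_cast; ring

/-- The factor with `m = 0` is `a`, the others contribute `m z`. -/
theorem hasLead_prod_Ioc_neg (n : ℕ) (a : HTY n) (p : ℕ) :
    HasLead (∏ m ∈ Finset.Ioc (-(p + 1 : ℤ)) 0, (constY n a + (m : LaurentY n) * zVar n)) (-p)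
      (a * ((-1) ^ p * (p.factorial : HTY n))) := by
  induction p with
  | zero =>
    have h1 : Finset.Ioc (-((0 : ℕ) + 1 : ℤ)) 0 = {0} := by
      ext m; simp only [Finset.mem_singleton, Finset.mem_Ioc]; push_cast; omega
    rw [h1]
    simpa using hasLead_constY n a
  | succ p ih =>
    have h1 : Finset.Ioc (-((p + 1 : ℕ) + 1 : ℤ)) 0
        = insert (-(p + 1 : ℤ)) (Finset.Ioc (-(p + 1 : ℤ)) 0) := by
      ext m; simp only [Finset.mem_insert, Finset.mem_Ioc]; push_cast; omega
    have h2 : (-(p + 1 : ℤ)) ∉ Finset.Ioc (-(p + 1 : ℤ)) 0 := by simp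
    rw [h1, Finset.prod_insert h2]
    convert (hasLead_const_add n a (-(p + 1 : ℤ))).mul ih using 1
    · push_cast; ring
    · rw [Nat.factorial_succ]; push_cast; ring

/-- The leading coefficient of `hyperFactor n j D` as a Laurent series in `z⁻¹`. For `D < 0` the
factor with `m = 0` contributes `ω_j`. -/
def hyperLead (n j : ℕ) (D : ℤ) : HTY n :=
  if D < 0 then omegaClass n j * algebraMap ℂ (HTY n)
    ((-1) ^ (-D - 1).toNat * ((-D - 1).toNat.factorial : ℂ))
  else algebraMap ℂ (HTY n) ((D.toNat.factorial : ℂ)⁻¹)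

theorem hasLead_hyperFactor (n j : ℕ) (D : ℤ) :
    HasLead (hyperFactor n j D) (D + if D < 0 then 1 else 0) (hyperLead n j D) := by
  rcases lt_or_ge D 0 with h | h
  · obtain ⟨p, hp⟩ : ∃ p : ℕ, D = -(p + 1 : ℤ) := ⟨(-D - 1).toNat, by omega⟩
    have h1 : Finset.Ioc 0 D = ∅ := Finset.Ioc_eq_empty (by omega)
    have h2 : (-D - 1).toNat = p := by omega
    rw [hyperFactor, h1, Finset.prod_empty, Ring.inverse_one, mul_one, if_pos h, hyperLead,
      if_pos h, h2, hp]
    convert hasLead_prod_Ioc_neg n (omegaClass n j) p using 1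
    · ring
    · simp
  · obtain ⟨p, rfl⟩ := Int.eq_ofNat_of_zero_le h
    have h1 : Finset.Ioc (p : ℤ) 0 = ∅ := Finset.Ioc_eq_empty (by omega)
    rw [hyperFactor, h1, Finset.prod_empty, one_mul, if_neg (by omega), hyperLead,
      if_neg (by omega)]
    have h3 := (hasLead_prod_Ioc_zero n (omegaClass n j) p).inverse
      (d := algebraMap ℂ (HTY n) ((p.factorial : ℂ)⁻¹)) (by
        have : (p.factorial : HTY n) = algebraMap ℂ (HTY n) (p.factorial : ℂ) := by simp
        rw [this, ← map_mul, mul_inv_cancel₀ (by exact_mod_cast p.factorial_ne_zero), map_one])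
    simpa using h3

/-! ### Second differences -/

theorem entry_of_not {R : Type} {n j : ℕ} {e : R} {v : Fin (n - 1) → R} (h : ¬ (1 ≤ j ∧ j < n)) :
    entry n e v j = e := dif_neg h

theorem entry_succ {R : Type} {n : ℕ} {e : R} {v : Fin (n - 1) → R} (j : Fin (n - 1)) :
    entry n e v (j + 1) = v j := by
  have := j.2
  rw [entry, dif_pos (by omega)]
  rfl

theorem entry_one_ne_zero {n : ℕ} {v : Fin (n - 1) → ℂ} (hv : ∀ j, v j ≠ 0) (k : ℕ) :
    entry n 1 v k ≠ 0 := by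
  unfold entry
  split_ifs
  · exact hv _
  · exact one_ne_zero

theorem DY_zero {n : ℕ} (d : Fin (n - 1) → ℕ) : DY n d 0 = entry n 0 d 1 := by
  simp [DY, entry_of_not (n := n) (j := 0)]

theorem DY_succ {n : ℕ} (d : Fin (n - 1) → ℕ) (j : ℕ) :
    DY n d (j + 1) = entry n 0 d j - 2 * entry n 0 d (j + 1) + entry n 0 d (j + 2) := by
  simp [DY]

theorem sum_range_DY {n : ℕ} (d : Fin (n - 1) → ℕ) (m : ℕ) :
    ∑ j ∈ Finset.range (m + 1), DY n d j = entry n 0 d (m + 1) - entry n 0 d m := by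
  induction m with
  | zero => simp [DY_zero, entry_of_not (n := n) (j := 0)]
  | succ m ih => rw [Finset.sum_range_succ, ih, DY_succ]; ring

/-- The `D'_j(d)` are the second differences of a sequence that vanishes outside `1 ≤ j < n`. -/
theorem sum_DY {n : ℕ} (d : Fin (n - 1) → ℕ) :
    ∑ j ∈ Finset.range (n + 1), DY n d j = 0 := by
  rw [sum_range_DY, entry_of_not (by omega), entry_of_not (by omega)]; simp

/-- The second differences determine the sequence, since it vanishes at `0`. -/
theorem eq_of_DY_eq {n : ℕ} {d d' : Fin (n - 1) → ℕ} (h : ∀ j < n, DY n d j = DY n d' j) :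
    d = d' := by
  have h1 : ∀ m, m + 1 < n → entry n 0 d (m + 1) = entry n 0 d' (m + 1)
      ∧ entry n 0 d m = entry n 0 d' m := by
    intro m
    induction m with
    | zero =>
      intro hm
      have := h 0 (by omega)
      rw [DY_zero, DY_zero] at this
      refine ⟨by exact_mod_cast this, ?_⟩
      rw [entry_of_not (by omega), entry_of_not (by omega)]
    | succ m ih =>
      intro hm
      obtain ⟨h2, h3⟩ := ih (by omega)
      have := h (m + 1) (by omega)
      rw [DY_succ, DY_succ, h2, h3] at this
      rw [show m + 2 = m + 1 + 1 from rfl] at this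
      exact ⟨by omega, h2⟩
  funext j
  have := (h1 j (by omega)).1
  rwa [entry_succ, entry_succ] at this

theorem eq_zero_of_DY_nonneg {n : ℕ} {d : Fin (n - 1) → ℕ}
    (h : ∀ j ∈ Finset.range (n + 1), 0 ≤ DY n d j) : d = 0 := by
  have h1 := (Finset.sum_eq_zero_iff_of_nonneg h).1 (sum_DY d)
  refine eq_of_DY_eq fun j hj => ?_
  rw [h1 j (Finset.mem_range.2 (by omega))]
  simp [DY, entry]

/-- Outside `1 ≤ j < n` the summand `-2 d_j` is absent. -/
theorem DY_end_nonneg {n : ℕ} (d : Fin (n - 1) → ℕ) {j : ℕ} (hj : ¬ (1 ≤ j ∧ j < n)) :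
    0 ≤ DY n d j := by
  rw [DY, entry_of_not hj]
  split_ifs <;> simp
  positivity

/-! ### The leading terms of the `I`-function -/

/-- The exponents of the expansion of `log (1 + ∑_{j ≠ J} z_j)` that correspond to `d`. -/
def logExponent (n J : ℕ) (d : Fin (n - 1) → ℕ) (j : Fin (n + 1)) : ℕ :=
  if (j : ℕ) = J then 0 else (DY n d j).toNat

/-- `d` satisfies `D'_J(d) < 0` and `D'_j(d) ≥ 0` for all `j ≠ J`. -/
def OnlyNeg (n J : ℕ) (d : Fin (n - 1) → ℕ) : Prop :=
  DY n d J < 0 ∧ ∀ j ∈ Finset.range (n + 1), j ≠ J → 0 ≤ DY n d j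

theorem OnlyNeg.mem {n J : ℕ} {d : Fin (n - 1) → ℕ} (h : OnlyNeg n J d) : 1 ≤ J ∧ J < n := by
  by_contra hc
  exact absurd (DY_end_nonneg d hc) (not_le.2 h.1)

theorem OnlyNeg.sum_logExponent {n J : ℕ} {d : Fin (n - 1) → ℕ} (h : OnlyNeg n J d) :
    ((∑ j, logExponent n J d j : ℕ) : ℤ) = -DY n d J := by
  have hJ := h.mem
  have h1 : ((∑ j, logExponent n J d j : ℕ) : ℤ)
      = ∑ j ∈ Finset.range (n + 1), if j = J then 0 else DY n d j := by
    rw [← Fin.sum_univ_eq_sum_range (fun j => if j = J then 0 else DY n d j)]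
    push_cast
    refine Finset.sum_congr rfl fun j _ => ?_
    rw [logExponent]
    split_ifs with hj
    · rfl
    · exact Int.toNat_of_nonneg (h.2 j (Finset.mem_range.2 j.2) hj)
  have h2 := sum_DY d
  rw [← Finset.add_sum_erase _ _ (Finset.mem_range.2 (show J < n + 1 by omega))] at h1 h2
  have h3 : ∑ j ∈ (Finset.range (n + 1)).erase J, (if j = J then 0 else DY n d j)
      = ∑ j ∈ (Finset.range (n + 1)).erase J, DY n d j :=
    Finset.sum_congr rfl fun j hj => if_neg (Finset.ne_of_mem_erase hj)
  rw [h1, h3, if_pos rfl]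
  omega

open Classical in
/-- The coefficient of `ω_J y^d` in the `z⁰`-term of `I_Y`. -/
def flatYCoeff (n J : ℕ) (d : Fin (n - 1) → ℕ) : ℂ :=
  if OnlyNeg n J d then logCoeff (logExponent n J d) else 0

theorem flatYCoeff_of_not {n J : ℕ} {d : Fin (n - 1) → ℕ} (h : ¬ OnlyNeg n J d) :
    flatYCoeff n J d = 0 := if_neg h

/-- The product of the factorials is that in the expansion of `log (1 + ∑_{j ≠ J} z_j)`. -/
theorem prod_hyperLead {n J : ℕ} {d : Fin (n - 1) → ℕ} (h : OnlyNeg n J d) :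
    ∏ j ∈ Finset.range (n + 1), hyperLead n j (DY n d j) = flatYCoeff n J d • omegaClass n J := by
  have hJ := h.mem
  have hs := h.sum_logExponent
  have hneg := h.1
  have h0 : ∑ j, logExponent n J d j ≠ 0 := by omega
  have h1 : (-DY n d J - 1).toNat = ∑ j, logExponent n J d j - 1 := by omega
  have h2 : (∏ j, ((logExponent n J d j).factorial : ℂ))
      = ∏ j ∈ (Finset.range (n + 1)).erase J, ((DY n d j).toNat.factorial : ℂ) := by
    unfold logExponent
    rw [Fin.prod_univ_eq_prod_range
      (fun j => ((if j = J then 0 else (DY n d j).toNat).factorial : ℂ)),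
      ← Finset.mul_prod_erase _ _ (Finset.mem_range.2 (show J < n + 1 by omega))]
    rw [if_pos rfl]
    simp only [Nat.factorial_zero, Nat.cast_one, one_mul]
    exact Finset.prod_congr rfl fun j hj => by rw [if_neg (Finset.ne_of_mem_erase hj)]
  rw [flatYCoeff, if_pos h, logCoeff, if_neg h0, h2,
    ← Finset.mul_prod_erase _ _ (Finset.mem_range.2 (show J < n + 1 by omega)), hyperLead,
    if_pos hneg, h1]
  have h3 : ∏ j ∈ (Finset.range (n + 1)).erase J, hyperLead n j (DY n d j)
      = algebraMap ℂ (HTY n)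
        (∏ j ∈ (Finset.range (n + 1)).erase J, ((DY n d j).toNat.factorial : ℂ))⁻¹ := by
    rw [← Finset.prod_inv_distrib, map_prod]
    refine Finset.prod_congr rfl fun j hj => ?_
    have := h.2 j (Finset.mem_of_mem_erase hj) (Finset.ne_of_mem_erase hj)
    rw [hyperLead, if_neg (by omega)]
  rw [h3, mul_assoc, ← map_mul, Algebra.smul_def, mul_comm]
  congr 2
  obtain ⟨p, hp⟩ := Nat.exists_eq_succ_of_ne_zero h0
  rw [hp]
  simp only [Nat.succ_eq_add_one, Nat.add_sub_cancel, pow_succ, div_eq_mul_inv]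
  ring

/-- The order of the `d`-th term in `z` is `1` minus the number of negative `D'_j(d)`: the exponents
`D'_j(d)` themselves add up to `0`. -/
theorem hasLead_IYTerm (n : ℕ) (y : Chart n) (d : Fin (n - 1) → ℕ) :
    HasLead (IYTerm n y d) (-1 + ∑ j ∈ Finset.range (n + 1), if DY n d j < 0 then 1 else 0)
      ((∏ j ∈ Finset.range (n + 1), hyperLead n j (DY n d j))
        * algebraMap ℂ (HTY n) (∏ i, y.2 i ^ d i)) := by
  have h1 := ((((hasLead_zVar n).mul (hasLead_expOverZ n (algebraMap ℂ (HTY n) y.1))).mul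
    (HasLead.prod Finset.univ fun i _ =>
      hasLead_expOverZ n (Complex.log (y.2 i) • gammaClass n (i + 1)))).mul
    (HasLead.prod (Finset.range (n + 1)) fun j _ => hasLead_hyperFactor n j (DY n d j))).mul
    (hasLead_constY n (algebraMap ℂ (HTY n) (∏ i, y.2 i ^ d i)))
  rw [Finset.sum_add_distrib, sum_DY] at h1
  simpa [IYTerm] using h1

theorem coeff_IYTerm_of_ne_zero {n : ℕ} (y : Chart n) {d : Fin (n - 1) → ℕ} (hd : d ≠ 0) {N : ℤ}
    (hN : 1 ≤ N) : (IYTerm n y d).coeff (-N) = 0 := by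
  refine (hasLead_IYTerm n y d).coeff_of_lt ?_
  obtain ⟨J, hJ, hJ'⟩ : ∃ j ∈ Finset.range (n + 1), DY n d j < 0 := by
    by_contra! hc
    exact hd (eq_zero_of_DY_nonneg hc)
  have h1 := Finset.single_le_sum (f := fun j => if DY n d j < 0 then (1 : ℤ) else 0)
    (fun j _ => by split_ifs <;> simp) hJ
  simp only [hJ', if_true] at h1
  omega

/-- For `d ≠ 0` at least one `D'_j(d)` is negative, and if two are, there is no contribution. So
at most one summand on the right is nonzero. -/
theorem coeff_zero_IYTerm_of_ne_zero {n : ℕ} (y : Chart n) {d : Fin (n - 1) → ℕ} (hd : d ≠ 0) :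
    (IYTerm n y d).coeff 0
      = ∑ J ∈ Finset.Icc 1 (n - 1), (flatYCoeff n J d * ∏ i, y.2 i ^ d i) • omegaClass n J := by
  obtain ⟨J, hJ, hJ'⟩ : ∃ j ∈ Finset.range (n + 1), DY n d j < 0 := by
    by_contra! hc
    exact hd (eq_zero_of_DY_nonneg hc)
  have hlead := hasLead_IYTerm n y d
  by_cases hon : OnlyNeg n J d
  · have hmem := hon.mem
    have h1 : ∑ j ∈ Finset.range (n + 1), (if DY n d j < 0 then (1 : ℤ) else 0) = 1 := by
      rw [Finset.sum_eq_single_of_mem J hJ, if_pos hJ']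
      intro j hj hne
      rw [if_neg (not_lt.2 (hon.2 j hj hne))]
    rw [h1, show (-1 + 1 : ℤ) = 0 by norm_num] at hlead
    rw [hlead.coeff_self, prod_hyperLead hon,
      Finset.sum_eq_single_of_mem J (Finset.mem_Icc.2 (by omega))]
    · rw [Algebra.smul_def, Algebra.smul_def, map_mul]
      ring
    · intro K _ hne
      rw [flatYCoeff_of_not, zero_mul, zero_smul]
      intro hK
      exact absurd (hK.2 J hJ hne.symm) (not_le.2 hJ')
  · obtain ⟨K, hK, hKJ, hK'⟩ : ∃ j ∈ Finset.range (n + 1), j ≠ J ∧ DY n d j < 0 := by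
      by_contra! hc
      exact hon ⟨hJ', hc⟩
    have h1 : 2 ≤ ∑ j ∈ Finset.range (n + 1), (if DY n d j < 0 then (1 : ℤ) else 0) := by
      rw [← Finset.add_sum_erase _ _ hJ, if_pos hJ']
      have h2 := Finset.single_le_sum (s := (Finset.range (n + 1)).erase J)
        (f := fun j => if DY n d j < 0 then (1 : ℤ) else 0)
        (fun j _ => by split_ifs <;> simp) (Finset.mem_erase.2 ⟨hKJ, hK⟩)
      simp only [hK', if_true] at h2
      omega
    rw [hlead.coeff_of_lt (by omega), Finset.sum_eq_zero]
    intro L _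
    rw [flatYCoeff_of_not, zero_mul, zero_smul]
    intro hL
    by_cases hLJ : L = J
    · exact hon (hLJ ▸ hL)
    · exact absurd (hL.2 J hJ (Ne.symm hLJ)) (not_le.2 hJ')

theorem IYTerm_zero (n : ℕ) (y : Chart n) :
    IYTerm n y 0 = zVar n * expOverZ n (algebraMap ℂ (HTY n) y.1
      + ∑ i : Fin (n - 1), Complex.log (y.2 i) • gammaClass n (i + 1)) := by
  have h1 : ∀ j, hyperFactor n j (DY n 0 j) = 1 := by
    intro j
    have : DY n 0 j = 0 := by simp [DY, entry]
    simp [this, hyperFactor]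
  have h2 : ∀ a b : HTY n, expOverZ n a * expOverZ n b = expOverZ n (a + b) := by
    intro a b
    rw [expOverZ, expOverZ, expOverZ, ← map_mul, PowerSeries.exp_mul_exp_eq_exp_add]
  have h3 : ∀ s : Finset (Fin (n - 1)), ∀ a : Fin (n - 1) → HTY n,
      ∏ i ∈ s, expOverZ n (a i) = expOverZ n (∑ i ∈ s, a i) := by
    intro s a
    induction s using Finset.induction_on with
    | empty =>
      simp [expOverZ]
    | insert j s hj ih => rw [Finset.prod_insert hj, ih, Finset.sum_insert hj, h2]
  simp only [IYTerm, h1, h3, Finset.prod_const_one, mul_one, mul_assoc, h2]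
  simp [constY]

theorem coeff_IYTerm_zero (n : ℕ) (y : Chart n) :
    (∀ N : ℤ, 1 < N → (IYTerm n y 0).coeff (-N) = 0) ∧ (IYTerm n y 0).coeff (-1) = 1 ∧
    (IYTerm n y 0).coeff 0 = algebraMap ℂ (HTY n) y.1
      + ∑ i : Fin (n - 1), Complex.log (y.2 i) • gammaClass n (i + 1) := by
  rw [IYTerm_zero]
  generalize algebraMap ℂ (HTY n) y.1
      + ∑ i : Fin (n - 1), Complex.log (y.2 i) • gammaClass n (i + 1) = a
  have h := (hasLead_zVar n).mul (hasLead_expOverZ n a)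
  refine ⟨fun N hN => h.coeff_of_lt (by omega), ?_, ?_⟩
  · simpa using h.coeff_self
  · have h1 := HahnSeries.coeff_single_mul_add (r := (1 : HTY n))
      (x := expOverZ n a) (a := 1) (b := -1)
    rw [show (1 + -1 : ℤ) = 0 by norm_num, one_mul] at h1
    rw [zVar, h1, expOverZ]
    have h2 := HahnSeries.ofPowerSeries_apply_coeff (Γ := ℤ)
      (PowerSeries.rescale a (PowerSeries.exp (HTY n))) 1
    rw [PowerSeries.coeff_rescale] at h2
    simpa [PowerSeries.coeff_exp] using h2

/-! ### The flat coordinates of `Y` -/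

theorem entry_le_sum {n : ℕ} (d : Fin (n - 1) → ℕ) (j : ℕ) : entry n 0 d j ≤ ∑ i, d i := by
  unfold entry
  split_ifs
  · exact Finset.single_le_sum (fun _ _ => Nat.zero_le _) (Finset.mem_univ _)
  · exact Nat.zero_le _

theorem norm_flatYCoeff_le (n J : ℕ) (d : Fin (n - 1) → ℕ) :
    ‖flatYCoeff n J d‖ ≤ (((n : ℝ) + 1) ^ 2) ^ ∑ i, d i := by
  by_cases h : OnlyNeg n J d
  · rw [flatYCoeff, if_pos h]
    refine (norm_logCoeff_le _).trans ?_
    rw [← pow_mul, Fintype.card_fin]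
    push_cast
    refine pow_le_pow_right₀ (by linarith [Nat.cast_nonneg (α := ℝ) n]) ?_
    have h1 := h.sum_logExponent
    obtain ⟨J, rfl⟩ := Nat.exists_eq_succ_of_ne_zero (show J ≠ 0 from by have := h.mem; omega)
    have h2 := DY_succ d J
    have h3 := entry_le_sum d (J + 1)
    rw [Nat.succ_eq_add_one] at *
    omega
  · rw [flatYCoeff_of_not h, norm_zero]
    positivity

theorem norm_flatYCoeff_mul_le (n J : ℕ) (y : Fin (n - 1) → ℂ) (d : Fin (n - 1) → ℕ) :
    ‖flatYCoeff n J d * ∏ i, y i ^ d i‖ ≤ ∏ i, (((n : ℝ) + 1) ^ 2 * ‖y i‖) ^ d i := by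
  simp only [mul_pow _ (‖y _‖), Finset.prod_mul_distrib]
  rw [norm_mul, norm_prod, Finset.prod_pow_eq_pow_sum]
  simp only [norm_pow]
  exact mul_le_mul_of_nonneg_right (norm_flatYCoeff_le n J d)
    (Finset.prod_nonneg fun _ _ => by positivity)

theorem summable_flatYCoeff_mul {n : ℕ} (J : ℕ) {y : Fin (n - 1) → ℂ}
    (hy : ∀ j, ‖y j‖ < (((n : ℝ) + 1) ^ 2)⁻¹) :
    Summable (fun d : Fin (n - 1) → ℕ => flatYCoeff n J d * ∏ i, y i ^ d i) := by
  refine Summable.of_norm_bounded (summable_prod_pow (fun i => ((n : ℝ) + 1) ^ 2 * ‖y i‖)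
    (fun i => by positivity) fun i => ?_) (norm_flatYCoeff_mul_le n J y)
  have hpos : 0 < ((n : ℝ) + 1) ^ 2 := by positivity
  calc ((n : ℝ) + 1) ^ 2 * ‖y i‖ < ((n : ℝ) + 1) ^ 2 * (((n : ℝ) + 1) ^ 2)⁻¹ :=
        mul_lt_mul_of_pos_left (hy i) hpos
    _ = 1 := mul_inv_cancel₀ hpos.ne'

/-- The coefficient of `ω_J` in the `z⁰`-term of `I_Y`, without the logarithms. -/
def flatYSeries (n J : ℕ) (y : Fin (n - 1) → ℂ) : ℂ :=
  ∑' d : Fin (n - 1) → ℕ, flatYCoeff n J d * ∏ i, y i ^ d i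

theorem flatYSeries_end {n J : ℕ} (hJ : ¬ (1 ≤ J ∧ J < n)) (y : Fin (n - 1) → ℂ) :
    flatYSeries n J y = 0 := by
  rw [flatYSeries, tsum_congr (fun d => by rw [flatYCoeff_of_not fun h => hJ h.mem, zero_mul])]
  exact tsum_zero

/-- The principal branches of the flat coordinates for `Y`. -/
def flatY (n i : ℕ) (y : Chart n) : ℂ :=
  if i = 0 then y.1
  else Complex.log (entry n 1 y.2 i)
    + (flatYSeries n (i - 1) y.2 - 2 * flatYSeries n i y.2 + flatYSeries n (i + 1) y.2)

/-- Summation by parts. -/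
theorem sum_secondDiff_smul {M : Type*} [AddCommGroup M] [Module ℂ M] (h : ℕ → ℂ) (G : ℕ → M)
    (m : ℕ) (h0 : h 0 = 0) (G0 : G 0 = 0) (hm : h (m + 1) = 0) (Gm : G (m + 1) = 0) :
    ∑ i ∈ Finset.range m, h (i + 1) • (G i - (2 : ℂ) • G (i + 1) + G (i + 2))
      = ∑ i ∈ Finset.range m, (h i - 2 * h (i + 1) + h (i + 2)) • G (i + 1) := by
  have key : ∀ k, ∑ i ∈ Finset.range k, h (i + 1) • (G i - (2 : ℂ) • G (i + 1) + G (i + 2))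
      - ∑ i ∈ Finset.range k, (h i - 2 * h (i + 1) + h (i + 2)) • G (i + 1)
      = (h 1 • G 0 - h 0 • G 1) - (h (k + 1) • G k - h k • G (k + 1)) := by
    intro k
    induction k with
    | zero => simp
    | succ k ih =>
      rw [Finset.sum_range_succ, Finset.sum_range_succ, add_sub_add_comm, ih]
      module
  have := key m
  rw [h0, G0, hm, Gm] at this
  simpa [sub_eq_zero] using this

theorem sum_Icc_one {M : Type*} [AddCommMonoid M] (f : ℕ → M) (m : ℕ) :
    ∑ i ∈ Finset.Icc 1 m, f i = ∑ i ∈ Finset.range m, f (i + 1) := by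
  rw [Finset.range_eq_Ico, Finset.sum_Ico_add' f 0 m 1]
  rfl

/-- As `ω_J` is the second difference of the `γ_i`, the coefficient of `γ_i` is the second
difference of the coefficients of the `ω_J`. -/
theorem sum_flatY_smul {n : ℕ} (hn : 2 ≤ n) (y : Chart n) :
    ∑ i ∈ Finset.range n, flatY n i y • gammaClass n i
      = algebraMap ℂ (HTY n) y.1
        + ∑ i : Fin (n - 1), Complex.log (y.2 i) • gammaClass n (i + 1)
        + ∑ J ∈ Finset.Icc 1 (n - 1), flatYSeries n J y.2 • omegaClass n J := by
  let G : ℕ → HTY n := fun k => toHTY n (entry n 0 (fun i => MvPolynomial.X (Sum.inr i)) k)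
  have hG : ∀ i < n - 1, gammaClass n (i + 1) = G (i + 1) := by
    intro i hi
    simp only [gammaClass, G, entry]
    rw [dif_pos (by omega), dif_pos (by omega)]
  have homega : ∀ i < n - 1, omegaClass n (i + 1) = G i - (2 : ℂ) • G (i + 1) + G (i + 2) := by
    intro i hi
    rw [omegaClass, omegaPoly, if_neg (by omega), if_neg (by omega), if_neg (by omega)]
    simp only [zero_add, map_add, map_sub, map_mul, G, Nat.add_sub_cancel, map_ofNat,
      ofNat_smul_eq_nsmul, nsmul_eq_mul, Nat.cast_ofNat]
  have h1 : ∑ J ∈ Finset.Icc 1 (n - 1), flatYSeries n J y.2 • omegaClass n J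
      = ∑ i ∈ Finset.range (n - 1), (flatYSeries n i y.2 - 2 * flatYSeries n (i + 1) y.2
          + flatYSeries n (i + 2) y.2) • G (i + 1) := by
    rw [sum_Icc_one, ← sum_secondDiff_smul (fun J => flatYSeries n J y.2) G (n - 1)]
    · exact Finset.sum_congr rfl fun i hi => by rw [homega i (Finset.mem_range.1 hi)]
    · exact flatYSeries_end (by omega) _
    · simp only [G]
      rw [entry_of_not (by omega), map_zero]
    · exact flatYSeries_end (by omega) _
    · simp only [G]
      rw [entry_of_not (by omega), map_zero]
  have h2 : ∑ i : Fin (n - 1), Complex.log (y.2 i) • gammaClass n (i + 1)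
      = ∑ i ∈ Finset.range (n - 1), Complex.log (entry n 1 y.2 (i + 1)) • G (i + 1) := by
    rw [← Fin.sum_univ_eq_sum_range
      (fun i => Complex.log (entry n 1 y.2 (i + 1)) • G (i + 1))]
    refine Finset.sum_congr rfl fun i _ => ?_
    rw [entry_succ, hG i (by omega)]
  have h3 : ∑ i ∈ Finset.range n, flatY n i y • gammaClass n i
      = ∑ i ∈ Finset.range (n - 1), flatY n (i + 1) y • gammaClass n (i + 1)
        + flatY n 0 y • gammaClass n 0 := by
    rw [show Finset.range n = Finset.range (n - 1 + 1) by rw [Nat.sub_add_cancel (by omega)],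
      Finset.sum_range_succ']
  have h4 : flatY n 0 y • gammaClass n 0 = algebraMap ℂ (HTY n) y.1 := by
    simp [flatY, gammaClass, entry_of_not (n := n) (j := 0), Algebra.smul_def]
  rw [h1, h2, h3, h4, add_assoc, ← Finset.sum_add_distrib, add_comm]
  congr 1
  refine Finset.sum_congr rfl fun i hi => ?_
  rw [hG i (Finset.mem_range.1 hi), flatY, if_neg (by omega), add_smul, Nat.add_sub_cancel]

theorem flatYCoeff_zero (n J : ℕ) : flatYCoeff n J 0 = 0 := by
  refine flatYCoeff_of_not fun h => ?_
  have : DY n 0 J = 0 := by simp [DY, entry]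
  exact absurd h.1 (by omega)

theorem isFlatY_flatY {n : ℕ} (hn : 2 ≤ n) : IsFlatY n (flatY n) := by
  refine ⟨(((n : ℝ) + 1) ^ 2)⁻¹, by positivity, fun y hy =>
    ⟨fun N hN φ => ?_, fun φ => ?_, fun φ => ?_⟩⟩
  · have h : ∀ d, (IYTerm n y d).coeff (-N) = 0 := by
      intro d
      rcases eq_or_ne d 0 with rfl | hd
      · exact (coeff_IYTerm_zero n y).1 N hN
      · exact coeff_IYTerm_of_ne_zero y hd (by omega)
    simp only [h, map_zero]
    exact hasSum_zero
  · rw [← (coeff_IYTerm_zero n y).2.1]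
    refine hasSum_single (f := fun d => φ ((IYTerm n y d).coeff (-1))) 0 fun d hd => ?_
    rw [coeff_IYTerm_of_ne_zero y hd le_rfl, map_zero]
  · rw [sum_flatY_smul hn]
    set L := algebraMap ℂ (HTY n) y.1
        + ∑ i : Fin (n - 1), Complex.log (y.2 i) • gammaClass n (i + 1) with hL
    have h1 : ∀ d, φ ((IYTerm n y d).coeff (-0)) = (if d = 0 then φ L else 0)
        + ∑ J ∈ Finset.Icc 1 (n - 1),
          (flatYCoeff n J d * ∏ i, y.2 i ^ d i) * φ (omegaClass n J) := by
      intro d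
      rw [neg_zero]
      rcases eq_or_ne d 0 with rfl | hd
      · rw [(coeff_IYTerm_zero n y).2.2, if_pos rfl]
        simp [flatYCoeff_zero, hL]
      · rw [coeff_zero_IYTerm_of_ne_zero y hd, if_neg hd, zero_add, map_sum]
        simp only [map_smul, smul_eq_mul]
    have h2 : φ (L + ∑ J ∈ Finset.Icc 1 (n - 1), flatYSeries n J y.2 • omegaClass n J)
        = φ L + ∑ J ∈ Finset.Icc 1 (n - 1), flatYSeries n J y.2 * φ (omegaClass n J) := by
      rw [map_add, map_sum]
      simp only [map_smul, smul_eq_mul]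
    have h3 : HasSum (fun d : Fin (n - 1) → ℕ => if d = 0 then φ L else 0) (φ L) :=
      hasSum_ite_eq 0 (φ L)
    have h4 : HasSum (fun d : Fin (n - 1) → ℕ => ∑ J ∈ Finset.Icc 1 (n - 1),
        (flatYCoeff n J d * ∏ i, y.2 i ^ d i) * φ (omegaClass n J))
        (∑ J ∈ Finset.Icc 1 (n - 1), flatYSeries n J y.2 * φ (omegaClass n J)) :=
      hasSum_sum fun J _ =>
        (summable_flatYCoeff_mul J fun j => (hy j).2).hasSum.mul_right (φ (omegaClass n J))
    rw [h2]
    rw [funext h1]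
    exact h3.add h4

/-- The linear functional on `H_T(Y; ℂ)` that takes the coefficient of `γ_i` in degree one. It is
well defined since the relations are products of two linear forms. -/
theorem exists_gammaFunctional {n i : ℕ} (hi : 1 ≤ i ∧ i < n) :
    ∃ φ : HTY n →ₗ[ℂ] ℂ, ∀ k < n, φ (gammaClass n k) = if k = i then 1 else 0 := by
  classical
  -- `λ_1, λ_2 ↦ 0`, `γ_i ↦ ε` and `γ_k ↦ 0` for `k ≠ i` define a map to the dual numbers
  let v : Fin 2 ⊕ Fin (n - 1) → DualNumber ℂ :=
    Sum.elim (fun _ => 0) fun k => if (k : ℕ) + 1 = i then DualNumber.eps else 0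
  let f : PolyY n →ₐ[ℂ] DualNumber ℂ := MvPolynomial.aeval v
  have hv : ∀ s, (v s).fst = 0 := by
    rintro (s | s)
    · rfl
    · simp only [v, Sum.elim_inr]
      split_ifs <;> simp
  have hentry : ∀ j, (f (entry n 0 (fun k => MvPolynomial.X (Sum.inr k)) j)).fst = 0 := by
    intro j
    unfold entry
    split_ifs
    · simp only [f, MvPolynomial.aeval_X]
      exact hv _
    · simp
  have homega : ∀ j, (f (omegaPoly n j)).fst = 0 := by
    intro j
    simp only [omegaPoly, map_add, map_sub, map_mul, TrivSqZeroExt.fst_add, TrivSqZeroExt.fst_sub,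
      TrivSqZeroExt.fst_mul, hentry, mul_zero, sub_zero, add_zero]
    split_ifs <;> simp [hentry, f, hv]
  have hker : ∀ a ∈ relY n, f a = 0 := by
    intro a ha
    have : relY n ≤ RingHom.ker f := by
      refine Ideal.span_le.2 ?_
      rintro p ⟨k, j, _, _, rfl⟩
      have h1 := homega k
      have h2 := homega j
      show f (omegaPoly n k * omegaPoly n j) = 0
      rw [map_mul]
      ext
      · simp [h1]
      · simp [h1, h2]
    exact this ha
  let F : HTY n →ₐ[ℂ] DualNumber ℂ := Ideal.Quotient.liftₐ (relY n) f hker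
  have hF : ∀ a, F (toHTY n a) = f a := fun a => rfl
  refine ⟨(TrivSqZeroExt.sndHom ℂ ℂ) ∘ₗ F.toLinearMap, fun k hk => ?_⟩
  simp only [LinearMap.comp_apply, AlgHom.toLinearMap_apply, gammaClass, hF]
  unfold entry
  split_ifs with h1 h2 h2
  · have h3 : k - 1 + 1 = i := by omega
    simp [f, v, h3]
  · have h3 : k - 1 + 1 ≠ i := by omega
    simp [f, v, h3]
  · omega
  · simp

/-- The flat coordinates of `Y` are unique near `y = 0`. -/
theorem IsFlatY.eq_flatY {n : ℕ} (hn : 2 ≤ n) {g : ℕ → Chart n → ℂ} (hg : IsFlatY n g) :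
    ∃ δ : ℝ, 0 < δ ∧ ∀ y : Chart n, (∀ j, y.2 j ≠ 0 ∧ ‖y.2 j‖ < δ) →
      ∀ i, 1 ≤ i ∧ i < n → g i y = flatY n i y := by
  obtain ⟨δ₁, h1, hg⟩ := hg
  obtain ⟨δ₂, h2, hf⟩ := isFlatY_flatY hn
  refine ⟨min δ₁ δ₂, lt_min h1 h2, fun y hy i hi => ?_⟩
  obtain ⟨φ, hφ⟩ := exists_gammaFunctional hi
  have h3 := (hg y fun j => ⟨(hy j).1, (hy j).2.trans_le (min_le_left _ _)⟩).2.2 φ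
  have h4 := (hf y fun j => ⟨(hy j).1, (hy j).2.trans_le (min_le_right _ _)⟩).2.2 φ
  have h5 := h3.unique h4
  have h6 : ∀ g : ℕ → Chart n → ℂ,
      φ (∑ k ∈ Finset.range n, g k y • gammaClass n k) = g i y := by
    intro g
    rw [map_sum, Finset.sum_eq_single_of_mem i (Finset.mem_range.2 hi.2)]
    · rw [map_smul, hφ i hi.2, if_pos rfl, smul_eq_mul, mul_one]
    · intro k hk hne
      rw [map_smul, hφ k (Finset.mem_range.1 hk), if_neg hne, smul_zero]
  rwa [h6, h6] at h5

/-! ### The exponents of the `I`-function -/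

/-- Every exponent whose monomial in the variables `z_j = c_j κ^{j - J}` is free of `κ` comes from
some `d`. The latter is obtained by summing the prescribed second differences twice. -/
theorem exists_onlyNeg {n J : ℕ} (hJ : 1 ≤ J ∧ J < n) {k : Fin (n + 1) → ℕ}
    (hkJ : ∀ j : Fin (n + 1), (j : ℕ) = J → k j = 0) (hk0 : ∑ j, k j ≠ 0)
    (hk : ∑ j : Fin (n + 1), ((j : ℤ) - J) * k j = 0) :
    ∃ d : Fin (n - 1) → ℕ, OnlyNeg n J d ∧ logExponent n J d = k := by
  let kk : ℕ → ℤ := fun j => if h : j < n + 1 then (k ⟨j, h⟩ : ℤ) else 0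
  have hkk : ∀ j : Fin (n + 1), kk j = k j := fun j => dif_pos j.2
  have hkk0 : ∀ j, 0 ≤ kk j := by
    intro j; simp only [kk]; split_ifs <;> simp
  have hkkJ : kk J = 0 := by
    have := hkk ⟨J, by omega⟩
    rw [hkJ _ rfl] at this
    exact_mod_cast this
  let K : ℕ → ℤ := fun j => kk j - if j = J then ((∑ j, k j : ℕ) : ℤ) else 0
  have hKJ : K J = -((∑ j, k j : ℕ) : ℤ) := by simp [K, hkkJ]
  have hK : ∀ j, j ≠ J → K j = kk j := fun j hj => by simp [K, hj]
  have hJm : J ∈ Finset.range (n + 1) := Finset.mem_range.2 (by omega)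
  have hsum0 : ∑ j ∈ Finset.range (n + 1), K j = 0 := by
    simp only [K, Finset.sum_sub_distrib, Finset.sum_ite_eq', hJm, if_true]
    rw [← Fin.sum_univ_eq_sum_range]
    simp [hkk]
  have hsum1 : ∑ j ∈ Finset.range (n + 1), ((j : ℤ) - J) * K j = 0 := by
    rw [← hk, ← Fin.sum_univ_eq_sum_range (fun j => ((j : ℤ) - J) * K j)]
    refine Finset.sum_congr rfl fun j _ => ?_
    by_cases hj : (j : ℕ) = J
    · rw [hj, sub_self, zero_mul, zero_mul]
    · rw [hK _ hj, hkk]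
  have hsumi : ∀ i : ℤ, ∑ j ∈ Finset.range (n + 1), (i - j) * K j = 0 := by
    intro i
    have : ∀ j : ℕ, (i - j) * K j = (i - J) * K j - ((j : ℤ) - J) * K j := fun j => by ring
    simp only [this]
    rw [Finset.sum_sub_distrib, ← Finset.mul_sum, hsum0, hsum1]
    simp
  -- `e` has second differences `K`; it vanishes at `n` and `n + 1` by the two conditions on `k`
  let e : ℕ → ℤ := fun i => ∑ j ∈ Finset.range i, ((i : ℤ) - j) * K j
  have he : ∀ i, e (i + 2) - 2 * e (i + 1) + e i = K (i + 1) := by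
    intro i
    have h1 : e (i + 2) = ∑ j ∈ Finset.range i, ((i : ℤ) + 2 - j) * K j + 2 * K i + K (i + 1) := by
      simp only [e]
      rw [Finset.sum_range_succ, Finset.sum_range_succ]
      push_cast
      ring
    have h2 : e (i + 1) = ∑ j ∈ Finset.range i, ((i : ℤ) + 1 - j) * K j + K i := by
      simp only [e]
      rw [Finset.sum_range_succ]
      push_cast
      ring
    have h3 : ∑ j ∈ Finset.range i, ((i : ℤ) + 2 - j) * K j
        - 2 * ∑ j ∈ Finset.range i, ((i : ℤ) + 1 - j) * K j
        + ∑ j ∈ Finset.range i, ((i : ℤ) - j) * K j = 0 := by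
      rw [Finset.mul_sum, ← Finset.sum_sub_distrib, ← Finset.sum_add_distrib]
      exact Finset.sum_eq_zero fun j _ => by ring
    have h4 : e i = ∑ j ∈ Finset.range i, ((i : ℤ) - j) * K j := rfl
    rw [h1, h2, h4]
    linarith
  have hen : e n = 0 := by
    have := hsumi n
    rw [Finset.sum_range_succ, sub_self, zero_mul, add_zero] at this
    exact this
  have hen1 : e (n + 1) = 0 := by
    have := hsumi (n + 1 : ℕ)
    exact this
  have he0 : e 0 = 0 := by simp [e]
  have he1 : e 1 = K 0 := by simp [e]
  -- the only negative `K j` is the one with `j = J`; for `i > J` the sum over `j ≥ i` avoids it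
  have hnn : ∀ i ≤ n, 0 ≤ e i := by
    intro i hi
    rcases le_or_gt i J with h | h
    · refine Finset.sum_nonneg fun j hj => ?_
      have hj' := Finset.mem_range.1 hj
      rw [hK j (by omega)]
      exact mul_nonneg (by omega) (hkk0 j)
    · have h1 := hsumi i
      rw [← Finset.sum_range_add_sum_Ico _ (show i ≤ n + 1 by omega)] at h1
      have h2 : ∑ j ∈ Finset.Ico i (n + 1), ((i : ℤ) - j) * K j ≤ 0 := by
        refine Finset.sum_nonpos fun j hj => ?_
        have hj' := Finset.mem_Ico.1 hj
        rw [hK j (by omega)]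
        exact mul_nonpos_of_nonpos_of_nonneg (by omega) (hkk0 j)
      have h3 : e i = ∑ j ∈ Finset.range i, ((i : ℤ) - j) * K j := rfl
      omega
  let d : Fin (n - 1) → ℕ := fun m => (e (m + 1)).toNat
  have hd : ∀ i ≤ n, ((entry n 0 d i : ℕ) : ℤ) = e i := by
    intro i hi
    by_cases h : 1 ≤ i ∧ i < n
    · rw [entry, dif_pos h]
      simp only [d]
      rw [Int.toNat_of_nonneg, Nat.sub_add_cancel h.1]
      rw [Nat.sub_add_cancel h.1]
      exact hnn i hi
    · rw [entry_of_not h]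
      rcases (show i = 0 ∨ i = n by omega) with rfl | rfl
      · simp [he0]
      · simp [hen]
  have hDY : ∀ j ≤ n, DY n d j = K j := by
    intro j hj
    rcases j with _ | j
    · rw [DY_zero, hd 1 (by omega), he1]
    · rw [DY_succ, hd j (by omega), hd (j + 1) hj, ← he j]
      rcases hj.eq_or_lt with h | h
      · rw [entry_of_not (by omega), show j + 2 = n + 1 by omega, hen1]
        simp
        ring
      · rw [hd (j + 2) (by omega)]
        ring
  refine ⟨d, ⟨?_, fun j hj hne => ?_⟩, funext fun j => ?_⟩
  · rw [hDY J (by omega), hKJ]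
    omega
  · rw [hDY j (by have := Finset.mem_range.1 hj; omega), hK j hne]
    exact hkk0 j
  · rw [logExponent]
    split_ifs with hj
    · exact (hkJ j hj).symm
    · rw [hDY j (by omega), hK j hj, hkk j]
      simp

/-- The missing value `D'_J(d)` is minus the sum of the others. -/
theorem OnlyNeg.eq_of_logExponent_eq {n J : ℕ} {d d' : Fin (n - 1) → ℕ} (hd : OnlyNeg n J d)
    (hd' : OnlyNeg n J d') (h : logExponent n J d = logExponent n J d') : d = d' := by
  refine eq_of_DY_eq fun j hj => ?_
  by_cases hjJ : j = J
  · have h1 := hd.sum_logExponent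
    have h2 := hd'.sum_logExponent
    rw [h] at h1
    rw [hjJ]
    omega
  · have h1 := congrFun h ⟨j, by omega⟩
    simp only [logExponent, if_neg hjJ] at h1
    have h2 := hd.2 j (Finset.mem_range.2 (by omega)) hjJ
    have h3 := hd'.2 j (Finset.mem_range.2 (by omega)) hjJ
    omega

/-- If `y_m` is a multiplicative second difference of `P`, then in `y^d` the second difference can
be moved to `d`. -/
theorem prod_pow_eq_prod_zpow_DY {n : ℕ} (P : ℕ → ℂ) (hP : ∀ j, P j ≠ 0) (d : Fin (n - 1) → ℕ) :
    ∏ m : Fin (n - 1), (P m * P (m + 2) / P (m + 1) ^ 2) ^ d m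
      = ∏ j ∈ Finset.range (n + 1), P j ^ DY n d j := by
  have key : ∀ M, ∏ j ∈ Finset.range (M + 1), P j ^ DY n d j
      = (∏ m ∈ Finset.range M, (P m * P (m + 2) / P (m + 1) ^ 2) ^ entry n 0 d (m + 1))
        * (P M ^ ((entry n 0 d (M + 1) : ℕ) : ℤ) * P (M + 1) ^ (-((entry n 0 d M : ℕ) : ℤ))) := by
    intro M
    induction M with
    | zero => simp [DY_zero, entry_of_not (n := n) (j := 0)]
    | succ M ih =>
      rw [Finset.prod_range_succ, ih, DY_succ, Finset.prod_range_succ]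
      have h0 := hP M
      have h1 := hP (M + 1)
      have h2 := hP (M + 2)
      rw [show M + 1 + 1 = M + 2 from rfl]
      simp only [zpow_add₀ h1, zpow_sub₀ h1, zpow_neg, zpow_natCast, zpow_mul, div_pow, mul_pow]
      rw [show ((2 : ℤ)) = ((2 : ℕ) : ℤ) from rfl, zpow_natCast]
      field_simp
  rcases Nat.eq_zero_or_pos n with rfl | hn
  · simp [DY, entry]
  obtain ⟨m, rfl⟩ : ∃ m, n = m + 1 := ⟨n - 1, by omega⟩
  rw [key, Finset.prod_range_succ, entry_of_not (j := m + 1) (by omega),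
    entry_of_not (j := m + 1 + 1) (by omega)]
  simp only [pow_zero, mul_one, Nat.cast_zero, zpow_zero, neg_zero]
  rw [← Fin.prod_univ_eq_prod_range
    (fun j => (P j * P (j + 2) / P (j + 1) ^ 2) ^ entry (m + 1) 0 d (j + 1)) m]
  refine Finset.prod_congr rfl fun j _ => ?_
  rw [show entry (m + 1) 0 d ((j : ℕ) + 1) = d j from entry_succ (n := m + 1) (v := d) j]

/-! ### Constant terms of a logarithm on an annulus -/

theorem circleIntegral_inv_mul_zpow (N : ℤ) :
    (∮ T in C(0, 1), T⁻¹ * T ^ N) = if N = 0 then 2 * Real.pi * Complex.I else 0 := by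
  have h : (∮ T in C(0, 1), T⁻¹ * T ^ N) = ∮ T in C(0, 1), (T - 0) ^ (N - 1) := by
    refine circleIntegral.integral_congr zero_le_one fun T hT => ?_
    have hT0 : T ≠ 0 := by
      rintro rfl
      simp at hT
    simp only [sub_zero]
    rw [zpow_sub_one₀ hT0, mul_comm]
  rw [h]
  split_ifs with hN
  · subst hN
    have := circleIntegral.integral_sub_center_inv 0 (R := 1) one_ne_zero
    simpa using this
  · exact circleIntegral.integral_sub_zpow_of_ne (by omega) _ _ _

theorem norm_mul_zpow_of_mem_sphere {T : ℂ} (hT : T ∈ Metric.sphere (0 : ℂ) 1) (a : ℂ) (s : ℤ) :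
    ‖a * T ^ s‖ = ‖a‖ := by
  rw [mem_sphere_zero_iff_norm] at hT
  rw [norm_mul, norm_zpow, hT, one_zpow, mul_one]

theorem continuousOn_zpow_sphere (s : ℤ) :
    ContinuousOn (fun T : ℂ => T ^ s) (Metric.sphere (0 : ℂ) 1) := by
  intro T hT
  refine (continuousAt_zpow₀ T s (Or.inl ?_)).continuousWithinAt
  rintro rfl
  simp at hT

theorem continuousOn_inv_sphere : ContinuousOn (fun T : ℂ => T⁻¹) (Metric.sphere (0 : ℂ) 1) := by
  simpa using continuousOn_zpow_sphere (-1)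

/-- The constant term of `log (1 + a T^s)` is `0`. -/
theorem circleIntegral_inv_mul_log {a : ℂ} (ha : ‖a‖ < 1) {s : ℤ} (hs : s ≠ 0) :
    (∮ T in C(0, 1), T⁻¹ * Complex.log (1 + a * T ^ s)) = 0 := by
  have h := hasSum_circleIntegral (c := 0) (R := 1)
    (f := fun (m : ℕ) T => T⁻¹ * ((-1) ^ (m + 1) * (a * T ^ s) ^ m / m))
    (g := fun T => T⁻¹ * Complex.log (1 + a * T ^ s)) (b := fun m => ‖a‖ ^ m) zero_le_one
    (summable_geometric_of_lt_one (norm_nonneg _) ha) (fun m => ?_) (fun m T hT => ?_)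
    (fun T hT => ?_)
  · have h0 : ∀ m : ℕ, (∮ T in C(0, 1), T⁻¹ * ((-1) ^ (m + 1) * (a * T ^ s) ^ m / m)) = 0 := by
      intro m
      rcases Nat.eq_zero_or_pos m with rfl | hm
      · simp [circleIntegral]
      · have h1 : ∀ T : ℂ, T⁻¹ * ((-1) ^ (m + 1) * (a * T ^ s) ^ m / m)
            = ((-1) ^ (m + 1) * a ^ m / m) * (T⁻¹ * T ^ (s * m)) := by
          intro T
          rw [mul_pow, zpow_mul, zpow_natCast]
          ring
        simp only [h1]
        rw [circleIntegral.integral_const_mul, circleIntegral_inv_mul_zpow, if_neg, mul_zero]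
        exact mul_ne_zero hs (by omega)
    simp only [h0] at h
    exact h.unique hasSum_zero
  · have h1 := continuousOn_zpow_sphere s
    have h2 := continuousOn_inv_sphere
    fun_prop
  · have h1 := norm_mul_zpow_of_mem_sphere hT a s
    have h2 := mem_sphere_zero_iff_norm.1 hT
    rw [norm_mul, norm_inv, h2, norm_div, norm_mul, norm_pow, norm_pow, h1]
    simp only [norm_neg, norm_one, one_pow, inv_one, one_mul, Complex.norm_natCast]
    rcases Nat.eq_zero_or_pos m with rfl | hm
    · simp
    · exact div_le_self (by positivity) (by exact_mod_cast hm)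
  · refine (Complex.hasSum_taylorSeries_log ?_).mul_left _
    rwa [norm_mul_zpow_of_mem_sphere hT]

theorem log_mul_one_add {z w : ℂ} (hz : ‖z‖ ≤ 1 / 2) (hw : ‖w‖ ≤ 1 / 2) :
    Complex.log ((1 + z) * (1 + w)) = Complex.log (1 + z) + Complex.log (1 + w) := by
  have h := log_prod_one_add Finset.univ ![z, w] (by
    intro j _; fin_cases j <;> simp <;> linarith) (by
    simp only [Fin.sum_univ_two, Matrix.cons_val_zero, Matrix.cons_val_one]; linarith)
  simpa using h

open Polynomial in
theorem natDegree_annProd_le {n i : ℕ} (hi : i ≤ n) (a : ℕ → ℂ) :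
    (annProd n i a).natDegree ≤ n := by
  have h1 : (∏ j ∈ Finset.range i, (X + C (a j))).natDegree ≤ i := by
    refine (natDegree_prod_le _ _).trans ?_
    simp
  have h2 : (∏ j ∈ Finset.Ico i n, (1 + C (a j) * X)).natDegree ≤ n - i := by
    refine (natDegree_prod_le _ _).trans ?_
    refine (Finset.sum_le_card_nsmul _ _ 1 fun j _ => ?_).trans (by simp)
    exact natDegree_add_le_of_degree_le (by simp) ((natDegree_C_mul_le _ _).trans (by simp))
  exact (natDegree_mul_le).trans (by omega)

/-- The exponents of `T` in the factors of `annProd n i a / T^i`. -/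
def annSign (i j : ℕ) : ℤ := if j < i then -1 else 1

theorem annSign_ne_zero (i j : ℕ) : annSign i j ≠ 0 := by unfold annSign; split_ifs <;> simp

/-- The factorization of `annProd n i a / T^i` into factors close to `1` on the unit circle. -/
theorem sum_coeff_annProd_mul_zpow {n i : ℕ} (hi : i ≤ n) (a : ℕ → ℂ) {T : ℂ} (hT : T ≠ 0) :
    ∑ k ∈ Finset.range (n + 1), (annProd n i a).coeff k * T ^ ((k : ℤ) - i)
      = ∏ j ∈ Finset.range n, (1 + a j * T ^ annSign i j) := by
  have h1 := Polynomial.eval_eq_sum_range' (Nat.lt_succ_of_le (natDegree_annProd_le hi a)) T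
  have h2 : (annProd n i a).eval T = T ^ i * ∏ j ∈ Finset.range n, (1 + a j * T ^ annSign i j) := by
    rw [annProd, Polynomial.eval_mul, Polynomial.eval_prod, Polynomial.eval_prod,
      ← Finset.prod_range_mul_prod_Ico _ hi, ← mul_assoc]
    congr 1
    · have : T ^ i = ∏ _j ∈ Finset.range i, T := by simp
      rw [this, ← Finset.prod_mul_distrib]
      refine Finset.prod_congr rfl fun j hj => ?_
      rw [annSign, if_pos (Finset.mem_range.1 hj), zpow_neg_one]
      simp only [Polynomial.eval_add, Polynomial.eval_X, Polynomial.eval_C]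
      field_simp
    · refine Finset.prod_congr rfl fun j hj => ?_
      rw [annSign, if_neg (by simpa using (Finset.mem_Ico.1 hj).1), zpow_one]
      simp
  have hTi : T ^ i ≠ 0 := pow_ne_zero _ hT
  apply mul_left_cancel₀ hTi
  rw [← h2, h1, Finset.mul_sum]
  refine Finset.sum_congr rfl fun k _ => ?_
  rw [zpow_sub₀ hT, zpow_natCast, zpow_natCast]
  field_simp

/-- The variables of the expansion of `log (1 + ∑_{j ≠ i} (P_j / P_i) T^{j - i})`. -/
def annRatio (n i : ℕ) (P : ℕ → ℂ) (j : Fin (n + 1)) : ℂ := if (j : ℕ) = i then 0 else P j / P i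

theorem card_mul_norm_annRatio_le {n i : ℕ} {P : ℕ → ℂ} (hi : i ≤ n)
    (hP : ∀ k ≤ n, ‖P k - (if k = i then 1 else 0)‖ ≤ 1 / (4 * ((n : ℝ) + 1))) (j : Fin (n + 1)) :
    Fintype.card (Fin (n + 1)) * ‖annRatio n i P j‖ ≤ 1 / 2 := by
  have hn1 : (0 : ℝ) < (n : ℝ) + 1 := by positivity
  have hle : 1 / (4 * ((n : ℝ) + 1)) ≤ 1 / 4 := by
    apply one_div_le_one_div_of_le (by norm_num)
    linarith [Nat.cast_nonneg (α := ℝ) n]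
  have h1 := hP i hi
  rw [if_pos rfl] at h1
  have h2 : 1 / 2 ≤ ‖P i‖ := by
    have : ‖(1 : ℂ)‖ ≤ ‖P i‖ + ‖P i - 1‖ := by
      calc ‖(1 : ℂ)‖ = ‖P i - (P i - 1)‖ := by ring_nf
        _ ≤ _ := norm_sub_le _ _
    rw [norm_one] at this
    linarith
  rw [Fintype.card_fin, annRatio]
  split_ifs with hj
  · simp
  · have h3 := hP j (by omega)
    rw [if_neg hj, sub_zero] at h3
    push_cast
    rw [norm_div, ← mul_div_assoc, div_le_iff₀ (by linarith)]
    calc ((n : ℝ) + 1) * ‖P j‖ ≤ (n + 1) * (1 / (4 * ((n : ℝ) + 1))) := by gcongr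
      _ = 1 / 4 := by field_simp
      _ ≤ 1 / 2 * ‖P i‖ := by linarith

theorem norm_sum_annRatio_le {n i : ℕ} {P : ℕ → ℂ} (hi : i ≤ n)
    (hP : ∀ k ≤ n, ‖P k - (if k = i then 1 else 0)‖ ≤ 1 / (4 * ((n : ℝ) + 1)))
    {u : Fin (n + 1) → ℂ} (hu : ∀ j, ‖u j‖ = 1) :
    ‖∑ j, annRatio n i P j * u j‖ ≤ 1 / 2 := by
  have hn1 : (0 : ℝ) < (n : ℝ) + 1 := by positivity
  calc ‖∑ j, annRatio n i P j * u j‖ ≤ ∑ j, ‖annRatio n i P j * u j‖ := norm_sum_le _ _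
    _ ≤ ∑ _j : Fin (n + 1), (1 / 2) / ((n : ℝ) + 1) := by
      refine Finset.sum_le_sum fun j _ => ?_
      have := card_mul_norm_annRatio_le hi hP j
      rw [Fintype.card_fin] at this
      push_cast at this
      rw [norm_mul, hu, mul_one, le_div_iff₀ hn1, mul_comm]
      exact this
    _ = 1 / 2 := by simp; field_simp

theorem log_one_add_sum_annRatio {n i : ℕ} (hi : i ≤ n) {a P : ℕ → ℂ} (hP0 : P i ≠ 0)
    (ha : ∀ j < n, ‖a j‖ ≤ 1 / (2 * ((n : ℝ) + 1))) (hPa : ∀ k ≤ n, P k = (annProd n i a).coeff k)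
    (hP : ∀ k ≤ n, ‖P k - (if k = i then 1 else 0)‖ ≤ 1 / (4 * ((n : ℝ) + 1)))
    {T : ℂ} (hT : T ∈ Metric.sphere (0 : ℂ) 1) :
    Complex.log (1 + ∑ j : Fin (n + 1), annRatio n i P j * T ^ ((j : ℤ) - i))
      = ∑ j ∈ Finset.range n, Complex.log (1 + a j * T ^ annSign i j) - Complex.log (P i) := by
  have hT1 := mem_sphere_zero_iff_norm.1 hT
  have hT0 : T ≠ 0 := by
    rintro rfl
    simp at hT1
  have hn1 : (0 : ℝ) < (n : ℝ) + 1 := by positivity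
  have hn0 := Nat.cast_nonneg (α := ℝ) n
  have hle : 1 / (4 * ((n : ℝ) + 1)) ≤ 1 / 2 := by
    apply one_div_le_one_div_of_le (by norm_num)
    linarith
  have h1 := norm_sum_annRatio_le hi hP (u := fun j => T ^ ((j : ℤ) - i)) fun j => by
    rw [norm_zpow, hT1, one_zpow]
  have h2 : P i * (1 + ∑ j : Fin (n + 1), annRatio n i P j * T ^ ((j : ℤ) - i))
      = ∏ j ∈ Finset.range n, (1 + a j * T ^ annSign i j) := by
    rw [← sum_coeff_annProd_mul_zpow hi a hT0]
    have h3 : ∑ j : Fin (n + 1), annRatio n i P j * T ^ ((j : ℤ) - i)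
        = ∑ k ∈ Finset.range (n + 1), (if k = i then 0 else P k / P i) * T ^ ((k : ℤ) - i) :=
      Fin.sum_univ_eq_sum_range (fun k => (if k = i then 0 else P k / P i) * T ^ ((k : ℤ) - i)) _
    have him : i ∈ Finset.range (n + 1) := Finset.mem_range.2 (by omega)
    rw [h3, ← Finset.add_sum_erase _ _ him, ← Finset.add_sum_erase _ _ him, if_pos rfl, zero_mul,
      zero_add, sub_self, zpow_zero, mul_one, mul_add, mul_one, ← hPa i hi, Finset.mul_sum]
    congr 1
    refine Finset.sum_congr rfl fun k hk => ?_
    rw [if_neg (Finset.ne_of_mem_erase hk),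
      ← hPa k (by have := Finset.mem_range.1 (Finset.mem_of_mem_erase hk); omega)]
    field_simp
  have h4 := hP i hi
  rw [if_pos rfl] at h4
  have h5 := log_mul_one_add (z := P i - 1)
    (w := ∑ j : Fin (n + 1), annRatio n i P j * T ^ ((j : ℤ) - i)) (h4.trans hle) h1
  rw [add_sub_cancel, h2, log_prod_one_add] at h5
  · rw [h5]; ring
  · intro j hj
    rw [norm_mul_zpow_of_mem_sphere hT]
    refine (ha j (Finset.mem_range.1 hj)).trans ?_
    apply one_div_le_one_div_of_le (by norm_num)
    linarith
  · calc ∑ j ∈ Finset.range n, ‖a j * T ^ annSign i j‖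
        ≤ ∑ _j ∈ Finset.range n, 1 / (2 * ((n : ℝ) + 1)) := by
          refine Finset.sum_le_sum fun j hj => ?_
          rw [norm_mul_zpow_of_mem_sphere hT]
          exact ha j (Finset.mem_range.1 hj)
      _ ≤ 1 := by
          rw [Finset.sum_const, Finset.card_range, nsmul_eq_mul, mul_one_div,
            div_le_one (by positivity)]
          linarith

/-- The logarithm splits into those of the factors `1 + a_j T^{±1}`, whose constant terms vanish,
and the constant `-log P_i`. -/
theorem circleIntegral_inv_mul_log_annRatio {n i : ℕ} (hi : i ≤ n) {a P : ℕ → ℂ} (hP0 : P i ≠ 0)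
    (ha : ∀ j < n, ‖a j‖ ≤ 1 / (2 * ((n : ℝ) + 1))) (hPa : ∀ k ≤ n, P k = (annProd n i a).coeff k)
    (hP : ∀ k ≤ n, ‖P k - (if k = i then 1 else 0)‖ ≤ 1 / (4 * ((n : ℝ) + 1))) :
    (∮ T in C(0, 1),
        T⁻¹ * Complex.log (1 + ∑ j : Fin (n + 1), annRatio n i P j * T ^ ((j : ℤ) - i)))
      = 2 * Real.pi * Complex.I * (-Complex.log (P i)) := by
  have ha1 : ∀ j < n, ‖a j‖ < 1 := fun j hj => (ha j hj).trans_lt (by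
    rw [div_lt_one (by positivity)]
    linarith [Nat.cast_nonneg (α := ℝ) n])
  have h1 : (∮ T in C(0, 1),
        T⁻¹ * Complex.log (1 + ∑ j : Fin (n + 1), annRatio n i P j * T ^ ((j : ℤ) - i)))
      = ∮ T in C(0, 1), ((∑ j ∈ Finset.range n, T⁻¹ * Complex.log (1 + a j * T ^ annSign i j))
        - Complex.log (P i) * (T - 0)⁻¹) := by
    refine circleIntegral.integral_congr zero_le_one fun T hT => ?_
    rw [log_one_add_sum_annRatio hi hP0 ha hPa hP hT, mul_sub, Finset.mul_sum,
      sub_zero, mul_comm T⁻¹ (Complex.log _)]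
  have hcont : ∀ j ∈ Finset.range n, ContinuousOn
      (fun T : ℂ => T⁻¹ * Complex.log (1 + a j * T ^ annSign i j)) (Metric.sphere (0 : ℂ) 1) := by
    intro j hj
    refine continuousOn_inv_sphere.mul (ContinuousOn.clog ?_ fun T hT => ?_)
    · have := continuousOn_zpow_sphere (annSign i j)
      fun_prop
    · refine Complex.mem_slitPlane_of_norm_lt_one ?_
      rw [norm_mul_zpow_of_mem_sphere hT]
      exact ha1 j (Finset.mem_range.1 hj)
  rw [h1, circleIntegral.integral_sub, circleIntegral.integral_fun_sum, Finset.sum_eq_zero,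
    circleIntegral.integral_const_mul, circleIntegral.integral_sub_center_inv 0 one_ne_zero]
  · ring
  · intro j hj
    exact circleIntegral_inv_mul_log (ha1 j (Finset.mem_range.1 hj)) (annSign_ne_zero i j)
  · exact fun j hj => (hcont j hj).circleIntegrable zero_le_one
  · exact (continuousOn_finsetSum _ hcont).circleIntegrable zero_le_one
  · have := continuousOn_inv_sphere
    refine ContinuousOn.circleIntegrable zero_le_one ?_
    simp only [sub_zero]
    fun_prop

/-- The constant term of `log (1 + ∑_{j ≠ i} (P_j / P_i) T^{j - i})`, computed from its expansion
on the one hand and from `circleIntegral_inv_mul_log_annRatio` on the other hand. -/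
theorem hasSum_constantTerm_log {n i : ℕ} (hi : i ≤ n) {a P : ℕ → ℂ} (hP0 : P i ≠ 0)
    (ha : ∀ j < n, ‖a j‖ ≤ 1 / (2 * ((n : ℝ) + 1))) (hPa : ∀ k ≤ n, P k = (annProd n i a).coeff k)
    (hP : ∀ k ≤ n, ‖P k - (if k = i then 1 else 0)‖ ≤ 1 / (4 * ((n : ℝ) + 1))) :
    HasSum (fun k : Fin (n + 1) → ℕ => if ∑ j : Fin (n + 1), ((j : ℤ) - i) * k j = 0 then
      logCoeff k * ∏ j, annRatio n i P j ^ k j else 0) (-Complex.log (P i)) := by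
  have hz : ∀ T ∈ Metric.sphere (0 : ℂ) 1, ∀ j : Fin (n + 1),
      Fintype.card (Fin (n + 1)) * ‖annRatio n i P j * T ^ ((j : ℤ) - i)‖ ≤ 1 / 2 := by
    intro T hT j
    rw [norm_mul_zpow_of_mem_sphere hT]
    exact card_mul_norm_annRatio_le hi hP j
  have h := hasSum_circleIntegral (c := 0) (R := 1)
    (f := fun (k : Fin (n + 1) → ℕ) T =>
      T⁻¹ * (logCoeff k * ∏ j, (annRatio n i P j * T ^ ((j : ℤ) - i)) ^ k j))
    (g := fun T => T⁻¹ * Complex.log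
      (1 + ∑ j : Fin (n + 1), annRatio n i P j * T ^ ((j : ℤ) - i)))
    (b := fun k => ∏ j, (1 / 2 : ℝ) ^ k j) zero_le_one
    (summable_prod_pow _ (fun _ => by norm_num) fun _ => by norm_num)
    (fun k => ?_) (fun k T hT => ?_) (fun T hT => ?_)
  · rw [circleIntegral_inv_mul_log_annRatio hi hP0 ha hPa hP] at h
    have h1 : ∀ k : Fin (n + 1) → ℕ, (∮ T in C(0, 1),
        T⁻¹ * (logCoeff k * ∏ j, (annRatio n i P j * T ^ ((j : ℤ) - i)) ^ k j))
        = 2 * Real.pi * Complex.I * if ∑ j : Fin (n + 1), ((j : ℤ) - i) * k j = 0 then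
          logCoeff k * ∏ j, annRatio n i P j ^ k j else 0 := by
      intro k
      have h2 : (∮ T in C(0, 1),
          T⁻¹ * (logCoeff k * ∏ j, (annRatio n i P j * T ^ ((j : ℤ) - i)) ^ k j))
          = ∮ T in C(0, 1), (logCoeff k * ∏ j, annRatio n i P j ^ k j)
            * (T⁻¹ * T ^ (∑ j : Fin (n + 1), ((j : ℤ) - i) * k j)) := by
        refine circleIntegral.integral_congr zero_le_one fun T hT => ?_
        have hT0 : T ≠ 0 := by
          rintro rfl
          simp at hT
        have h3 : ∀ s : Finset (Fin (n + 1)), T ^ (∑ j ∈ s, ((j : ℤ) - i) * k j)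
            = ∏ j ∈ s, (T ^ ((j : ℤ) - i)) ^ k j := by
          intro s
          induction s using Finset.induction_on with
          | empty => simp
          | insert j s hj ih =>
            rw [Finset.sum_insert hj, Finset.prod_insert hj, zpow_add₀ hT0, ih, zpow_mul,
              zpow_natCast]
        rw [h3]
        simp only [mul_pow, Finset.prod_mul_distrib]
        ring
      rw [h2, circleIntegral.integral_const_mul, circleIntegral_inv_mul_zpow]
      split_ifs <;> ring
    simp only [h1] at h
    have h2pi : (2 * Real.pi * Complex.I : ℂ) ≠ 0 := Complex.two_pi_I_ne_zero
    exact (hasSum_mul_left_iff h2pi).1 h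
  · have h1 := continuousOn_inv_sphere
    have h2 := fun s => continuousOn_zpow_sphere s
    refine h1.mul (continuousOn_const.mul (continuousOn_finsetProd _ fun j _ => ?_))
    exact (continuousOn_const.mul (h2 _)).pow _
  · have h1 := norm_logCoeff_mul_prod_le _ (hz T hT) k
    rw [norm_mul, norm_inv, mem_sphere_zero_iff_norm.1 hT, inv_one, one_mul]
    exact h1
  · exact (hasSum_log_one_add_sum (by norm_num) (by norm_num) _ (hz T hT)).mul_left _

theorem flatYCoeff_mul_eq {n i : ℕ} {P : ℕ → ℂ} (hP0 : ∀ j, P j ≠ 0)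
    {d : Fin (n - 1) → ℕ} (hd : OnlyNeg n i d) :
    flatYCoeff n i d * ∏ m : Fin (n - 1), (P m * P (m + 2) / P (m + 1) ^ 2) ^ d m
      = logCoeff (logExponent n i d) * ∏ j, annRatio n i P j ^ logExponent n i d j := by
  have hi := hd.mem
  have him : i ∈ Finset.range (n + 1) := Finset.mem_range.2 (by omega)
  rw [flatYCoeff, if_pos hd, prod_pow_eq_prod_zpow_DY P hP0]
  congr 1
  have h1 : ∏ j, annRatio n i P j ^ logExponent n i d j
      = ∏ j ∈ Finset.range (n + 1),
        (if j = i then (0 : ℂ) else P j / P i) ^ (if j = i then 0 else (DY n d j).toNat) :=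
    Fin.prod_univ_eq_prod_range
      (fun j => (if j = i then (0 : ℂ) else P j / P i) ^ (if j = i then 0 else (DY n d j).toNat)) _
  have h2 : ∏ j ∈ (Finset.range (n + 1)).erase i,
      (if j = i then (0 : ℂ) else P j / P i) ^ (if j = i then 0 else (DY n d j).toNat)
      = ∏ j ∈ (Finset.range (n + 1)).erase i, (P j ^ DY n d j * (P i)⁻¹ ^ DY n d j) := by
    refine Finset.prod_congr rfl fun j hj => ?_
    have hne := Finset.ne_of_mem_erase hj
    rw [if_neg hne, if_neg hne, ← mul_zpow, ← div_eq_mul_inv]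
    conv_rhs => rw [← Int.toNat_of_nonneg (hd.2 j (Finset.mem_of_mem_erase hj) hne)]
    rw [zpow_natCast]
  have h3 : ∀ s : Finset ℕ, ∏ j ∈ s, (P i)⁻¹ ^ DY n d j = (P i)⁻¹ ^ ∑ j ∈ s, DY n d j := by
    intro s
    induction s using Finset.induction_on with
    | empty => simp
    | insert j s hj ih =>
      rw [Finset.sum_insert hj, Finset.prod_insert hj, zpow_add₀ (inv_ne_zero (hP0 i)), ih]
  have h4 := sum_DY d
  rw [← Finset.add_sum_erase _ _ him] at h4
  rw [h1, ← Finset.mul_prod_erase _ _ him, ← Finset.mul_prod_erase _ _ him, h2,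
    Finset.prod_mul_distrib, h3, show ∑ j ∈ (Finset.range (n + 1)).erase i, DY n d j = -DY n d i by
      linarith, if_pos rfl, if_pos rfl, pow_zero, one_mul, inv_zpow, zpow_neg, inv_inv, mul_comm]

/-- The terms of `flatYSeries n i` are the nonzero terms of the expansion in
`hasSum_constantTerm_log`, if `y_m` is the second difference (in multiplicative notation) of the
coefficients `P`. -/
theorem flatYSeries_eq_neg_log {n i : ℕ} (hi : 1 ≤ i ∧ i < n) {a P : ℕ → ℂ} (hP0 : ∀ j, P j ≠ 0)
    (ha : ∀ j < n, ‖a j‖ ≤ 1 / (2 * ((n : ℝ) + 1))) (hPa : ∀ k ≤ n, P k = (annProd n i a).coeff k)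
    (hP : ∀ k ≤ n, ‖P k - (if k = i then 1 else 0)‖ ≤ 1 / (4 * ((n : ℝ) + 1))) :
    flatYSeries n i (fun m : Fin (n - 1) => P m * P (m + 2) / P (m + 1) ^ 2)
      = -Complex.log (P i) := by
  have h := hasSum_constantTerm_log hi.2.le (hP0 i) ha hPa hP
  refine HasSum.tsum_eq ?_
  have hon : ∀ d : Function.support (fun d : Fin (n - 1) → ℕ => flatYCoeff n i d
      * ∏ m : Fin (n - 1), (P m * P (m + 2) / P (m + 1) ^ 2) ^ d m), OnlyNeg n i d := by
    rintro ⟨d, hd⟩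
    by_contra hc
    exact hd (by simp only [flatYCoeff_of_not hc, zero_mul])
  have hweight : ∀ {d : Fin (n - 1) → ℕ}, OnlyNeg n i d →
      ∑ j : Fin (n + 1), ((j : ℤ) - i) * logExponent n i d j = 0 := by
    intro d hd
    have h1 : ∑ j : Fin (n + 1), ((j : ℤ) - i) * logExponent n i d j
        = ∑ j ∈ Finset.range (n + 1), ((j : ℤ) - i) * DY n d j := by
      rw [← Fin.sum_univ_eq_sum_range (fun j => ((j : ℤ) - i) * DY n d j)]
      refine Finset.sum_congr rfl fun j _ => ?_
      rw [logExponent]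
      split_ifs with hj
      · rw [hj, sub_self, zero_mul, zero_mul]
      · rw [Int.toNat_of_nonneg (hd.2 j (Finset.mem_range.2 j.2) hj)]
    have h2 : ∀ m, ∑ j ∈ Finset.range (m + 1), (j : ℤ) * DY n d j
        = m * (entry n 0 d (m + 1) - entry n 0 d m : ℤ) - entry n 0 d m := by
      intro m
      induction m with
      | zero => simp [entry_of_not (n := n) (j := 0)]
      | succ m ih => rw [Finset.sum_range_succ, ih, DY_succ]; push_cast; ring
    rw [h1]
    simp only [sub_mul]
    rw [Finset.sum_sub_distrib, ← Finset.mul_sum, sum_DY, h2, entry_of_not (by omega),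
      entry_of_not (by omega)]
    simp
  refine (hasSum_iff_hasSum_of_ne_zero_bij (fun d => logExponent n i d.1) ?_ ?_ ?_).1 h
  · intro d d' hdd
    exact Subtype.ext ((hon d).eq_of_logExponent_eq (hon d') hdd)
  · intro k hk
    simp only [Function.mem_support, ne_eq, ite_eq_right_iff, Classical.not_imp] at hk
    obtain ⟨hk1, hk2⟩ := hk
    have hk3 : ∑ j, k j ≠ 0 := by
      intro h0
      exact hk2 (by rw [logCoeff, if_pos h0, zero_mul])
    have hk4 : ∀ j : Fin (n + 1), (j : ℕ) = i → k j = 0 := by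
      intro j hj
      by_contra hkj
      refine hk2 (mul_eq_zero_of_right _ (Finset.prod_eq_zero (Finset.mem_univ j) ?_))
      rw [annRatio, if_pos hj, zero_pow hkj]
    obtain ⟨d, hd, rfl⟩ := exists_onlyNeg hi hk4 hk3 hk1
    refine ⟨⟨d, ?_⟩, rfl⟩
    rw [Function.mem_support, flatYCoeff_mul_eq hP0 hd]
    exact hk2
  · intro d
    rw [if_pos (hweight (hon d)), flatYCoeff_mul_eq hP0 (hon d)]

/-! ### The flat coordinates of `Y` as differences of logarithms of roots -/

theorem leadRatio_zero {n : ℕ} {A : ℕ → ℂ} (hA : ∏ j ∈ Finset.range n, A j = 1) :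
    leadRatio n A 0 = 1 := by
  rw [leadRatio, coeff_zero_rootProd, ← Finset.range_eq_Ico, hA, div_one]

theorem leadRatio_self (n : ℕ) (A : ℕ → ℂ) : leadRatio n A n = 1 := by
  have := monic_rootProd n A
  rw [Polynomial.Monic, Polynomial.leadingCoeff, natDegree_rootProd] at this
  rw [leadRatio, this, Finset.Ico_self, Finset.prod_empty, div_one]

/-- The coefficients `P` of the rescaled polynomial have the same multiplicative second
differences as those of `W`. -/
theorem flatYSeries_xToY {n i : ℕ} (hn : 2 ≤ n) (hi : 1 ≤ i ∧ i < n) {x : Chart n} {A : ℕ → ℂ}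
    (hA : ∀ j, A j ≠ 0) (hx : WX n x = rootProd n A) (hx0 : ∀ j, x.2 j ≠ 0) {r : ℂ} (hr : r ≠ 0)
    (ha : ∀ j < n, ‖annParam i r A j‖ ≤ 1 / (2 * ((n : ℝ) + 1)))
    (hP : ∀ k ≤ n, ‖(annProd n i (annParam i r A)).coeff k - (if k = i then 1 else 0)‖
      ≤ 1 / (4 * ((n : ℝ) + 1))) :
    flatYSeries n i (xToY n x).2 = -Complex.log (leadRatio n A i) := by
  -- the values `P k` for `k > n` do not matter as long as they are nonzero
  let P : ℕ → ℂ := fun k => if k ≤ n then (annProd n i (annParam i r A)).coeff k else 1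
  have hPk : ∀ k ≤ n, P k = (annProd n i (annParam i r A)).coeff k := fun k hk => if_pos hk
  have hprod : ∏ j ∈ Finset.Ico i n, A j ≠ 0 := Finset.prod_ne_zero_iff.2 fun j _ => hA j
  have hent : ∀ k ≤ n, entry n 1 x.2 k * r ^ k = r ^ i * (∏ j ∈ Finset.Ico i n, A j) * P k := by
    intro k hk
    rw [← coeff_WX hn x hk, hx, hPk k hk]
    exact coeff_rootProd_mul_pow hi.2.le hr hA k
  have hent0 := entry_one_ne_zero hx0
  have hP0 : ∀ j, P j ≠ 0 := by
    intro j
    by_cases hj : j ≤ n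
    · intro h
      have h1 := hent j hj
      rw [h, mul_zero] at h1
      exact mul_ne_zero (hent0 j) (pow_ne_zero _ hr) h1
    · simp [P, hj]
  have hC : r ^ i * ∏ j ∈ Finset.Ico i n, A j ≠ 0 := mul_ne_zero (pow_ne_zero _ hr) hprod
  have hy : (xToY n x).2 = fun m : Fin (n - 1) => P m * P (m + 2) / P (m + 1) ^ 2 := by
    funext m
    have hm := m.2
    have h0 := hent m (by omega)
    have h1 := hent (m + 1) (by omega)
    have h2 := hent (m + 2) (by omega)
    have e : ∀ k ≤ n, P k = entry n 1 x.2 k * r ^ k / (r ^ i * ∏ j ∈ Finset.Ico i n, A j) :=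
      fun k hk => by rw [eq_div_iff hC, hent k hk, mul_comm]
    have hm1 := hent0 (m + 1)
    rw [e _ (by omega), e _ (by omega), e _ (by omega)]
    simp only [xToY]
    field_simp
    ring
  rw [hy, flatYSeries_eq_neg_log hi hP0 ha hPk, hPk i hi.2.le, leadRatio_eq hi.2.le hr hA]
  intro k hk
  rw [hPk k hk]
  exact hP k hk

theorem norm_exp_le_two_mul {u v : ℂ} (h : ‖u - v‖ ≤ 1 / 2) :
    ‖Complex.exp u‖ ≤ 2 * ‖Complex.exp v‖ := by
  have h1 := (Complex.abs_re_le_norm _).trans h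
  have h2 := abs_le.1 h1
  rw [Complex.sub_re] at h2
  have h3 : Real.exp (1 / 2) ≤ 2 := by
    have := Real.add_one_le_exp (-(1 / 2))
    rw [Real.exp_neg] at this
    have hpos := Real.exp_pos (1 / 2)
    have h4 := mul_le_mul_of_nonneg_right this hpos.le
    rw [inv_mul_cancel₀ hpos.ne'] at h4
    linarith
  rw [Complex.norm_exp, Complex.norm_exp]
  calc Real.exp u.re ≤ Real.exp (1 / 2 + v.re) := Real.exp_le_exp.2 (by linarith)
    _ = Real.exp (1 / 2) * Real.exp v.re := Real.exp_add _ _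
    _ ≤ _ := mul_le_mul_of_nonneg_right h3 (Real.exp_pos _).le

/-- Near the start of the path, the flat coordinates of `Y` are the differences of the logarithms
of the negatives of consecutive roots of `W`. The logarithms of the roots may be any that are
close to those along the path; this pins the principal branch of `log y_i`. -/
theorem exists_flatY_eq_sub {n : ℕ} (hn : 2 ≤ n) :
    ∃ τ : ℝ, 0 < τ ∧ ∀ t : ℝ, 0 < t → t < τ → ∀ (x : Chart n) (U : ℕ → ℂ),
      WX n x = rootProd n (fun j => Complex.exp (U j)) →
      (∀ j < n, ‖U j - pathLog n t j‖ ≤ 1 / 2) → (∀ j, x.2 j ≠ 0) →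
      ∀ i, i + 1 < n → flatY n (i + 1) (xToY n x) = U i - U (i + 1) := by
  have hn0 : (2 : ℝ) ≤ n := by exact_mod_cast hn
  obtain ⟨ε, hε, hcoef⟩ := exists_norm_coeff_annProd_sub_lt n
    (show (0 : ℝ) < 1 / (4 * ((n : ℝ) + 1)) by positivity)
  -- `ε'` makes the coefficients close to those of `X^i` and the factors of `annProd` close to `1`
  let ε' := min ε (1 / (2 * ((n : ℝ) + 1)))
  have hε' : 0 < ε' := lt_min hε (by positivity)
  refine ⟨min (1 / 4) ((ε' / 2) ^ 2), lt_min (by norm_num) (by positivity), ?_⟩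
  intro t ht0 htτ x U hx hU hx0 i hi
  have ht4 : t < 1 / 4 := htτ.trans_le (min_le_left _ _)
  have hsqrt : 2 * Real.sqrt t ≤ ε' := by
    have h1 : Real.sqrt t ≤ ε' / 2 := by
      rw [Real.sqrt_le_left (by positivity)]
      exact (htτ.trans_le (min_le_right _ _)).le
    linarith
  set A : ℕ → ℂ := fun j => Complex.exp (U j) with hAdef
  have hA : ∀ j, A j ≠ 0 := fun j => Complex.exp_ne_zero _
  have hcmp : ∀ j < n, ‖A j‖ ≤ 2 * ‖pathRoot n t j‖ ∧ ‖pathRoot n t j‖ ≤ 2 * ‖A j‖ := fun j hj =>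
    ⟨norm_exp_le_two_mul (hU j hj), norm_exp_le_two_mul (by rw [norm_sub_rev]; exact hU j hj)⟩
  have hr : ∀ k, (pathRadius n k t : ℂ) ≠ 0 := fun k => by
    exact_mod_cast (pathRadius_pos n k t).ne'
  have ha : ∀ k, ∀ j < n, ‖annParam k (pathRadius n k t) A j‖ ≤ ε' := fun k j hj =>
    (norm_annParam_le ht0 (by linarith) hcmp hj).trans hsqrt
  have hco : ∀ k ≤ n, ∀ l ≤ n, ‖(annProd n k (annParam k (pathRadius n k t) A)).coeff l
      - (if l = k then 1 else 0)‖ < 1 / (4 * ((n : ℝ) + 1)) := fun k hk l hl =>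
    hcoef _ (fun j hj => (ha k j hj).trans (min_le_left _ _)) k hk l hl
  have hprod : ∏ j ∈ Finset.range n, A j = 1 := by
    rw [← coeff_zero_rootProd, ← hx, coeff_WX hn x (by omega), entry_of_not (by omega)]
  have hS : ∀ k ≤ n, flatYSeries n k (xToY n x).2 = -Complex.log (leadRatio n A k) := by
    intro k hk
    by_cases hk' : 1 ≤ k ∧ k < n
    · exact flatYSeries_xToY hn hk' hA hx hx0 (hr k)
        (fun j hj => (ha k j hj).trans (min_le_right _ _)) fun l hl => (hco k hk l hl).le
    · rw [flatYSeries_end hk']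
      rcases (show k = 0 ∨ k = n by omega) with rfl | rfl
      · rw [leadRatio_zero hprod, Complex.log_one, neg_zero]
      · rw [leadRatio_self, Complex.log_one, neg_zero]
  have hc : ∀ k ≤ n, ‖leadRatio n A k - 1‖ ≤ 1 / 12 := by
    intro k hk
    have h1 := hco k hk k hk
    rw [if_pos rfl, ← leadRatio_eq hk (hr k) hA] at h1
    refine h1.le.trans (one_div_le_one_div_of_le (by norm_num) (by linarith))
  have hc0 : ∀ k ≤ n, leadRatio n A k ≠ 0 := by
    intro k hk h0
    have := hc k hk
    rw [h0] at this
    norm_num at this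
  have hlog : ∀ k ≤ n, ‖Complex.log (leadRatio n A k)‖ ≤ 1 / 8 := by
    intro k hk
    have h1 := Complex.norm_log_one_add_half_le_self (z := leadRatio n A k - 1)
      ((hc k hk).trans (by norm_num))
    rw [add_sub_cancel] at h1
    linarith [hc k hk]
  have hy : entry n 1 (xToY n x).2 (i + 1) = A i / A (i + 1)
      * (leadRatio n A i * leadRatio n A (i + 2) / leadRatio n A (i + 1) ^ 2) := by
    rw [entry, dif_pos (by omega)]
    exact xToY_eq_of_WX_eq hn hA hx ⟨i, by omega⟩
  set V := U i - U (i + 1) + (Complex.log (leadRatio n A i) + Complex.log (leadRatio n A (i + 2))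
    - 2 * Complex.log (leadRatio n A (i + 1))) with hV
  have hexp : Complex.exp V = entry n 1 (xToY n x).2 (i + 1) := by
    rw [hy, hV, Complex.exp_add, Complex.exp_sub, Complex.exp_sub, Complex.exp_add,
      Complex.exp_log (hc0 i (by omega)), Complex.exp_log (hc0 (i + 2) (by omega)), two_mul,
      Complex.exp_add, Complex.exp_log (hc0 (i + 1) (by omega)), sq]
  -- `V` is the principal logarithm of `y_{i+1}`, as its imaginary part is less than `π`
  have him : |V.im| ≤ 5 / 2 := by
    have h1 : V.im = -(2 * Real.pi * t / n) + (U i - pathLog n t i).im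
        - (U (i + 1) - pathLog n t (i + 1)).im + (Complex.log (leadRatio n A i)).im
        + (Complex.log (leadRatio n A (i + 2))).im
        - 2 * (Complex.log (leadRatio n A (i + 1))).im := by
      have h2 : pathLog n t i - pathLog n t (i + 1) = -pathArg n t := by
        simp only [pathLog]
        push_cast
        ring
      have h3 := congrArg Complex.im h2
      rw [Complex.neg_im, pathArg_im, Complex.sub_im] at h3
      rw [hV]
      simp only [Complex.add_im, Complex.sub_im, Complex.mul_im, Complex.re_ofNat, Complex.im_ofNat]
      linarith
    have h4 : 0 ≤ 2 * Real.pi * t / n := by positivity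
    have h5 : 2 * Real.pi * t / n ≤ 1 := by
      rw [div_le_one (by positivity)]
      nlinarith [Real.pi_lt_four, Real.pi_pos]
    have b : ∀ z : ℂ, ∀ c : ℝ, ‖z‖ ≤ c → -c ≤ z.im ∧ z.im ≤ c := fun z c hz =>
      abs_le.1 ((Complex.abs_im_le_norm z).trans hz)
    have b1 := b _ _ (hU i (by omega))
    have b2 := b _ _ (hU (i + 1) hi)
    have b3 := b _ _ (hlog i (by omega))
    have b4 := b _ _ (hlog (i + 2) (by omega))
    have b5 := b _ _ (hlog (i + 1) (by omega))
    rw [h1, abs_le]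
    constructor <;> linarith
  have him' := abs_le.1 him
  have hpi := Real.pi_gt_three
  rw [flatY, if_neg (by omega), Nat.add_sub_cancel, ← hexp,
    Complex.log_exp (by linarith) (by linarith), hS i (by omega), hS (i + 1) (by omega),
    hS (i + 1 + 1) (by omega), hV]
  ring

/-! ### Contour integrals about an `n`-th root of `-1` -/

/-- The closed disc of radius `R` about the `n`-th root `κ` of `-1` contains neither `0` nor any
other `n`-th root of `-1`. -/
structure IsolatingDisc (n : ℕ) (κ : ℂ) (R : ℝ) : Prop where
  pow_eq : κ ^ n = -1
  pos : 0 < R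
  ne_zero : ∀ z ∈ Metric.closedBall κ R, z ≠ 0
  root : ∀ z ∈ Metric.closedBall κ R, z ^ n + 1 = 0 → z = κ

namespace IsolatingDisc

variable {n : ℕ} {κ : ℂ} {R : ℝ}

theorem sphere_ne (h : IsolatingDisc n κ R) {z : ℂ} (hz : z ∈ Metric.sphere κ R) :
    z ≠ 0 ∧ z ^ n + 1 ≠ 0 ∧ z - κ ≠ 0 := by
  have hz' := Metric.sphere_subset_closedBall hz
  have h3 : z - κ ≠ 0 := fun h0 => by
    rw [mem_sphere_iff_norm, h0, norm_zero] at hz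
    exact h.pos.ne hz
  exact ⟨h.ne_zero z hz', fun h0 => h3 (sub_eq_zero.2 (h.root z hz' h0)), h3⟩

theorem continuousOn_inv (h : IsolatingDisc n κ R) :
    ContinuousOn (fun z : ℂ => z⁻¹) (Metric.sphere κ R) :=
  continuousOn_id.inv₀ fun _ hz => (h.sphere_ne hz).1

theorem continuousOn_inv_mul_pow_div (h : IsolatingDisc n κ R) (N m : ℕ) :
    ContinuousOn (fun z : ℂ => z⁻¹ * (z ^ N / (z ^ n + 1) ^ m)) (Metric.sphere κ R) := by
  refine h.continuousOn_inv.mul (ContinuousOn.div (by fun_prop) (by fun_prop) fun z hz => ?_)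
  exact pow_ne_zero _ (h.sphere_ne hz).2.1

/-- The residue at the simple pole `κ`. -/
theorem circleIntegral_pow_div (h : IsolatingDisc n κ R) (N : ℕ) :
    (∮ z in C(κ, R), z⁻¹ * (z ^ N / (z ^ n + 1) ^ 1))
      = 2 * Real.pi * Complex.I * (-(κ ^ N / n)) := by
  have hn : n ≠ 0 := by
    rintro rfl
    have := h.pow_eq
    norm_num at this
  have hn' : (n : ℂ) ≠ 0 := by exact_mod_cast hn
  have hκ : κ ≠ 0 := h.ne_zero κ (Metric.mem_closedBall_self h.pos.le)
  obtain ⟨Q, hQ⟩ := Polynomial.dvd_iff_isRoot.2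
    (show (Polynomial.X ^ n + 1 : Polynomial ℂ).IsRoot κ by simp [h.pow_eq])
  have hev : ∀ z, z ^ n + 1 = (z - κ) * Q.eval z := fun z => by
    have := congrArg (Polynomial.eval z) hQ
    simpa using this
  have hQκ : Q.eval κ = n * κ ^ (n - 1) := by
    have := congrArg (fun p => Polynomial.eval κ (Polynomial.derivative p)) hQ
    simpa [Polynomial.derivative_X_pow] using this.symm
  have hQ0 : ∀ z ∈ Metric.closedBall κ R, Q.eval z ≠ 0 := by
    intro z hz h0
    have h1 := h.root z hz (by rw [hev, h0, mul_zero])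
    rw [h1, hQκ] at h0
    exact mul_ne_zero hn' (pow_ne_zero _ hκ) h0
  have hd : DifferentiableOn ℂ (fun z : ℂ => z⁻¹ * (z ^ N / Q.eval z)) (Metric.closedBall κ R) := by
    refine DifferentiableOn.mul (differentiableOn_id.inv h.ne_zero)
      (DifferentiableOn.div (by fun_prop) Q.differentiable.differentiableOn hQ0)
  have h1 := (hd.diffContOnCl_ball
    (U := Metric.closedBall κ R) subset_rfl).circleIntegral_sub_inv_smul (Metric.mem_ball_self h.pos)
  have h2 : (∮ z in C(κ, R), z⁻¹ * (z ^ N / (z ^ n + 1) ^ 1))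
      = ∮ z in C(κ, R), (z - κ)⁻¹ • (z⁻¹ * (z ^ N / Q.eval z)) := by
    refine circleIntegral.integral_congr h.pos.le fun z hz => ?_
    have hz' := hQ0 z (Metric.sphere_subset_closedBall hz)
    have h3 := (h.sphere_ne hz).2.2
    have h4 := (h.sphere_ne hz).1
    simp only [pow_one, hev, smul_eq_mul]
    field_simp
  have h3 : κ ^ n = κ * κ ^ (n - 1) := by
    rw [← pow_succ', Nat.sub_add_cancel (by omega)]
  rw [h2, h1, hQκ, smul_eq_mul]
  have h4 := h.pow_eq
  rw [h3] at h4
  have h5 : κ⁻¹ * (κ ^ N / (n * κ ^ (n - 1))) = κ ^ N / (n * (κ * κ ^ (n - 1))) := by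
    field_simp
  rw [h5, h4]
  field_simp

/-- The derivative of `z^N / (z^n + 1)^m` integrates to `0`. -/
theorem circleIntegral_pow_div_succ (h : IsolatingDisc n κ R) (N m : ℕ) (hm : m ≠ 0) :
    (∮ z in C(κ, R), z⁻¹ * (z ^ N / (z ^ n + 1) ^ (m + 1)))
      = (1 - (N : ℂ) / n / m) * ∮ z in C(κ, R), z⁻¹ * (z ^ N / (z ^ n + 1) ^ m) := by
  have hn : n ≠ 0 := by
    rintro rfl
    have := h.pow_eq
    norm_num at this
  have hn' : (n : ℂ) ≠ 0 := by exact_mod_cast hn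
  have hm' : (m : ℂ) ≠ 0 := by exact_mod_cast hm
  have h1 : (∮ z in C(κ, R), (((N : ℂ) - m * n) * (z⁻¹ * (z ^ N / (z ^ n + 1) ^ m))
      + (m * n : ℂ) * (z⁻¹ * (z ^ N / (z ^ n + 1) ^ (m + 1))))) = 0 := by
    refine circleIntegral.integral_eq_zero_of_hasDerivWithinAt h.pos.le
      (f := fun z => z ^ N / (z ^ n + 1) ^ m) fun z hz => HasDerivAt.hasDerivWithinAt ?_
    obtain ⟨hz0, hz1, _⟩ := h.sphere_ne hz
    have hd : HasDerivAt (fun z : ℂ => z ^ N / (z ^ n + 1) ^ m)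
        ((N * z ^ (N - 1) * (z ^ n + 1) ^ m - z ^ N * (m * (z ^ n + 1) ^ (m - 1)
          * (n * z ^ (n - 1)))) / ((z ^ n + 1) ^ m) ^ 2) z :=
      (hasDerivAt_pow N z).div ((((hasDerivAt_pow n z).add_const 1)).pow m) (pow_ne_zero m hz1)
    refine hd.congr_deriv ?_
    obtain ⟨m, rfl⟩ := Nat.exists_eq_succ_of_ne_zero hm
    obtain ⟨n, rfl⟩ := Nat.exists_eq_succ_of_ne_zero hn
    simp only [Nat.succ_eq_add_one, Nat.add_sub_cancel] at hz1 ⊢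
    have hN : (N : ℂ) * z ^ (N - 1) = N * (z⁻¹ * z ^ N) := by
      rcases N with _ | N
      · simp
      · rw [Nat.add_sub_cancel, pow_succ]
        field_simp
    rw [hN]
    field_simp
    push_cast
    ring
  rw [circleIntegral.integral_add, circleIntegral.integral_const_mul,
    circleIntegral.integral_const_mul] at h1
  · generalize (∮ z in C(κ, R), z⁻¹ * (z ^ N / (z ^ n + 1) ^ m)) = I₁ at h1 ⊢
    generalize (∮ z in C(κ, R), z⁻¹ * (z ^ N / (z ^ n + 1) ^ (m + 1))) = I₂ at h1 ⊢
    field_simp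
    linear_combination h1
  · exact (continuousOn_const.mul (h.continuousOn_inv_mul_pow_div N m)).circleIntegrable h.pos.le
  · exact (continuousOn_const.mul
      (h.continuousOn_inv_mul_pow_div N (m + 1))).circleIntegrable h.pos.le

theorem circleIntegral_pow_div_eq (h : IsolatingDisc n κ R) (N m : ℕ) :
    (m.factorial : ℂ) * (∮ z in C(κ, R), z⁻¹ * (z ^ N / (z ^ n + 1) ^ (m + 1)))
      = 2 * Real.pi * Complex.I * (-(κ ^ N / n))
        * ((-1) ^ m * ∏ j ∈ Finset.range m, ((N : ℂ) / n - (j + 1 : ℕ))) := by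
  induction m with
  | zero => simpa using h.circleIntegral_pow_div N
  | succ m ih =>
    rw [h.circleIntegral_pow_div_succ N (m + 1) (by omega), Nat.factorial_succ,
      Finset.prod_range_succ]
    have hm : ((m + 1 : ℕ) : ℂ) ≠ 0 := by exact_mod_cast Nat.succ_ne_zero m
    calc (((m + 1) * m.factorial : ℕ) : ℂ) * ((1 - (N : ℂ) / n / (m + 1 : ℕ))
          * ∮ z in C(κ, R), z⁻¹ * (z ^ N / (z ^ n + 1) ^ (m + 1)))
        = ((m + 1 : ℕ) - (N : ℂ) / n) * ((m.factorial : ℂ)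
          * ∮ z in C(κ, R), z⁻¹ * (z ^ N / (z ^ n + 1) ^ (m + 1))) := by
          rw [one_sub_div hm]
          push_cast at hm ⊢
          field_simp
      _ = _ := by
          rw [ih]
          ring

/-- By recursion on `m`, from `κ z⁻¹ (z - κ)⁻¹ = (z - κ)⁻¹ - z⁻¹`. -/
theorem circleIntegral_inv_mul_pow_sub_inv (h : IsolatingDisc n κ R) (m : ℕ) :
    (∮ z in C(κ, R), z⁻¹ * ((z - κ)⁻¹) ^ (m + 1))
      = 2 * Real.pi * Complex.I * ((-1) ^ m / κ ^ (m + 1)) := by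
  have hκ : κ ≠ 0 := h.ne_zero κ (Metric.mem_closedBall_self h.pos.le)
  have hcinv : ContinuousOn (fun z : ℂ => (z - κ)⁻¹) (Metric.sphere κ R) :=
    (continuousOn_id.sub continuousOn_const).inv₀ fun z hz => (h.sphere_ne hz).2.2
  have step : ∀ m : ℕ, κ * (∮ z in C(κ, R), z⁻¹ * ((z - κ)⁻¹) ^ (m + 1))
      = (∮ z in C(κ, R), ((z - κ)⁻¹) ^ (m + 1)) - ∮ z in C(κ, R), z⁻¹ * ((z - κ)⁻¹) ^ m := by
    intro m
    rw [← circleIntegral.integral_const_mul, ← circleIntegral.integral_sub]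
    · refine circleIntegral.integral_congr h.pos.le fun z hz => ?_
      obtain ⟨hz0, _, hz2⟩ := h.sphere_ne hz
      simp only [pow_succ]
      field_simp
      ring
    · exact (hcinv.pow _).circleIntegrable h.pos.le
    · exact (h.continuousOn_inv.mul (hcinv.pow _)).circleIntegrable h.pos.le
  induction m with
  | zero =>
    have h0 : (∮ z in C(κ, R), z⁻¹ * ((z - κ)⁻¹) ^ 0) = 0 := by
      have hd : DifferentiableOn ℂ (fun z : ℂ => z⁻¹) (Metric.closedBall κ R) :=
        differentiableOn_id.inv h.ne_zero
      simpa using (hd.diffContOnCl_ball subset_rfl).circleIntegral_eq_zero h.pos.le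
    have h1 := step 0
    rw [h0, sub_zero] at h1
    simp only [zero_add, pow_one] at h1 ⊢
    rw [circleIntegral.integral_sub_center_inv κ h.pos.ne'] at h1
    rw [eq_comm, pow_zero, mul_one_div, div_eq_iff hκ, ← h1, mul_comm]
  | succ m ih =>
    have h1 := step (m + 1)
    have h2 : (∮ z in C(κ, R), ((z - κ)⁻¹) ^ (m + 1 + 1)) = 0 := by
      have := circleIntegral.integral_sub_zpow_of_ne (n := -((m + 2 : ℕ) : ℤ)) (by omega) κ κ R
      rw [← this]
      congr 1
      funext z
      rw [zpow_neg, zpow_natCast, inv_pow]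
    rw [h2, zero_sub, ih] at h1
    apply mul_left_cancel₀ hκ
    rw [h1]
    field_simp
    ring

/-- The integrand has a branch cut from `κ` to the nearby root `κ + δ`, inside the circle; the
integral is computed from the expansion in powers of `δ`. -/
theorem circleIntegral_inv_mul_log_one_sub (h : IsolatingDisc n κ R) {δ : ℂ} (hδ : ‖δ‖ < R)
    (hδκ : ‖δ / κ‖ < 1) :
    (∮ z in C(κ, R), z⁻¹ * Complex.log (1 + -δ / (z - κ)))
      = 2 * Real.pi * Complex.I * (-Complex.log (1 + δ / κ)) := by
  have hκ : κ ≠ 0 := h.ne_zero κ (Metric.mem_closedBall_self h.pos.le)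
  have hcinv : ContinuousOn (fun z : ℂ => (z - κ)⁻¹) (Metric.sphere κ R) :=
    (continuousOn_id.sub continuousOn_const).inv₀ fun z hz => (h.sphere_ne hz).2.2
  have hlt : ‖δ‖ / R < 1 := (div_lt_one h.pos).2 hδ
  have hnorm : ∀ z ∈ Metric.sphere κ R, ‖-δ / (z - κ)‖ = ‖δ‖ / R := by
    intro z hz
    rw [norm_div, norm_neg, mem_sphere_iff_norm.1 hz]
  obtain ⟨B, hB⟩ := (isCompact_sphere κ R).exists_bound_of_continuousOn h.continuousOn_inv
  have hsum := hasSum_circleIntegral (c := κ) (R := R)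
    (f := fun (m : ℕ) z => z⁻¹ * ((-1) ^ (m + 1) * (-δ / (z - κ)) ^ m / m))
    (g := fun z => z⁻¹ * Complex.log (1 + -δ / (z - κ))) (b := fun m => B * (‖δ‖ / R) ^ m) h.pos.le
    ((summable_geometric_of_lt_one (by have := h.pos; positivity) hlt).mul_left B)
    (fun m => ?_) (fun m z hz => ?_) (fun z hz => ?_)
  · have h1 : ∀ m : ℕ, (∮ z in C(κ, R), z⁻¹ * ((-1) ^ (m + 1) * (-δ / (z - κ)) ^ m / m))
        = 2 * Real.pi * Complex.I * ((-(δ / κ)) ^ m / m) := by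
      intro m
      rcases m with _ | m
      · simp [circleIntegral]
      · have h2 : ∀ z : ℂ, z⁻¹ * ((-1) ^ (m + 1 + 1) * (-δ / (z - κ)) ^ (m + 1) / (m + 1 : ℕ))
            = ((-1) ^ (m + 1 + 1) * (-δ) ^ (m + 1) / (m + 1 : ℕ))
              * (z⁻¹ * ((z - κ)⁻¹) ^ (m + 1)) := by
          intro z
          rw [div_eq_mul_inv (-δ), mul_pow]
          ring
        simp only [h2]
        rw [circleIntegral.integral_const_mul, h.circleIntegral_inv_mul_pow_sub_inv]
        have h3 : ((-1 : ℂ) ^ (m + 1 + 1)) * (-1) ^ m = 1 := by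
          rw [pow_succ, pow_succ, mul_assoc (_ ^ m), ← mul_rotate, ← mul_pow]
          simp
        calc (-1) ^ (m + 1 + 1) * (-δ) ^ (m + 1) / ((m + 1 : ℕ) : ℂ)
              * (2 * Real.pi * Complex.I * ((-1) ^ m / κ ^ (m + 1)))
            = 2 * Real.pi * Complex.I * ((-δ / κ) ^ (m + 1) / ((m + 1 : ℕ) : ℂ))
              * ((-1) ^ (m + 1 + 1) * (-1) ^ m) := by
              rw [div_pow]
              ring
          _ = _ := by rw [h3, mul_one, neg_div]
    simp only [h1] at hsum
    have h4 : HasSum (fun m : ℕ => (-(δ / κ)) ^ m / m) (-Complex.log (1 - -(δ / κ))) :=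
      Complex.hasSum_taylorSeries_neg_log (by rwa [norm_neg])
    rw [sub_neg_eq_add] at h4
    exact hsum.unique (h4.mul_left _)
  · have h2 := h.continuousOn_inv
    simp only [div_eq_mul_inv (-δ)]
    fun_prop
  · rw [norm_mul]
    refine mul_le_mul (hB z hz) ?_ (norm_nonneg _) ((norm_nonneg _).trans (hB z hz))
    rw [norm_div, norm_mul, norm_pow, norm_pow, hnorm z hz]
    simp only [norm_neg, norm_one, one_pow, one_mul, Complex.norm_natCast]
    rcases Nat.eq_zero_or_pos m with rfl | hm
    · simp
    · have := h.pos
      exact div_le_self (by positivity) (by exact_mod_cast hm)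
  · refine (Complex.hasSum_taylorSeries_log ?_).mul_left _
    rwa [hnorm z hz]

end IsolatingDisc

/-! ### The expansion at `x = 0` of the logarithm of a root -/

/-- `∑ i k_i`. -/
def weight (n : ℕ) (k : Fin (n - 1) → ℕ) : ℕ := ∑ j : Fin (n - 1), ((j : ℕ) + 1) * k j

/-- The factor of the term with exponent `k` of a flat coordinate for `[ℂ²/ℤ_n]` coming from the
values of `Γ`, up to sign. -/
def flatXFactor (n : ℕ) (k : Fin (n - 1) → ℕ) : ℂ :=
  ∏ l ∈ Finset.range (∑ j, k j - 1), ((weight n k : ℂ) / n - (l + 1 : ℕ))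

/-- The term with exponent `k` of the expansion at `x = 0` of `log (κ(x) / κ)`, where `κ(x)` is the
root of `W` with `κ(0) = κ`. -/
def logRootTerm (n : ℕ) (κ : ℂ) (x : Chart n) (k : Fin (n - 1) → ℕ) : ℂ :=
  if ∑ j, k j = 0 then 0
  else 1 / n * κ ^ weight n k * (∏ j, x.2 j ^ k j / ((k j).factorial : ℂ)) * flatXFactor n k

theorem eval_WX_eq (n : ℕ) (x : Chart n) (z : ℂ) :
    (WX n x).eval z = z ^ n + 1 + ∑ j : Fin (n - 1), x.2 j * z ^ ((j : ℕ) + 1) := by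
  rw [eval_WX, sum_Icc_one, ← Fin.sum_univ_eq_sum_range
    (fun k => entry n 0 x.2 (k + 1) * z ^ (k + 1))]
  simp only [entry_succ]
  ring

theorem WX_zero_eq_rootProd {n : ℕ} (hn : 2 ≤ n) : WX n 0 = rootProd n (pathRoot n 1) := by
  rw [← path_one hn, WX_path hn]

theorem norm_pathRoot_one (n j : ℕ) : ‖pathRoot n 1 j‖ = 1 := by
  rw [norm_pathRoot]; simp

/-- A radius isolating the root with index `i` at `x = 0` from `0` and the other roots. -/
theorem exists_isolating_radius {n : ℕ} (hn : 2 ≤ n) {i : ℕ} (hi : i < n) :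
    ∃ R : ℝ, 0 < R ∧ R ≤ 1 / 2 ∧
      ∀ j < n, j ≠ i → 2 * R ≤ ‖pathRoot n 1 j - pathRoot n 1 i‖ := by
  have h1 : ∀ j ∈ Finset.range n, ∀ᶠ R in 𝓝[>] (0 : ℝ),
      j ≠ i → 2 * R ≤ ‖pathRoot n 1 j - pathRoot n 1 i‖ := by
    intro j hj
    by_cases hji : j = i
    · exact Eventually.of_forall fun R h => absurd hji h
    · have hpos : 0 < ‖pathRoot n 1 j - pathRoot n 1 i‖ := by
        rw [norm_pos_iff, sub_ne_zero]
        exact fun h => hji (injOn_pathRoot hn ⟨zero_lt_one, le_rfl⟩ (by simpa using hj)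
          (by simpa using hi) h)
      have h2 : ∀ᶠ R in 𝓝[>] (0 : ℝ), R < ‖pathRoot n 1 j - pathRoot n 1 i‖ / 2 :=
        eventually_nhdsWithin_of_eventually_nhds (eventually_lt_nhds (by positivity))
      filter_upwards [h2] with R hR _
      linarith
  have h3 : ∀ᶠ R in 𝓝[>] (0 : ℝ), R < 1 / 2 :=
    eventually_nhdsWithin_of_eventually_nhds (eventually_lt_nhds (by norm_num))
  obtain ⟨R, hR1, hR2, hR3⟩ := (((Filter.eventually_all_finset _).2 h1).and
    (h3.and self_mem_nhdsWithin)).exists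
  exact ⟨R, hR3, hR2.le, fun j hj => hR1 j (Finset.mem_range.2 hj)⟩

section LogRoot

variable {n : ℕ} {i : ℕ} {R : ℝ}

theorem isolatingDisc_pathRoot (hn : 2 ≤ n) (hR : 0 < R) (hR2 : R ≤ 1 / 2)
    (hsep : ∀ j < n, j ≠ i → 2 * R ≤ ‖pathRoot n 1 j - pathRoot n 1 i‖) :
    IsolatingDisc n (-pathRoot n 1 i) R where
  pow_eq := neg_pathRoot_one_pow hn i
  pos := hR
  ne_zero := by
    rintro z hz rfl
    rw [mem_closedBall_iff_norm, zero_sub, neg_neg, norm_pathRoot_one] at hz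
    linarith
  root := by
    intro z hz h0
    have h1 : (rootProd n (pathRoot n 1)).eval z = 0 := by
      rw [← WX_zero_eq_rootProd hn, WX_zero]
      simpa using h0
    rw [eval_rootProd, Finset.prod_eq_zero_iff] at h1
    obtain ⟨j, hj, hzj⟩ := h1
    by_cases hji : j = i
    · rw [← hji]
      linear_combination hzj
    · have h2 := hsep j (Finset.mem_range.1 hj) hji
      have h3 : z - -pathRoot n 1 i = -(pathRoot n 1 j - pathRoot n 1 i) := by
        linear_combination hzj
      rw [mem_closedBall_iff_norm, h3, norm_neg] at hz
      linarith

theorem le_norm_add_pathRoot_of_ne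
    (hsep : ∀ j < n, j ≠ i → 2 * R ≤ ‖pathRoot n 1 j - pathRoot n 1 i‖) {j : ℕ} (hj : j < n)
    (hji : j ≠ i) {z : ℂ} (hz : z ∈ Metric.closedBall (-pathRoot n 1 i) R) :
    R ≤ ‖z + pathRoot n 1 j‖ := by
  have h1 := hsep j hj hji
  rw [mem_closedBall_iff_norm] at hz
  have h2 : ‖pathRoot n 1 j - pathRoot n 1 i‖ ≤ ‖z + pathRoot n 1 j‖ + ‖z - -pathRoot n 1 i‖ := by
    calc ‖pathRoot n 1 j - pathRoot n 1 i‖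
        = ‖(z + pathRoot n 1 j) - (z - -pathRoot n 1 i)‖ := by ring_nf
      _ ≤ _ := norm_sub_le _ _
  linarith

theorem le_norm_add_pathRoot
    (hsep : ∀ j < n, j ≠ i → 2 * R ≤ ‖pathRoot n 1 j - pathRoot n 1 i‖) {j : ℕ} (hj : j < n)
    {z : ℂ} (hz : z ∈ Metric.sphere (-pathRoot n 1 i) R) : R ≤ ‖z + pathRoot n 1 j‖ := by
  by_cases hji : j = i
  · rw [mem_sphere_iff_norm, sub_neg_eq_add] at hz
    rw [hji, hz]
  · exact le_norm_add_pathRoot_of_ne hsep hj hji (Metric.sphere_subset_closedBall hz)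

theorem pow_add_one_eq_prod (hn : 2 ≤ n) (z : ℂ) :
    z ^ n + 1 = ∏ j ∈ Finset.range n, (z + pathRoot n 1 j) := by
  rw [← eval_rootProd, ← WX_zero_eq_rootProd hn, WX_zero]
  simp

theorem card_mul_norm_le (hn : 2 ≤ n) (hR : 0 < R) (hR2 : R ≤ 1 / 2)
    (hsep : ∀ j < n, j ≠ i → 2 * R ≤ ‖pathRoot n 1 j - pathRoot n 1 i‖) {x : Chart n}
    (hx : ∀ j, n * ‖x.2 j‖ * (2 / R) ^ n ≤ 1 / 2) {z : ℂ}
    (hz : z ∈ Metric.sphere (-pathRoot n 1 i) R) (j : Fin (n - 1)) :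
    Fintype.card (Fin (n - 1)) * ‖x.2 j * z ^ ((j : ℕ) + 1) / (z ^ n + 1)‖ ≤ 1 / 2 := by
  refine le_trans ?_ (hx j)
  have h1 : R ^ n ≤ ‖z ^ n + 1‖ := by
    rw [pow_add_one_eq_prod hn, norm_prod]
    calc R ^ n = ∏ _j ∈ Finset.range n, R := by simp
      _ ≤ _ := Finset.prod_le_prod (fun _ _ => hR.le)
        fun j hj => le_norm_add_pathRoot hsep (Finset.mem_range.1 hj) hz
  have h2 : ‖z‖ ≤ 2 := by
    rw [mem_sphere_iff_norm, sub_neg_eq_add] at hz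
    have h3 : ‖z‖ ≤ ‖z + pathRoot n 1 i‖ + ‖pathRoot n 1 i‖ := by
      calc ‖z‖ = ‖(z + pathRoot n 1 i) - pathRoot n 1 i‖ := by ring_nf
        _ ≤ _ := norm_sub_le _ _
    rw [norm_pathRoot_one, hz] at h3
    linarith
  have h3 : ‖z‖ ^ ((j : ℕ) + 1) ≤ 2 ^ n :=
    (pow_le_pow_left₀ (norm_nonneg _) h2 _).trans
      (pow_le_pow_right₀ (by norm_num) (by omega))
  have h4 : ((Fintype.card (Fin (n - 1)) : ℕ) : ℝ) ≤ n := by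
    rw [Fintype.card_fin]
    exact_mod_cast Nat.sub_le n 1
  rw [norm_div, norm_mul, norm_pow, div_pow, mul_assoc, mul_div_assoc]
  gcongr

/-- On the circle, `W / (κ^n + 1)` is the product of the ratios of the linear factors. -/
theorem log_one_add_eq_sum_log (hn : 2 ≤ n) (hR : 0 < R)
    (hsep : ∀ j < n, j ≠ i → 2 * R ≤ ‖pathRoot n 1 j - pathRoot n 1 i‖) {x : Chart n}
    {A : ℕ → ℂ} (hxA : WX n x = rootProd n A)
    (hA : ∀ j < n, ‖A j - pathRoot n 1 j‖ ≤ R / (2 * n)) {z : ℂ}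
    (hz : z ∈ Metric.sphere (-pathRoot n 1 i) R) :
    Complex.log (1 + ∑ j : Fin (n - 1), x.2 j * z ^ ((j : ℕ) + 1) / (z ^ n + 1))
      = ∑ j ∈ Finset.range n, Complex.log (1 + (A j - pathRoot n 1 j) / (z + pathRoot n 1 j)) := by
  have hn0 : (2 : ℝ) ≤ n := by exact_mod_cast hn
  have hne : ∀ j ∈ Finset.range n, z + pathRoot n 1 j ≠ 0 := fun j hj h0 => by
    have := le_norm_add_pathRoot hsep (Finset.mem_range.1 hj) hz
    rw [h0, norm_zero] at this
    linarith
  have hW0 : z ^ n + 1 ≠ 0 := by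
    rw [pow_add_one_eq_prod hn]
    exact Finset.prod_ne_zero_iff.2 hne
  have hb : ∀ j ∈ Finset.range n,
      ‖(A j - pathRoot n 1 j) / (z + pathRoot n 1 j)‖ ≤ 1 / (2 * n) := by
    intro j hj
    have h1 := le_norm_add_pathRoot hsep (Finset.mem_range.1 hj) hz
    have h2 := hA j (Finset.mem_range.1 hj)
    rw [norm_div, div_le_iff₀ (by linarith)]
    refine h2.trans ?_
    rw [div_eq_mul_one_div, mul_comm]
    gcongr
  rw [← log_prod_one_add]
  · congr 1
    have h1 := eval_WX_eq n x z
    rw [hxA, eval_rootProd] at h1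
    have h2 : ∏ j ∈ Finset.range n, (1 + (A j - pathRoot n 1 j) / (z + pathRoot n 1 j))
        = (∏ j ∈ Finset.range n, (z + A j)) / (z ^ n + 1) := by
      rw [pow_add_one_eq_prod hn, ← Finset.prod_div_distrib]
      refine Finset.prod_congr rfl fun j hj => ?_
      have := hne j hj
      field_simp
      ring
    rw [h2, h1, add_div, div_self hW0, Finset.sum_div]
  · intro j hj
    refine (hb j hj).trans (one_div_le_one_div_of_le (by norm_num) (by linarith))
  · refine (Finset.sum_le_sum hb).trans ?_
    rw [Finset.sum_const, Finset.card_range, nsmul_eq_mul]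
    have : (n : ℝ) * (1 / (2 * n)) = 1 / 2 := by field_simp
    linarith

/-- Only the factor of `W` whose root lies inside the circle contributes. -/
theorem circleIntegral_inv_mul_log_WX (hn : 2 ≤ n) (hi : i < n) (hR : 0 < R) (hR2 : R ≤ 1 / 2)
    (hsep : ∀ j < n, j ≠ i → 2 * R ≤ ‖pathRoot n 1 j - pathRoot n 1 i‖) {x : Chart n}
    {U : ℕ → ℂ} (hxA : WX n x = rootProd n (fun j => Complex.exp (U j)))
    (hA : ∀ j < n, ‖Complex.exp (U j) - pathRoot n 1 j‖ ≤ R / (2 * n))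
    (hU : ‖U i - pathLog n 1 i‖ ≤ 1) :
    (∮ z in C(-pathRoot n 1 i, R),
        z⁻¹ * Complex.log (1 + ∑ j : Fin (n - 1), x.2 j * z ^ ((j : ℕ) + 1) / (z ^ n + 1)))
      = 2 * Real.pi * Complex.I * (-(U i - pathLog n 1 i)) := by
  have hdisc := isolatingDisc_pathRoot hn hR hR2 hsep
  have hn0 : (2 : ℝ) ≤ n := by exact_mod_cast hn
  have hRn : R / (2 * n) < R := div_lt_self hR (by linarith)
  have hmem : ∀ j < n, ∀ z : ℂ, R ≤ ‖z + pathRoot n 1 j‖ →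
      1 + (Complex.exp (U j) - pathRoot n 1 j) / (z + pathRoot n 1 j) ∈ Complex.slitPlane := by
    intro j hj z hz
    refine Complex.mem_slitPlane_of_norm_lt_one ?_
    rw [norm_div, div_lt_one (by linarith)]
    exact (hA j hj).trans_lt (hRn.trans_le hz)
  have hcont : ∀ j ∈ Finset.range n, ContinuousOn (fun z : ℂ => z⁻¹ *
      Complex.log (1 + (Complex.exp (U j) - pathRoot n 1 j) / (z + pathRoot n 1 j)))
      (Metric.sphere (-pathRoot n 1 i) R) := by
    intro j hj
    have hle := fun z hz => le_norm_add_pathRoot hsep (Finset.mem_range.1 hj) (z := z) hz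
    refine hdisc.continuousOn_inv.mul (ContinuousOn.clog ?_ fun z hz =>
      hmem j (Finset.mem_range.1 hj) z (hle z hz))
    refine continuousOn_const.add (continuousOn_const.div (by fun_prop) fun z hz h0 => ?_)
    have := hle z hz
    rw [h0, norm_zero] at this
    linarith
  have h1 : (∮ z in C(-pathRoot n 1 i, R),
        z⁻¹ * Complex.log (1 + ∑ j : Fin (n - 1), x.2 j * z ^ ((j : ℕ) + 1) / (z ^ n + 1)))
      = ∮ z in C(-pathRoot n 1 i, R), ∑ j ∈ Finset.range n, z⁻¹ *
        Complex.log (1 + (Complex.exp (U j) - pathRoot n 1 j) / (z + pathRoot n 1 j)) := by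
    refine circleIntegral.integral_congr hR.le fun z hz => ?_
    rw [log_one_add_eq_sum_log hn hR hsep hxA hA hz, Finset.mul_sum]
  rw [h1, circleIntegral.integral_fun_sum fun j hj => (hcont j hj).circleIntegrable hR.le,
    Finset.sum_eq_single_of_mem i (Finset.mem_range.2 hi)]
  · set δ := -(Complex.exp (U i) - pathRoot n 1 i) with hδ
    have hδn : ‖δ‖ ≤ R / (2 * n) := by rw [hδ, norm_neg]; exact hA i hi
    have h2 := hdisc.circleIntegral_inv_mul_log_one_sub (δ := δ) (hδn.trans_lt hRn) (by
      rw [norm_div, norm_neg (pathRoot n 1 i), norm_pathRoot_one, div_one]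
      linarith)
    have h3 : 1 + δ / -pathRoot n 1 i = Complex.exp (U i - pathLog n 1 i) := by
      have hne := pathRoot_ne_zero n 1 i
      rw [Complex.exp_sub, ← pathRoot, hδ]
      field_simp
      ring
    have him := abs_le.1 ((Complex.abs_im_le_norm _).trans hU)
    have hpi := Real.pi_gt_three
    rw [h3, Complex.log_exp (by linarith) (by linarith)] at h2
    simp only [sub_neg_eq_add, hδ, neg_neg] at h2
    exact h2
  · intro j hj hji
    have hle := fun z hz => le_norm_add_pathRoot_of_ne hsep (Finset.mem_range.1 hj) hji (z := z) hz
    have hd : DifferentiableOn ℂ (fun z : ℂ => z⁻¹ *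
        Complex.log (1 + (Complex.exp (U j) - pathRoot n 1 j) / (z + pathRoot n 1 j)))
        (Metric.closedBall (-pathRoot n 1 i) R) := by
      refine (differentiableOn_id.inv hdisc.ne_zero).mul (DifferentiableOn.clog ?_ fun z hz =>
        hmem j (Finset.mem_range.1 hj) z (hle z hz))
      refine (differentiableOn_const _).add ((differentiableOn_const _).div (by fun_prop)
        fun z hz h0 => ?_)
      have := hle z hz
      rw [h0, norm_zero] at this
      linarith
    exact (hd.diffContOnCl_ball subset_rfl).circleIntegral_eq_zero hR.le

theorem circleIntegral_logCoeff_mul (hn : 2 ≤ n) (hR : 0 < R) (hR2 : R ≤ 1 / 2)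
    (hsep : ∀ j < n, j ≠ i → 2 * R ≤ ‖pathRoot n 1 j - pathRoot n 1 i‖) (x : Chart n)
    (k : Fin (n - 1) → ℕ) :
    (∮ z in C(-pathRoot n 1 i, R),
        z⁻¹ * (logCoeff k * ∏ j, (x.2 j * z ^ ((j : ℕ) + 1) / (z ^ n + 1)) ^ k j))
      = 2 * Real.pi * Complex.I * (-logRootTerm n (-pathRoot n 1 i) x k) := by
  have hdisc := isolatingDisc_pathRoot hn hR hR2 hsep
  by_cases hk : ∑ j, k j = 0
  · rw [logRootTerm, if_pos hk, logCoeff, if_pos hk]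
    simp [circleIntegral]
  obtain ⟨m, hm⟩ := Nat.exists_eq_add_one_of_ne_zero hk
  have h1 : ∀ z : ℂ, z⁻¹ * (logCoeff k * ∏ j, (x.2 j * z ^ ((j : ℕ) + 1) / (z ^ n + 1)) ^ k j)
      = (logCoeff k * ∏ j, x.2 j ^ k j) * (z⁻¹ * (z ^ weight n k / (z ^ n + 1) ^ (m + 1))) := by
    intro z
    simp only [div_pow, mul_pow, Finset.prod_div_distrib, Finset.prod_mul_distrib, ← pow_mul]
    rw [Finset.prod_pow_eq_pow_sum, Finset.prod_pow_eq_pow_sum, hm, weight]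
    ring
  simp only [h1]
  rw [circleIntegral.integral_const_mul, logRootTerm, if_neg hk, logCoeff, if_neg hk, flatXFactor,
    hm]
  simp only [Nat.add_sub_cancel]
  have h2 := hdisc.circleIntegral_pow_div_eq (weight n k) m
  have h3 : ((-1 : ℂ) ^ m) * (-1) ^ m = 1 := by rw [← mul_pow]; simp
  rw [Finset.prod_div_distrib]
  generalize (∮ z in C(-pathRoot n 1 i, R), z⁻¹ * (z ^ weight n k / (z ^ n + 1) ^ (m + 1))) = I₁
    at h2 ⊢
  calc (-1) ^ (m + 1 + 1) * (m.factorial : ℂ) / (∏ j, ((k j).factorial : ℂ))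
        * (∏ j, x.2 j ^ k j) * I₁
      = (-1) ^ m / (∏ j, ((k j).factorial : ℂ)) * (∏ j, x.2 j ^ k j) * ((m.factorial : ℂ) * I₁) := by
        rw [pow_succ, pow_succ]; ring
    _ = _ := by
        rw [h2]
        linear_combination (2 * Real.pi * Complex.I * (-((-pathRoot n 1 i) ^ weight n k / n))
          * (∏ j ∈ Finset.range m, ((weight n k : ℂ) / n - (j + 1 : ℕ)))
          / (∏ j, ((k j).factorial : ℂ)) * (∏ j, x.2 j ^ k j)) * h3

/-- The expansion at `x = 0` of the logarithm of a root of `W`, by expanding the logarithm in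
`circleIntegral_inv_mul_log_WX` and integrating term by term. -/
theorem hasSum_logRootTerm (hn : 2 ≤ n) (hi : i < n) (hR : 0 < R) (hR2 : R ≤ 1 / 2)
    (hsep : ∀ j < n, j ≠ i → 2 * R ≤ ‖pathRoot n 1 j - pathRoot n 1 i‖) {x : Chart n}
    (hx : ∀ j, n * ‖x.2 j‖ * (2 / R) ^ n ≤ 1 / 2) {U : ℕ → ℂ}
    (hxA : WX n x = rootProd n (fun j => Complex.exp (U j)))
    (hA : ∀ j < n, ‖Complex.exp (U j) - pathRoot n 1 j‖ ≤ R / (2 * n))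
    (hU : ‖U i - pathLog n 1 i‖ ≤ 1) :
    HasSum (logRootTerm n (-pathRoot n 1 i) x) (U i - pathLog n 1 i) := by
  have hdisc := isolatingDisc_pathRoot hn hR hR2 hsep
  have hz := fun z hz => card_mul_norm_le hn hR hR2 hsep hx (z := z) hz
  obtain ⟨B, hB⟩ := (isCompact_sphere (-pathRoot n 1 i) R).exists_bound_of_continuousOn
    hdisc.continuousOn_inv
  have h := hasSum_circleIntegral (c := -pathRoot n 1 i) (R := R)
    (f := fun (k : Fin (n - 1) → ℕ) z =>
      z⁻¹ * (logCoeff k * ∏ j, (x.2 j * z ^ ((j : ℕ) + 1) / (z ^ n + 1)) ^ k j))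
    (g := fun z => z⁻¹ * Complex.log
      (1 + ∑ j : Fin (n - 1), x.2 j * z ^ ((j : ℕ) + 1) / (z ^ n + 1)))
    (b := fun k => B * ∏ j, (1 / 2 : ℝ) ^ k j) hR.le
    ((summable_prod_pow _ (fun _ => by norm_num) fun _ => by norm_num).mul_left B)
    (fun k => ?_) (fun k z hzs => ?_) (fun z hzs => ?_)
  · rw [circleIntegral_inv_mul_log_WX hn hi hR hR2 hsep hxA hA hU] at h
    simp only [circleIntegral_logCoeff_mul hn hR hR2 hsep] at h
    have h2pi : (2 * Real.pi * Complex.I : ℂ) ≠ 0 := Complex.two_pi_I_ne_zero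
    simpa using ((hasSum_mul_left_iff h2pi).1 h).neg
  · refine hdisc.continuousOn_inv.mul (continuousOn_const.mul
      (continuousOn_finsetProd _ fun j _ => ContinuousOn.pow ?_ _))
    exact ContinuousOn.div (by fun_prop) (by fun_prop) fun z hzs => (hdisc.sphere_ne hzs).2.1
  · rw [norm_mul]
    exact mul_le_mul (hB z hzs) (norm_logCoeff_mul_prod_le _ (hz z hzs) k) (norm_nonneg _)
      ((norm_nonneg _).trans (hB z hzs))
  · exact (hasSum_log_one_add_sum (by norm_num) (by norm_num) _ (hz z hzs)).mul_left _

end LogRoot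

/-! ### The flat coordinates of `[ℂ²/ℤ_n]` in the expansion of a logarithm of a root -/

theorem Gamma_eq_prod_mul_Gamma_sub {z : ℝ} (hz : ∀ m : ℤ, z ≠ m) (p : ℕ) :
    Real.Gamma z = (∏ j ∈ Finset.range p, (z - (j + 1 : ℕ))) * Real.Gamma (z - p) := by
  induction p with
  | zero => simp
  | succ p ih =>
    have h1 : z - (p + 1 : ℕ) ≠ 0 := fun h => hz (p + 1 : ℕ) (by
      rw [Int.cast_natCast]; linarith)
    have h2 := Real.Gamma_add_one h1
    have h3 : z - (p + 1 : ℕ) + 1 = z - p := by push_cast; ring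
    rw [h3] at h2
    rw [ih, h2, Finset.prod_range_succ, mul_assoc]

/-- No pole of `Γ` is met as `z` is not an integer. -/
theorem Gamma_div_Gamma_sub {z : ℝ} (hz : ∀ m : ℤ, z ≠ m) (p : ℕ) :
    Real.Gamma z / Real.Gamma (z - p) = ∏ j ∈ Finset.range p, (z - (j + 1 : ℕ)) := by
  rw [Gamma_eq_prod_mul_Gamma_sub hz p, mul_div_assoc, div_self, mul_one]
  refine Real.Gamma_ne_zero fun m h => hz (p - m : ℤ) ?_
  push_cast
  linarith

/-- A product of two quotients of values of `Γ` as a falling product: the factors `b - l` with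
`l ≤ q` come from the second quotient, the others from the first. -/
theorem Gamma_quotients_eq {s : ℝ} (hs0 : 0 < s) (hs1 : s < 1) {q m : ℕ} (hqm : q < m) :
    Real.Gamma s / Real.Gamma (1 + (q + s - m)) * (Real.Gamma (1 - s) / Real.Gamma (1 + -(q + s)))
      = (-1) ^ q * ∏ l ∈ Finset.range (m - 1), (q + s - (l + 1 : ℕ)) := by
  obtain ⟨p, rfl⟩ : ∃ p, m = q + p + 1 := ⟨m - 1 - q, by omega⟩
  have hs : ∀ a : ℤ, s ≠ a := fun a h => by
    rw [h] at hs0 hs1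
    have h1 : 0 < a := by exact_mod_cast hs0
    have h2 : a < 1 := by exact_mod_cast hs1
    omega
  have hs' : ∀ a : ℤ, 1 - s ≠ a := fun a h => hs (1 - a) (by push_cast; linarith)
  have e1 : 1 + (q + s - (q + p + 1 : ℕ)) = s - p := by push_cast; ring
  have e2 : 1 + -(q + s) = 1 - s - q := by ring
  rw [e1, e2, Gamma_div_Gamma_sub hs, Gamma_div_Gamma_sub hs', Nat.add_sub_cancel,
    Finset.prod_range_add, ← Finset.prod_range_reflect (fun l : ℕ => (q : ℝ) + s - (l + 1 : ℕ))]
  have e3 : ∏ j ∈ Finset.range q, (1 - s - (j + 1 : ℕ))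
      = (-1) ^ q * ∏ j ∈ Finset.range q, (q + s - (q - 1 - j + 1 : ℕ)) := by
    rw [← Finset.card_range q, ← Finset.prod_const, Finset.card_range, ← Finset.prod_mul_distrib]
    refine Finset.prod_congr rfl fun j hj => ?_
    have h1 : q - 1 - j + 1 = q - j := by have := Finset.mem_range.1 hj; omega
    rw [h1, Nat.cast_sub (Finset.mem_range.1 hj).le]
    push_cast
    ring
  have e4 : ∀ j : ℕ, (q : ℝ) + s - (q + j + 1 : ℕ) = s - (j + 1 : ℕ) := fun j => by
    push_cast; ring
  simp only [e3, e4]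
  ring

theorem DXn_eq (n : ℕ) (k : Fin (n - 1) → ℕ) : DXn n k = -((weight n k : ℝ) / n) := by
  rw [DXn, sum_Icc_one, ← Fin.sum_univ_eq_sum_range
    (fun i => ((i + 1 : ℕ) : ℝ) * ((entry n 0 k (i + 1) : ℕ) : ℝ))]
  simp only [entry_succ, weight]
  push_cast
  ring

theorem DX0_eq {n : ℕ} (hn : 2 ≤ n) (k : Fin (n - 1) → ℕ) :
    DX0 n k = (weight n k : ℝ) / n - (∑ j, k j : ℕ) := by
  have hn0 : (n : ℝ) ≠ 0 := by positivity
  rw [DX0, sum_Icc_one, ← Fin.sum_univ_eq_sum_range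
    (fun i => ((n : ℝ) - ((i + 1 : ℕ) : ℝ)) * ((entry n 0 k (i + 1) : ℕ) : ℝ))]
  simp only [entry_succ, weight, sub_mul, Finset.sum_sub_distrib, ← Finset.mul_sum]
  push_cast
  field_simp
  ring

theorem weight_le (n : ℕ) (k : Fin (n - 1) → ℕ) : weight n k ≤ (n - 1) * ∑ j, k j := by
  rw [weight, Finset.mul_sum]
  exact Finset.sum_le_sum fun j _ => Nat.mul_le_mul_right _ (by omega)

/-- The number of factors of the falling product is at least `⌊b(k)⌋`. -/
theorem weight_div_lt {n : ℕ} (hn : 2 ≤ n) {k : Fin (n - 1) → ℕ} (hk : ∑ j, k j ≠ 0) :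
    weight n k / n < ∑ j, k j := by
  rw [Nat.div_lt_iff_lt_mul (by omega), mul_comm]
  exact (weight_le n k).trans_lt (Nat.mul_lt_mul_of_pos_right (by omega) (by omega))

theorem fract_neg_DXn_eq_iff {n : ℕ} (hn : 2 ≤ n) (k : Fin (n - 1) → ℕ) (r : ℕ) :
    Int.fract (-DXn n k) = (r : ℝ) / n ↔ weight n k % n = r := by
  have hn0 : (n : ℝ) ≠ 0 := by positivity
  rw [DXn_eq, neg_neg, Int.fract_div_natCast_eq_div_natCast_mod, div_left_inj' hn0, Nat.cast_inj]

theorem flatXTerm_eq {n : ℕ} (hn : 2 ≤ n) (x : Chart n) {k : Fin (n - 1) → ℕ}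
    (hk : weight n k % n ≠ 0) :
    flatXTerm n x k = (-1) ^ (weight n k / n) * (∏ j, x.2 j ^ k j / ((k j).factorial : ℂ))
      * flatXFactor n k := by
  have hn0 : (0 : ℝ) < n := by positivity
  have hsum : ∑ j, k j ≠ 0 := fun h => hk (by
    have := weight_le n k
    rw [h, mul_zero, Nat.le_zero] at this
    rw [this, Nat.zero_mod])
  set s : ℝ := ((weight n k % n : ℕ) : ℝ) / n with hs
  have hs0 : 0 < s := by
    have : (0 : ℝ) < (weight n k % n : ℕ) := by exact_mod_cast Nat.pos_of_ne_zero hk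
    positivity
  have hs1 : s < 1 := by
    rw [hs, div_lt_one hn0]
    exact_mod_cast Nat.mod_lt _ (by omega)
  have hb : (weight n k : ℝ) / n = (weight n k / n : ℕ) + s := by
    have h1 : ((n * (weight n k / n) + weight n k % n : ℕ) : ℝ) = weight n k := by
      rw [Nat.div_add_mod]
    push_cast at h1
    rw [hs, ← h1]
    field_simp
  have hfr : Int.fract ((weight n k : ℝ) / n) = s := Int.fract_div_natCast_eq_div_natCast_mod
  have hfr' : Int.fract (-((weight n k : ℝ) / n)) = 1 - s := by
    rw [Int.fract_neg (by rw [hfr]; exact hs0.ne'), hfr]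
  have key := Gamma_quotients_eq hs0 hs1 (weight_div_lt hn hsum)
  rw [flatXTerm, DX0_eq hn, DXn_eq, Int.fract_sub_natCast, hfr, hfr', hb, mul_assoc,
    ← Complex.ofReal_mul, key, ← hb, flatXFactor]
  push_cast
  ring

theorem logRootTerm_eq {n : ℕ} (hn : 2 ≤ n) {κ : ℂ} (hκ : κ ^ n = -1) (x : Chart n)
    {k : Fin (n - 1) → ℕ} (hk : weight n k % n ≠ 0) :
    logRootTerm n κ x k = 1 / n * κ ^ (weight n k % n) * flatXTerm n x k := by
  have hsum : ∑ j, k j ≠ 0 := fun h => hk (by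
    have := weight_le n k
    rw [h, mul_zero, Nat.le_zero] at this
    rw [this, Nat.zero_mod])
  have h1 : κ ^ weight n k = (-1) ^ (weight n k / n) * κ ^ (weight n k % n) := by
    rw [← hκ, ← pow_mul, ← pow_add, Nat.div_add_mod]
  rw [logRootTerm, if_neg hsum, flatXTerm_eq hn x hk, h1]
  ring

/-- The exponents with `∑ i k_i` divisible by `n` do not contribute: the falling product contains
the factor `0`. -/
theorem logRootTerm_eq_zero {n : ℕ} (hn : 2 ≤ n) (κ : ℂ) (x : Chart n) {k : Fin (n - 1) → ℕ}
    (hk : weight n k % n = 0) : logRootTerm n κ x k = 0 := by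
  rw [logRootTerm]
  split_ifs with hsum
  · rfl
  have hn0 : (n : ℂ) ≠ 0 := by exact_mod_cast (by omega : n ≠ 0)
  obtain ⟨q, hq⟩ := Nat.dvd_of_mod_eq_zero hk
  have hqlt : q < ∑ j, k j := by
    have := weight_div_lt hn hsum
    rwa [hq, Nat.mul_div_cancel_left _ (by omega)] at this
  have hq0 : q ≠ 0 := by
    rintro rfl
    have h1 : ∑ j, k j ≤ weight n k := Finset.sum_le_sum fun j _ => by nlinarith [Nat.zero_le (k j)]
    omega
  rw [flatXFactor, Finset.prod_eq_zero (i := q - 1) (Finset.mem_range.2 (by omega)), mul_zero]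
  rw [hq, Nat.sub_add_cancel (by omega)]
  push_cast
  field_simp
  ring

theorem summable_flatXTerm_of_hasSum {n : ℕ} (hn : 2 ≤ n) {κ : ℂ} (hκ : κ ^ n = -1) {x : Chart n}
    {L : ℂ} (h : HasSum (logRootTerm n κ x) L) {r : ℕ} (hr : r ∈ Finset.Icc 1 (n - 1)) :
    Summable (fun k : FlatXIndex n r => flatXTerm n x k) := by
  have hr' := Finset.mem_Icc.1 hr
  have hn0 : (n : ℂ) ≠ 0 := by exact_mod_cast (by omega : n ≠ 0)
  have hκ0 : κ ≠ 0 := by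
    rintro rfl
    rw [zero_pow (by omega)] at hκ
    norm_num at hκ
  have h1 : Summable (fun k : FlatXIndex n r => logRootTerm n κ x k) := h.summable.subtype _
  have h2 : ∀ k : FlatXIndex n r,
      logRootTerm n κ x k = 1 / n * κ ^ r * flatXTerm n x k := fun k => by
    have hk := (fract_neg_DXn_eq_iff hn k.1 r).1 k.2
    rw [logRootTerm_eq hn hκ x (by omega), hk]
  simp only [h2] at h1
  exact (summable_mul_left_iff (mul_ne_zero (one_div_ne_zero hn0) (pow_ne_zero _ hκ0))).1 h1

/-- The expansion of the logarithm of a root of `W`, sorted by `∑ i k_i` modulo `n`. -/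
theorem eq_sum_flatX_of_hasSum {n : ℕ} (hn : 2 ≤ n) {κ : ℂ} (hκ : κ ^ n = -1) {x : Chart n}
    {L : ℂ} (h : HasSum (logRootTerm n κ x) L) :
    L = 1 / n * ∑ r ∈ Finset.Icc 1 (n - 1), κ ^ r * flatX n r x := by
  have h1 : ∀ r ∈ Finset.Icc 1 (n - 1),
      HasSum ({k | Int.fract (-DXn n k) = (r : ℝ) / n}.indicator (logRootTerm n κ x))
        (1 / n * κ ^ r * flatX n r x) := by
    intro r hr
    have hr' := Finset.mem_Icc.1 hr
    rw [← hasSum_subtype_iff_indicator, flatX, if_neg (by omega)]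
    have h2 := ((summable_flatXTerm_of_hasSum hn hκ h hr).hasSum).mul_left (1 / n * κ ^ r)
    refine h2.congr_fun ?_
    intro k
    have hk := (fract_neg_DXn_eq_iff hn k.1 r).1 k.2
    rw [Function.comp_apply, logRootTerm_eq hn hκ x (by omega), hk]
  have h2 := hasSum_sum h1
  have h3 : (fun k => ∑ r ∈ Finset.Icc 1 (n - 1),
      ({k | Int.fract (-DXn n k) = (r : ℝ) / n}.indicator (logRootTerm n κ x)) k)
      = logRootTerm n κ x := by
    funext k
    simp only [Set.indicator_apply, Set.mem_ofPred_eq, fract_neg_DXn_eq_iff hn]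
    rw [Finset.sum_ite_eq]
    split_ifs with hk
    · rfl
    · have := Nat.mod_lt (weight n k) (by omega : n > 0)
      rw [Finset.mem_Icc] at hk
      exact (logRootTerm_eq_zero hn κ x (by omega)).symm
  rw [h3] at h2
  rw [h.unique h2, Finset.mul_sum]
  exact Finset.sum_congr rfl fun r _ => by ring

/-! ### Continuation of the logarithms of the roots along the path -/

theorem xToY_ne_zero {n : ℕ} {x : Chart n} (hx : ∀ j, x.2 j ≠ 0) (j : Fin (n - 1)) :
    (xToY n x).2 j ≠ 0 := by
  have h := entry_one_ne_zero hx
  exact mul_ne_zero (mul_ne_zero (h _) (inv_ne_zero (pow_ne_zero _ (h _)))) (h _)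

theorem continuousAt_xToY {n : ℕ} {x : Chart n} (hx : ∀ j, x.2 j ≠ 0) :
    ContinuousAt (xToY n) x := by
  have h := entry_one_ne_zero hx
  have hc := fun k => (contDiff_entry n k 1).continuous.continuousAt (x := x)
  refine continuousAt_fst.prodMk (continuousAt_pi.2 fun j => ?_)
  exact ((hc _).mul (((hc _).pow 2).inv₀ (pow_ne_zero 2 (h _)))).mul (hc _)

/-- The local solutions of `exists_logRoot` at all points of the path, as one family. -/
theorem exists_logRoot_path {n : ℕ} (hn : 2 ≤ n) (j : ℕ) :
    ∃ U : ℝ → Chart n → ℂ, j < n → ∀ t ∈ Set.Ioc (0 : ℝ) 1,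
      AnalyticAt ℂ (U t) (path n t) ∧ U t (path n t) = pathLog n t j ∧
      ∀ᶠ v : Chart n × ℂ in 𝓝 (path n t, pathLog n t j),
        (WX n v.1).eval (-Complex.exp v.2) = 0 ↔ U t v.1 = v.2 := by
  by_cases hj : j < n
  · have h : ∀ t : ℝ, ∃ U : Chart n → ℂ, t ∈ Set.Ioc (0 : ℝ) 1 →
        AnalyticAt ℂ U (path n t) ∧ U (path n t) = pathLog n t j ∧
        ∀ᶠ v : Chart n × ℂ in 𝓝 (path n t, pathLog n t j),
          (WX n v.1).eval (-Complex.exp v.2) = 0 ↔ U v.1 = v.2 := by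
      intro t
      by_cases ht : t ∈ Set.Ioc (0 : ℝ) 1
      · obtain ⟨U, hU⟩ := exists_logRoot (eval_WX_path hn t hj) (separable_WX_path hn ht)
        exact ⟨U, fun _ => hU⟩
      · exact ⟨0, fun h => absurd h ht⟩
    choose U hU using h
    exact ⟨U, fun _ t ht => hU t ht⟩
  · exact ⟨0, fun h => absurd h hj⟩

/-- The logarithm, continued along the path, of the negative of the root of `W` with index `j`: for
each `t ∈ (0, 1]` an analytic function near `path n t`. -/
def logRoot {n : ℕ} (hn : 2 ≤ n) (j : ℕ) : ℝ → Chart n → ℂ := (exists_logRoot_path hn j).choose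

theorem analyticAt_logRoot {n : ℕ} (hn : 2 ≤ n) {j : ℕ} (hj : j < n) {t : ℝ}
    (ht : t ∈ Set.Ioc (0 : ℝ) 1) : AnalyticAt ℂ (logRoot hn j t) (path n t) :=
  ((exists_logRoot_path hn j).choose_spec hj t ht).1

theorem logRoot_path {n : ℕ} (hn : 2 ≤ n) {j : ℕ} (hj : j < n) {t : ℝ}
    (ht : t ∈ Set.Ioc (0 : ℝ) 1) : logRoot hn j t (path n t) = pathLog n t j :=
  ((exists_logRoot_path hn j).choose_spec hj t ht).2.1

theorem eventually_logRoot_iff {n : ℕ} (hn : 2 ≤ n) {j : ℕ} (hj : j < n) {t : ℝ}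
    (ht : t ∈ Set.Ioc (0 : ℝ) 1) :
    ∀ᶠ v : Chart n × ℂ in 𝓝 (path n t, pathLog n t j),
      (WX n v.1).eval (-Complex.exp v.2) = 0 ↔ logRoot hn j t v.1 = v.2 :=
  ((exists_logRoot_path hn j).choose_spec hj t ht).2.2

theorem tendsto_logRoot {n : ℕ} (hn : 2 ≤ n) {j : ℕ} (hj : j < n) {t : ℝ}
    (ht : t ∈ Set.Ioc (0 : ℝ) 1) : Tendsto (logRoot hn j t) (𝓝 (path n t)) (𝓝 (pathLog n t j)) := by
  have := (analyticAt_logRoot hn hj ht).continuousAt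
  rwa [ContinuousAt, logRoot_path hn hj ht] at this

theorem eventually_eval_logRoot {n : ℕ} (hn : 2 ≤ n) {j : ℕ} (hj : j < n) {t : ℝ}
    (ht : t ∈ Set.Ioc (0 : ℝ) 1) :
    ∀ᶠ x in 𝓝 (path n t), (WX n x).eval (-Complex.exp (logRoot hn j t x)) = 0 := by
  have h1 : Tendsto (fun x => (x, logRoot hn j t x)) (𝓝 (path n t))
      (𝓝 (path n t, pathLog n t j)) := tendsto_id.prodMk_nhds (tendsto_logRoot hn hj ht)
  filter_upwards [h1.eventually (eventually_logRoot_iff hn hj ht)] with x hx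
  exact hx.2 rfl

/-- The germs `logRoot hn j t` form an analytic continuation along the path: a logarithm of a root
that is close to the one with index `j` is determined. -/
theorem eventually_logRoot_eq {n : ℕ} (hn : 2 ≤ n) {j : ℕ} (hj : j < n) {t : ℝ}
    (ht : t ∈ Set.Ioc (0 : ℝ) 1) :
    ∀ᶠ s in 𝓝[Set.Ioc (0 : ℝ) 1] t, logRoot hn j s =ᶠ[𝓝 (path n s)] logRoot hn j t := by
  have h1 : Tendsto (fun s => (path n s, pathLog n s j)) (𝓝[Set.Ioc (0 : ℝ) 1] t)
      (𝓝 (path n t, pathLog n t j)) :=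
    (continuousOn_path n t ht).prodMk_nhds (continuousOn_pathLog n j t ht)
  filter_upwards [h1.eventually (eventually_logRoot_iff hn hj ht).eventually_nhds,
    self_mem_nhdsWithin] with s hs hs1
  have h2 : Tendsto (fun x => (x, logRoot hn j s x)) (𝓝 (path n s))
      (𝓝 (path n s, pathLog n s j)) := tendsto_id.prodMk_nhds (tendsto_logRoot hn hj hs1)
  filter_upwards [h2.eventually hs, eventually_eval_logRoot hn hj hs1] with x hx hx1
  exact (hx.1 hx1).symm

theorem eventually_norm_logRoot_sub_le {n : ℕ} (hn : 2 ≤ n) {t : ℝ}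
    (ht : t ∈ Set.Ioc (0 : ℝ) 1) {ε : ℝ} (hε : 0 < ε) :
    ∀ᶠ x in 𝓝 (path n t), ∀ j < n, ‖logRoot hn j t x - pathLog n t j‖ ≤ ε := by
  have h : ∀ j ∈ Finset.range n,
      ∀ᶠ x in 𝓝 (path n t), ‖logRoot hn j t x - pathLog n t j‖ ≤ ε := fun j hj => by
    have h1 := (tendsto_logRoot hn (Finset.mem_range.1 hj) ht).eventually
      (Metric.closedBall_mem_nhds _ hε)
    filter_upwards [h1] with x hx
    rwa [← mem_closedBall_iff_norm]
  filter_upwards [(Filter.eventually_all_finset _).2 h] with x hx j hj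
  exact hx j (Finset.mem_range.2 hj)

theorem eventually_norm_exp_logRoot_sub_le {n : ℕ} (hn : 2 ≤ n) {t : ℝ}
    (ht : t ∈ Set.Ioc (0 : ℝ) 1) {ε : ℝ} (hε : 0 < ε) :
    ∀ᶠ x in 𝓝 (path n t), ∀ j < n, ‖Complex.exp (logRoot hn j t x) - pathRoot n t j‖ ≤ ε := by
  have h : ∀ j ∈ Finset.range n,
      ∀ᶠ x in 𝓝 (path n t), ‖Complex.exp (logRoot hn j t x) - pathRoot n t j‖ ≤ ε := fun j hj => by
    have h1 := ((Complex.continuous_exp.tendsto _).comp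
      (tendsto_logRoot hn (Finset.mem_range.1 hj) ht)).eventually (Metric.closedBall_mem_nhds _ hε)
    filter_upwards [h1] with x hx
    rwa [← mem_closedBall_iff_norm]
  filter_upwards [(Filter.eventually_all_finset _).2 h] with x hx j hj
  exact hx j (Finset.mem_range.2 hj)

/-- The `n` continued roots remain distinct near the path, so they are all the roots. -/
theorem eventually_WX_eq_rootProd {n : ℕ} (hn : 2 ≤ n) {t : ℝ}
    (ht : t ∈ Set.Ioc (0 : ℝ) 1) :
    ∀ᶠ x in 𝓝 (path n t), WX n x = rootProd n (fun j => Complex.exp (logRoot hn j t x)) := by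
  have h1 : ∀ j ∈ Finset.range n, ∀ k ∈ Finset.range n, ∀ᶠ x in 𝓝 (path n t),
      Complex.exp (logRoot hn j t x) = Complex.exp (logRoot hn k t x) → j = k := by
    intro j hj k hk
    by_cases hjk : j = k
    · exact Eventually.of_forall fun _ _ => hjk
    have h2 : ∀ l ∈ Finset.range n, Tendsto (fun x => Complex.exp (logRoot hn l t x))
        (𝓝 (path n t)) (𝓝 (pathRoot n t l)) := fun l hl =>
      (Complex.continuous_exp.tendsto _).comp (tendsto_logRoot hn (Finset.mem_range.1 hl) ht)
    have h3 : pathRoot n t j ≠ pathRoot n t k := fun h =>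
      hjk (injOn_pathRoot hn ht (by simpa using hj) (by simpa using hk) h)
    filter_upwards [((h2 j hj).sub (h2 k hk)).eventually_ne (sub_ne_zero.2 h3)] with x hx h
    exact absurd (sub_eq_zero.2 h) hx
  have h2 : ∀ j ∈ Finset.range n, ∀ᶠ x in 𝓝 (path n t),
      (WX n x).eval (-Complex.exp (logRoot hn j t x)) = 0 := fun j hj =>
    eventually_eval_logRoot hn (Finset.mem_range.1 hj) ht
  filter_upwards [(Filter.eventually_all_finset _).2 fun j hj =>
    (Filter.eventually_all_finset _).2 (h1 j hj), (Filter.eventually_all_finset _).2 h2]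
    with x hx1 hx2
  exact WX_eq_rootProd hn x (fun j hj k hk h => hx1 j (by simpa using hj) k (by simpa using hk) h)
    fun j hj => hx2 j (Finset.mem_range.2 hj)

theorem eventually_hasSum_logRootTerm {n : ℕ} (hn : 2 ≤ n) {i : ℕ} (hi : i < n) :
    ∀ᶠ x in 𝓝 (0 : Chart n),
      HasSum (logRootTerm n (-pathRoot n 1 i) x) (logRoot hn i 1 x - pathLog n 1 i) := by
  obtain ⟨R, hR, hR2, hsep⟩ := exists_isolating_radius hn hi
  have h1 : (1 : ℝ) ∈ Set.Ioc (0 : ℝ) 1 := ⟨zero_lt_one, le_rfl⟩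
  have hn0 : (0 : ℝ) < n := by positivity
  have hx : ∀ᶠ x in 𝓝 (0 : Chart n), ∀ j, n * ‖x.2 j‖ * (2 / R) ^ n ≤ 1 / 2 := by
    refine Filter.eventually_all.2 fun j => ?_
    have hc : Continuous fun x : Chart n => n * ‖x.2 j‖ * (2 / R) ^ n := by fun_prop
    have := (hc.tendsto 0).eventually_le_const (u := 1 / 2) (by simp)
    exact this
  have e1 := eventually_WX_eq_rootProd hn h1
  have e2 := eventually_norm_exp_logRoot_sub_le hn h1 (show 0 < R / (2 * n) by positivity)
  have e3 := eventually_norm_logRoot_sub_le hn h1 one_pos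
  rw [path_one hn] at e1 e2 e3
  filter_upwards [hx, e1, e2, e3] with x hx e1 e2 e3
  exact hasSum_logRootTerm hn hi hR hR2 hsep hx (U := fun j => logRoot hn j 1 x) e1 e2 (e3 i hi)

/-- `exists_flatY_eq_sub` for the germs `logRoot`. -/
theorem eventually_eq_logRoot_sub {n : ℕ} (hn : 2 ≤ n) {g : ℕ → Chart n → ℂ} (hg : IsFlatY n g)
    {i : ℕ} (hi : i + 1 < n) :
    ∀ᶠ t in 𝓝[>] (0 : ℝ), ∀ᶠ x in 𝓝 (path n t),
      g (i + 1) (xToY n x) = logRoot hn i t x - logRoot hn (i + 1) t x := by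
  obtain ⟨τ, hτ, hflat⟩ := exists_flatY_eq_sub hn
  obtain ⟨δ, hδ, hgf⟩ := hg.eq_flatY hn
  have hp := isPathYX_path hn
  have h1 : ∀ᶠ t in 𝓝[>] (0 : ℝ), t < min τ 1 :=
    eventually_nhdsWithin_of_eventually_nhds (eventually_lt_nhds (lt_min hτ one_pos))
  have h2 : ∀ᶠ t in 𝓝[>] (0 : ℝ), ‖xToY n (path n t)‖ < δ := by
    have := hp.start.eventually (Metric.ball_mem_nhds 0 hδ)
    simpa only [Metric.mem_ball, dist_zero_right] using this
  filter_upwards [h1, h2, hp.torus, self_mem_nhdsWithin] with t h1 h2 h3 h4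
  have ht : t ∈ Set.Ioc (0 : ℝ) 1 := ⟨h4, (h1.trans_le (min_le_right _ _)).le⟩
  have hne : ∀ᶠ x in 𝓝 (path n t), ∀ j, x.2 j ≠ 0 := by
    refine Filter.eventually_all.2 fun j => ?_
    have hc : Continuous fun x : Chart n => x.2 j := by fun_prop
    exact hc.continuousAt.eventually_ne (h3 j).1
  have hcont : ContinuousAt (xToY n) (path n t) := continuousAt_xToY fun j => (h3 j).1
  have hlt : ∀ᶠ x in 𝓝 (path n t), ‖xToY n x‖ < δ := hcont.norm.eventually_lt_const h2
  filter_upwards [hne, hlt, eventually_WX_eq_rootProd hn ht,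
    eventually_norm_logRoot_sub_le hn ht (ε := 1 / 2) (by norm_num)] with x hx1 hx2 hx3 hx4
  rw [hgf _ (fun j => ⟨xToY_ne_zero hx1 j, ?_⟩) _ ⟨by omega, hi⟩,
    hflat t h4 (h1.trans_le (min_le_left _ _)) x (fun j => logRoot hn j t x) hx3 hx4 hx1 i hi]
  exact (norm_le_pi_norm _ j).trans_lt ((norm_snd_le _).trans_lt hx2)

theorem neg_pathRoot_one {n : ℕ} (hn : 2 ≤ n) (j : ℕ) :
    -pathRoot n 1 j = Complex.exp (Real.pi * Complex.I / n) ^ (2 * j + 1) := by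
  have hn0 : (n : ℂ) ≠ 0 := by exact_mod_cast (by omega : n ≠ 0)
  have h1 : -(1 : ℂ) = Complex.exp (Real.pi * Complex.I) := Complex.exp_pi_mul_I.symm
  rw [neg_eq_neg_one_mul, h1, pathRoot, ← Complex.exp_add, ← Complex.exp_nat_mul]
  congr 1
  simp only [pathLog, pathArg, Real.log_one]
  push_cast
  field_simp
  ring

theorem pathLog_one_sub {n : ℕ} (j : ℕ) :
    pathLog n 1 j - pathLog n 1 (j + 1) = -(2 * Real.pi * Complex.I / n) := by
  simp only [pathLog, pathArg, Real.log_one]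
  push_cast
  ring

end TypeACrepant

end

theorem propositionA6 (n : ℕ) (hn : 2 ≤ n) :
    -- the series of the flat coordinates of `[ℂ²/ℤ_n]` converge near the large-radius limit point
    (∀ᶠ x in 𝓝 (0 : TypeACrepant.Chart n), ∀ r ∈ Finset.Icc 1 (n - 1),
      Summable (fun k : TypeACrepant.FlatXIndex n r => TypeACrepant.flatXTerm n x k)) ∧
    -- the flat coordinates of `Y` exist
    (∃ g, TypeACrepant.IsFlatY n g) ∧
    -- continuation along a suitable path
    ∃ p : ℝ → TypeACrepant.Chart n, TypeACrepant.IsPathYX n p ∧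
      ∀ g, TypeACrepant.IsFlatY n g → ∀ i ∈ Finset.Icc 1 (n - 1),
        ∃ F : ℝ → TypeACrepant.Chart n → ℂ,
          TypeACrepant.IsContinuationAlong n p F ∧
          (∀ᶠ t in 𝓝[>] (0 : ℝ),
            F t =ᶠ[𝓝 (p t)] fun x => g i (TypeACrepant.xToY n x)) ∧
          ∀ ζ : ℂ, ζ = Complex.exp (Real.pi * Complex.I / n) →
            F 1 =ᶠ[𝓝 0] fun x =>
              -(2 * Real.pi * Complex.I / n)
                + 1 / n * ∑ k ∈ Finset.Icc 1 (n - 1),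
                    ζ ^ (2 * k * i) * ((ζ ^ k)⁻¹ - ζ ^ k) * TypeACrepant.flatX n k x := by
  have key := fun i (hi : i < n) => TypeACrepant.eventually_hasSum_logRootTerm hn hi
  refine ⟨?_, ⟨_, TypeACrepant.isFlatY_flatY hn⟩, TypeACrepant.path n,
    TypeACrepant.isPathYX_path hn, fun g hg i hi => ?_⟩
  · filter_upwards [key 0 (by omega)] with x hx r hr
    exact TypeACrepant.summable_flatXTerm_of_hasSum hn
      (TypeACrepant.neg_pathRoot_one_pow hn 0) hx hr
  have hi' := Finset.mem_Icc.1 hi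
  obtain ⟨l, rfl⟩ : ∃ l, i = l + 1 := ⟨i - 1, by omega⟩
  have hl : l < n := by omega
  have hl1 : l + 1 < n := by omega
  refine ⟨fun t x => TypeACrepant.logRoot hn l t x - TypeACrepant.logRoot hn (l + 1) t x,
    fun t ht => ⟨(TypeACrepant.analyticAt_logRoot hn hl ht).sub
      (TypeACrepant.analyticAt_logRoot hn hl1 ht), ?_⟩, ?_, ?_⟩
  · filter_upwards [TypeACrepant.eventually_logRoot_eq hn hl ht,
      TypeACrepant.eventually_logRoot_eq hn hl1 ht] with s h1 h2
    exact h1.sub h2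
  · filter_upwards [TypeACrepant.eventually_eq_logRoot_sub hn hg hl1] with t ht
    filter_upwards [ht] with x hx
    exact hx.symm
  · rintro ζ rfl
    set ζ := Complex.exp (Real.pi * Complex.I / n)
    have hζ : ζ ≠ 0 := Complex.exp_ne_zero _
    filter_upwards [key l hl, key (l + 1) hl1] with x h1 h2
    have e1 := TypeACrepant.eq_sum_flatX_of_hasSum hn (TypeACrepant.neg_pathRoot_one_pow hn l) h1
    have e2 := TypeACrepant.eq_sum_flatX_of_hasSum hn
      (TypeACrepant.neg_pathRoot_one_pow hn (l + 1)) h2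
    rw [TypeACrepant.neg_pathRoot_one hn] at e1 e2
    have e3 : ∀ k : ℕ, ζ ^ (2 * k * (l + 1)) * ((ζ ^ k)⁻¹ - ζ ^ k)
        = (ζ ^ (2 * l + 1)) ^ k - (ζ ^ (2 * (l + 1) + 1)) ^ k := by
      intro k
      have h3 : ζ ^ (2 * k * (l + 1)) = (ζ ^ (2 * l + 1)) ^ k * ζ ^ k := by ring
      have h4 : (ζ ^ (2 * (l + 1) + 1)) ^ k = (ζ ^ (2 * l + 1)) ^ k * ζ ^ k * ζ ^ k := by ring
      rw [h3, h4]
      field_simp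
    simp only [e3, sub_mul, Finset.sum_sub_distrib, mul_sub]
    linear_combination e1 - e2 + TypeACrepant.pathLog_one_sub (n := n) l
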